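/- Let $\{p_k\}_{k\ge 0}$ be an offspring distribution with $p_0=0$, mean $m=\sum_k kp_k>1$ and $\sum_k\beta^kp_k<\infty$ for some $\beta>1$. Let $\mathtt{GW}$ be the law of the rooted Galton--Watson tree with offspring distribution $\{p_k\}$. Let $\mathtt{IGWR}$ be the law of the random infinite tree $\mathcal T$ with root $o=v_0$ and a marked ray $v_0,v_1,v_2,\dots$, in which $v_{j}$ is one of the offspring of $v_{j+1}$ for every $j\ge 0$ (all other offspring of the vertices of the ray being off the ray), and in which the numbers of offspring $d_v$ of the vertices are independent, with $P(d_{v_j}=k)=kp_k/m$ for $j\ge1$, $P(d_o=k)=(m+k)p_k/(2m)$, and $P(d_v=k)=p_k$ for every other vertex $v$. For a vertex $v$ let $Z_n(v)$ be the number of descendants of $v$ that are $n$ generations below $v$, and let $W_v=\lim_{n\to\infty}Z_n(v)/m^n$ (the limit exists almost surely for all $v$, under $\mathtt{GW}$ and under $\mathtt{IGWR}$). For a tree $\mathcal T$ with marked ray let $P^o_{\mathcal T}$ be the law of the Markov chain $(X_t)_{t\ge0}$ on the vertices of $\mathcal T$ with $X_0=o$ that moves from $v$ to the parent of $v$ with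 probability $m/(m+d_v)$ and to each offspring of $v$ with probability $1/(m+d_v)$. Put $M_0=0$ and, for $X_t=v$, $$M_{t+1}-M_t=\begin{cases}-W_v,&X_{t+1}\text{ is the parent of }v,\\ W_{X_{t+1}},&X_{t+1}\text{ is an offspring of }v,\end{cases}$$ and let $$V_t=\frac1t\sum_{i=1}^tE^o_{\mathcal T}\big((M_{i+1}-M_i)^2\,\big|\,\mathcal F_i\big),\qquad \mathcal F_i=\sigma(X_1,\dots,X_i).$$ Finally let $$\mu_o^2=\frac1{m+d_o}\sum_{j=1}^{d_o}W_{Y_j}^2+\frac1{m(m+d_o)}\Big(\sum_{j=1}^{d_o}W_{Y_j}\Big)^2,$$ where $Y_1,\dots,Y_{d_o}$ are the offspring of $o$, and $\eta=E_{\mathtt{GW}}W_o^2$. Then $0<\eta<\infty$, $E_{\mathtt{IGWR}}\,\mu_o^2<\infty$, the increments of $M$ are square integrable under $P^o_{\mathcal T}$ for every $\mathcal T$ (with $W_v$ given an arbitrary finite value where the limit does not exist), and for $\mathtt{IGWR}$-almost every $\mathcal T$, $$V_t\longrightarrow E_{\mathtt{IGWR}}\,\mu_o^2=\sigma^2\eta^2\qquad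 P^o_{\mathcal T}\text{-almost surely as }t\to\infty,$$ where $\sigma^2$ is defined by the last equality. -/

import Mathlib

open MeasureTheory ProbabilityTheory Filter Topology

noncomputable section

namespace GWRay

/-- An offspring distribution `(p_k)` on `ℕ` with `p_0 = 0`, mean `m = ∑ k p_k > 1`
and a finite exponential moment `∑ β^k p_k < ∞` for some `β > 1`. -/
structure OffspringLaw where
  /-- the probabilities `p_k` -/
  prob : ℕ → ℝ
  nonneg : ∀ k, 0 ≤ prob k
  hasSum_one : HasSum prob 1
  prob_zero : prob 0 = 0
  one_lt_mean : 1 < ∑' k : ℕ, (k : ℝ) * prob k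
  exp_moment : ∃ β : ℝ, 1 < β ∧ Summable (fun k : ℕ => β ^ k * prob k)

namespace OffspringLaw

/-- The mean `m = ∑ k p_k`. -/
def mean (p : OffspringLaw) : ℝ := ∑' k : ℕ, (k : ℝ) * p.prob k

theorem mean_pos (p : OffspringLaw) : 0 < p.mean := lt_trans one_pos p.one_lt_mean

theorem hasSum_mean (p : OffspringLaw) : HasSum (fun k : ℕ => (k : ℝ) * p.prob k) p.mean := by
  refine Summable.hasSum ?_
  by_contra h
  have h1 := p.one_lt_mean
  rw [tsum_eq_zero_of_not_summable h] at h1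
  linarith

end OffspringLaw

/-- The measure on `ℕ` with weights `q k`. -/
def lawOf (q : ℕ → ℝ) : Measure ℕ :=
  Measure.sum (fun k => ENNReal.ofReal (q k) • Measure.dirac k)

theorem isProbabilityMeasure_lawOf {q : ℕ → ℝ} (h0 : ∀ k, 0 ≤ q k) (h1 : HasSum q 1) :
    IsProbabilityMeasure (lawOf q) := by
  constructor
  rw [lawOf, Measure.sum_apply _ MeasurableSet.univ]
  simp only [Measure.smul_apply, measure_univ, smul_eq_mul, mul_one]
  rw [← ENNReal.ofReal_tsum_of_nonneg h0 h1.summable, h1.tsum_eq, ENNReal.ofReal_one]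

namespace OffspringLaw

/-- The offspring law `P(d = k) = p_k`. -/
def ordinary (p : OffspringLaw) : Measure ℕ := lawOf p.prob

/-- The size-biased offspring law `P(d = k) = k p_k / m`. -/
def sizeBiased (p : OffspringLaw) : Measure ℕ := lawOf (fun k => k * p.prob k / p.mean)

/-- The average `P(d = k) = (m + k) p_k / (2m)` of the two laws above. -/
def averaged (p : OffspringLaw) : Measure ℕ :=
  lawOf (fun k => (p.mean + k) * p.prob k / (2 * p.mean))

instance (p : OffspringLaw) : IsProbabilityMeasure p.ordinary :=
  isProbabilityMeasure_lawOf p.nonneg p.hasSum_one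

instance (p : OffspringLaw) : IsProbabilityMeasure p.sizeBiased := by
  refine isProbabilityMeasure_lawOf
    (fun k => div_nonneg (mul_nonneg k.cast_nonneg (p.nonneg k)) p.mean_pos.le) ?_
  have h := p.hasSum_mean.div_const p.mean
  rwa [div_self p.mean_pos.ne'] at h

instance (p : OffspringLaw) : IsProbabilityMeasure p.averaged := by
  have hm := p.mean_pos
  refine isProbabilityMeasure_lawOf (fun k => div_nonneg (mul_nonneg
    (add_nonneg hm.le k.cast_nonneg) (p.nonneg k)) (by positivity)) ?_
  have h := ((p.hasSum_one.mul_left p.mean).add p.hasSum_mean).div_const (2 * p.mean)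
  have e : (p.mean * 1 + p.mean) / (2 * p.mean) = 1 := by field_simp; ring
  rw [e] at h
  simpa only [add_mul] using h

end OffspringLaw

/-! ### Rooted Galton-Watson trees -/

/-- A rooted plane tree: every word is assigned its number of offspring.  The root is `[]`, and the
offspring of a vertex `w` are `i :: w` with `i` less than the number assigned to `w`. -/
abbrev RootedTree := List ℕ → ℕ

/-- The vertices at distance `n` from the root. -/
def RootedTree.generation (τ : RootedTree) : ℕ → Finset (List ℕ)
  | 0 => {[]}
  | n + 1 => (RootedTree.generation τ n).biUnion
      (fun w => (Finset.range (τ w)).image (fun i => i :: w))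

/-- The limit `W_o` of `Z_n(o) / m^n` for the root `o` of a rooted tree. -/
def rootW (p : OffspringLaw) (τ : RootedTree) : ℝ :=
  limUnder atTop (fun n : ℕ => ((τ.generation n).card : ℝ) / p.mean ^ n)

/-- The law `GW` of Galton-Watson trees: independent numbers of offspring with law `(p_k)`. -/
def GW (p : OffspringLaw) : Measure RootedTree :=
  Measure.infinitePi (fun _ : List ℕ => p.ordinary)

/-- `η = E_GW W_o ^ 2`. -/
def eta (p : OffspringLaw) : ℝ := ∫ τ, rootW p τ ^ 2 ∂(GW p)

/-! ### Trees with a marked ray -/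

/-- Vertex labels of a tree with a marked ray `v_0, v_1, v_2, …` from the root `o = v_0`:
`⟨j, []⟩` is the ray vertex `v_j`, and `⟨j, w⟩` is the vertex reached from `v_j` by leaving the
ray and following the word `w`, whose last step is written first. -/
@[ext]
structure Vertex where
  /-- the index of the closest vertex of the ray -/
  ray : ℕ
  /-- the path from that vertex -/
  path : List ℕ

instance : DecidableEq Vertex := Classical.decEq _

instance : Countable Vertex :=
  Function.Injective.countable (f := fun v : Vertex => (v.ray, v.path)) (by
    rintro ⟨a, b⟩ ⟨c, d⟩ h
    simpa using h)

instance : MeasurableSpace Vertex := ⊤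

instance : DiscreteMeasurableSpace Vertex := ⟨fun _ => trivial⟩

/-- The root `o`. -/
def root : Vertex := ⟨0, []⟩

/-- The parent of a vertex; the parent of `v_j` is `v_{j+1}`. -/
def parent : Vertex → Vertex
  | ⟨j, []⟩ => ⟨j + 1, []⟩
  | ⟨j, _ :: w⟩ => ⟨j, w⟩

/-- A tree with a marked ray, given by the number of offspring of every vertex.  (Only the labels
reachable from the root by `parent` and `offspring` below are vertices of the tree.) -/
abbrev RayTree := Vertex → ℕ

/-- The offspring of a vertex.  One of the offspring of `v_{j+1}` is `v_j`; its other ones, and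
all offspring of the vertices that are not among `v_1, v_2, …`, are off the ray. -/
def offspring (T : RayTree) : Vertex → Finset Vertex
  | ⟨0, []⟩ => (Finset.range (T ⟨0, []⟩)).image (fun i => ⟨0, [i]⟩)
  | ⟨j + 1, []⟩ =>
      insert ⟨j, []⟩ ((Finset.range (T ⟨j + 1, []⟩ - 1)).image (fun i => ⟨j + 1, [i]⟩))
  | ⟨j, k :: w⟩ => (Finset.range (T ⟨j, k :: w⟩)).image (fun i => ⟨j, i :: k :: w⟩)

/-- The number `d_v` of offspring of `v`. -/
def deg (T : RayTree) (v : Vertex) : ℕ := (offspring T v).card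

/-- The number of offspring of `v` is the number assigned to it (a positive one, if `v` is one of
`v_1, v_2, …`). -/
theorem deg_eq (T : RayTree) (v : Vertex) (h : T v ≠ 0) : deg T v = T v := by
  rcases v with ⟨_ | j, _ | ⟨k, w⟩⟩
  · rw [deg, offspring, Finset.card_image_of_injective _ (fun a b h => by simpa using h),
      Finset.card_range]
  · rw [deg, offspring, Finset.card_image_of_injective _ (fun a b h => by simpa using h),
      Finset.card_range]
  · rw [deg, offspring, Finset.card_insert_of_notMem (by simp),
      Finset.card_image_of_injective _ (fun a b h => by simpa using h), Finset.card_range]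
    omega
  · rw [deg, offspring, Finset.card_image_of_injective _ (fun a b h => by simpa using h),
      Finset.card_range]

/-- The set `D_n(v)` of descendants of `v` at distance `n` from `v`. -/
def descendants (T : RayTree) (v : Vertex) : ℕ → Finset Vertex
  | 0 => {v}
  | n + 1 => (descendants T v n).biUnion (offspring T)

/-- `Z_n(v) = |D_n(v)|`. -/
def Z (T : RayTree) (v : Vertex) (n : ℕ) : ℕ := (descendants T v n).card

/-- `W_v`, the limit of `Z_n(v) / m^n`. -/
def W (p : OffspringLaw) (T : RayTree) (v : Vertex) : ℝ :=
  limUnder atTop (fun n : ℕ => (Z T v n : ℝ) / p.mean ^ n)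

/-- The law of the number of offspring of each vertex under `IGWR`. -/
def offspringLawAt (p : OffspringLaw) : Vertex → Measure ℕ
  | ⟨0, []⟩ => p.averaged
  | ⟨_ + 1, []⟩ => p.sizeBiased
  | ⟨_, _ :: _⟩ => p.ordinary

instance (p : OffspringLaw) (v : Vertex) : IsProbabilityMeasure (offspringLawAt p v) := by
  rcases v with ⟨_ | j, _ | ⟨k, w⟩⟩ <;> rw [offspringLawAt] <;> infer_instance

/-- The measure `IGWR`: all numbers of offspring are independent, size-biased at `v_1, v_2, …`,
with the averaged law at the root, and with the law `(p_k)` at all other vertices. -/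
def IGWR (p : OffspringLaw) : Measure RayTree := Measure.infinitePi (offspringLawAt p)

instance (p : OffspringLaw) : IsProbabilityMeasure (GW p) := by rw [GW]; infer_instance

instance (p : OffspringLaw) : IsProbabilityMeasure (IGWR p) := by rw [IGWR]; infer_instance

/-! ### The biased random walk -/

/-- One step of the `m`-biased walk from `v`: to the parent with probability `m / (m + d_v)`, and
to each offspring with probability `1 / (m + d_v)`. -/
def stepMeasure (p : OffspringLaw) (T : RayTree) (v : Vertex) : Measure Vertex :=
  ENNReal.ofReal (p.mean / (p.mean + deg T v)) • Measure.dirac (parent v) +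
    ∑ u ∈ offspring T v, ENNReal.ofReal (1 / (p.mean + deg T v)) • Measure.dirac u

instance (p : OffspringLaw) (T : RayTree) (v : Vertex) :
    IsProbabilityMeasure (stepMeasure p T v) := by
  have hm := p.mean_pos
  constructor
  simp only [stepMeasure, Measure.add_apply, Measure.smul_apply, Measure.coe_finsetSum,
    Finset.sum_apply, measure_univ, smul_eq_mul, mul_one, Finset.sum_const, nsmul_eq_mul]
  rw [← deg, ← ENNReal.ofReal_natCast, ← ENNReal.ofReal_mul (by positivity),
    ← ENNReal.ofReal_add (by positivity) (by positivity), ← ENNReal.ofReal_one]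
  congr 1
  field_simp

/-- The transition kernel of the walk. -/
def stepKernel (p : OffspringLaw) (T : RayTree) : Kernel Vertex Vertex :=
  ⟨stepMeasure p T, measurable_of_countable _⟩

instance (p : OffspringLaw) (T : RayTree) : IsMarkovKernel (stepKernel p T) :=
  ⟨fun v => inferInstanceAs (IsProbabilityMeasure (stepMeasure p T v))⟩

/-- Trajectories `(X_0, X_1, …)` of the walk. -/
abbrev Trajectory := ℕ → Vertex

/-- The quenched law `P_T^o`: the law of the Markov chain `(X_t)` with `X_0 = o` and transition
kernel `stepKernel`. -/
def quenched (p : OffspringLaw) (T : RayTree) : Measure Trajectory :=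
  Kernel.traj (X := fun _ => Vertex)
    (fun n => (stepKernel p T).comap
      (fun x : (i : Finset.Iic n) → Vertex => x ⟨n, Finset.mem_Iic.2 le_rfl⟩)
      (measurable_pi_apply _)) 0 (fun _ => root)

instance (p : OffspringLaw) (T : RayTree) : IsProbabilityMeasure (quenched p T) := by
  rw [quenched]; infer_instance

/-- The process `M_t`: `M_0 = 0`, and `M_{t+1} - M_t` is `-W_{X_t}` if the walk goes to the parent
of `X_t` at time `t + 1`, and `W_{X_{t+1}}` if it goes to an offspring of `X_t`. -/
def M (p : OffspringLaw) (T : RayTree) : ℕ → Trajectory → ℝ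
  | 0, _ => 0
  | t + 1, X => M p T t X +
      if X (t + 1) = parent (X t) then -W p T (X t)
      else if X (t + 1) ∈ offspring T (X t) then W p T (X (t + 1)) else 0

/-- The σ-algebra `F_t = σ(X_1, …, X_t)`. -/
abbrev pastSigma (t : ℕ) : MeasurableSpace Trajectory :=
  ⨆ s ∈ Finset.Icc 1 t, MeasurableSpace.comap (fun X : Trajectory => X s) inferInstance

/-- The normalized quadratic variation
`V_t = t⁻¹ ∑_{i=1}^t E_T^o((M_{i+1} - M_i)^2 | F_i)`. -/
def V (p : OffspringLaw) (T : RayTree) (t : ℕ) (X : Trajectory) : ℝ :=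
  (1 / (t : ℝ)) * ∑ i ∈ Finset.Icc 1 t,
    ((quenched p T)[fun Y => (M p T (i + 1) Y - M p T i Y) ^ 2 | pastSigma i]) X

/-- `μ_v ^ 2 = (m + d_v)⁻¹ ∑_j W_{Y_j}^2 + (m (m + d_v))⁻¹ (∑_j W_{Y_j})^2`, where the `Y_j` are
the offspring of `v`. -/
def muSq (p : OffspringLaw) (T : RayTree) (v : Vertex) : ℝ :=
  1 / (p.mean + deg T v) * ∑ u ∈ offspring T v, W p T u ^ 2 +
    1 / (p.mean * (p.mean + deg T v)) * (∑ u ∈ offspring T v, W p T u) ^ 2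

/-- `σ^2`, defined by `σ^2 η^2 = E_IGWR μ_o^2`. -/
def sigmaSq (p : OffspringLaw) : ℝ := (∫ T, muSq p T root ∂(IGWR p)) / eta p ^ 2

end GWRay

end

/-! For almost every tree `W` satisfies `W_v = m⁻¹ ∑ W_u`, the sum running over the offspring `u` of
`v`. The step to the parent therefore contributes exactly the second term of `μ_v²`, and the
conditional variance of the `i`-th increment of `M` is `μ²` at `X_i` (`condExp_increment_sq`). Thus
`V_t` is a time average of `μ²` along the walk, and an ergodic theorem for the tree seen from the
walk is needed.

That tree is a Markov chain once each ray vertex records the position of its ray child among its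
offspring. With this record, `up` (reroot at `v_1`) and `down i` (reroot at the `i`-th child) undo
each other. Let `μ` be the law `envLaw p p.ordinary`, whose root has offspring law `p`. Under `μ`,
summing over the steps to the children equals `m` times the step seen backwards from the child
(`lintegral_sum_down`). Weighting `μ` by `(m + d_o) / (2m)` gives the enriched `IGWR` law `ν`, and
the flux identity makes the environment chain reversible under `ν` (`compProd_envKernel`).

Ergodicity has two ingredients. A square integrable harmonic function has zero Dirichlet energy,
hence is invariant under `up` (`ae_eq_const_of_harmonic`). And `up` is ergodic under `μ`
(`quasiErgodic_up`): far up, the tree is independent of any finite set of vertices, while the image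
of `μ` under `up^[n]` has density `Z_n / m^n`, bounded in `L²` uniformly in `n`.

The ergodic theorem `ae_tendsto_average_chainLaw` then follows. By Hilbert space duality centred
functions are `L¹` limits of coboundaries `g - K g`. Averages of coboundaries vanish almost surely,
as martingale differences plus a telescoping sum, and the maximal inequality controls the
approximation error. Integrability of `μ_o²` reduces to `W ∈ L²`, which comes from the geometric
decay of the increments of `Z_n / m^n`. -/

open scoped ENNReal symmDiff

/-! ### Product measures: resampling a coordinate, independence, approximation by cylinders. -/

section ProductMeasures

variable {ι : Type*} {X : ι → Type*} [∀ i, MeasurableSpace (X i)]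

/-- One-coordinate Fubini: the law of a single vertex can be changed or integrated out while the
rest of the tree keeps its law. On boxes the coordinate `i` factors off. -/
theorem map_update_infinitePi [DecidableEq ι] {P P' : (i : ι) → Measure (X i)}
    [∀ i, IsProbabilityMeasure (P i)] [∀ i, IsProbabilityMeasure (P' i)] (i : ι)
    (h : ∀ j, j ≠ i → P j = P' j) :
    ((Measure.infinitePi P).prod (P' i)).map (fun q => Function.update q.1 i q.2) =
      Measure.infinitePi P' := by
  have hm : Measurable (fun q : (∀ i, X i) × X i => Function.update q.1 i q.2) :=
    measurable_update'
  refine Measure.eq_infinitePi _ fun s t ht => ?_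
  rw [Measure.map_apply hm (MeasurableSet.pi s.countable_toSet fun i _ => ht i)]
  have e : (fun q : (∀ i, X i) × X i => Function.update q.1 i q.2) ⁻¹' (Set.pi s t) =
      (Set.pi (s.erase i : Finset ι) t) ×ˢ (if i ∈ s then t i else Set.univ) := by
    ext ⟨x, y⟩
    simp only [Set.mem_preimage, Set.mem_pi, Finset.mem_coe, Set.mem_prod, Finset.mem_erase]
    constructor
    · intro hx
      refine ⟨fun j hj => by simpa [hj.1] using hx j hj.2, ?_⟩
      split_ifs with his
      · simpa using hx i his
      · trivial
    · rintro ⟨h1, h2⟩ j hj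
      by_cases hji : j = i
      · subst hji
        simpa [hj] using h2
      · simpa [hji] using h1 j ⟨hji, hj⟩
  rw [e, Measure.prod_prod, Measure.infinitePi_pi P (fun i _ => ht i)]
  split_ifs with his
  · rw [← Finset.prod_erase_mul s _ his]
    congr 1
    exact Finset.prod_congr rfl fun j hj => by rw [h j (Finset.ne_of_mem_erase hj)]
  · rw [measure_univ, mul_one, Finset.erase_eq_of_notMem his]
    exact Finset.prod_congr rfl fun j hj => by rw [h j (fun e => his (e ▸ hj))]

theorem lintegral_infinitePi_update [DecidableEq ι] {P P' : (i : ι) → Measure (X i)}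
    [∀ i, IsProbabilityMeasure (P i)] [∀ i, IsProbabilityMeasure (P' i)] (i : ι)
    (h : ∀ j, j ≠ i → P j = P' j) {f : (∀ i, X i) → ℝ≥0∞} (hf : Measurable f) :
    ∫⁻ s, f s ∂(Measure.infinitePi P') =
      ∫⁻ s, ∫⁻ x, f (Function.update s i x) ∂(P' i) ∂(Measure.infinitePi P) := by
  have hm : Measurable (fun q : (∀ i, X i) × X i => Function.update q.1 i q.2) :=
    measurable_update'
  rw [← map_update_infinitePi i h, lintegral_map hf hm,
    lintegral_prod (fun q : (∀ i, X i) × X i => f (Function.update q.1 i q.2))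
      (hf.comp hm).aemeasurable]

theorem lintegral_infinitePi_update_symm [DecidableEq ι] {P P' : (i : ι) → Measure (X i)}
    [∀ i, IsProbabilityMeasure (P i)] [∀ i, IsProbabilityMeasure (P' i)] (i : ι)
    (h : ∀ j, j ≠ i → P j = P' j) {f : (∀ i, X i) → ℝ≥0∞} (hf : Measurable f) :
    ∫⁻ s, f s ∂(Measure.infinitePi P') =
      ∫⁻ x, ∫⁻ s, f (Function.update s i x) ∂(Measure.infinitePi P) ∂(P' i) := by
  have hm : Measurable (fun q : (∀ i, X i) × X i => Function.update q.1 i q.2) :=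
    measurable_update'
  rw [← map_update_infinitePi i h, lintegral_map hf hm,
    lintegral_prod_symm (fun q : (∀ i, X i) × X i => f (Function.update q.1 i q.2))
      (hf.comp hm).aemeasurable]

theorem measurable_iSup_comap_of_dependsOn {β : Type*} [MeasurableSpace β] [Nonempty (∀ i, X i)]
    {F : (∀ i, X i) → β} (hF : Measurable F) {A : Set ι} (hA : DependsOn F A) :
    Measurable[⨆ i ∈ A, MeasurableSpace.comap (fun x : ∀ i, X i => x i) inferInstance] F := by
  classical
  obtain ⟨x0⟩ := ‹Nonempty (∀ i, X i)›
  -- Freezing the coordinates outside `A` at `x0` does not change `F`, and the frozen point is a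
  -- function of the coordinates in `A` alone.
  have e : F = F ∘ (fun x i => if i ∈ A then x i else x0 i) := by
    funext x
    exact hA fun i hi => by simp [hi]
  rw [e]
  refine hF.comp ?_
  refine @measurable_pi_lambda _ _ _ (_) _ _ fun i => ?_
  by_cases hi : i ∈ A
  · simp only [hi, if_true]
    exact Measurable.mono (comap_measurable _)
      (le_iSup₂ (f := fun i (_ : i ∈ A) => MeasurableSpace.comap (fun x : ∀ i, X i => x i)
        inferInstance) i hi) le_rfl
  · simp only [hi, if_false]
    exact measurable_const

theorem indepFun_infinitePi_of_dependsOn {P : (i : ι) → Measure (X i)}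
    [∀ i, IsProbabilityMeasure (P i)] {β γ : Type*} [MeasurableSpace β] [MeasurableSpace γ]
    {F : (∀ i, X i) → β} {G : (∀ i, X i) → γ} (hF : Measurable F) (hG : Measurable G)
    {A B : Set ι} (hA : DependsOn F A) (hB : DependsOn G B) (hAB : Disjoint A B) :
    IndepFun F G (Measure.infinitePi P) := by
  have : Nonempty (∀ i, X i) := (Measure.infinitePi P).nonempty_of_neZero
  have h1 : iIndep (fun i => MeasurableSpace.comap (fun x : ∀ i, X i => x i) inferInstance)
      (Measure.infinitePi P) :=
    (iIndepFun_infinitePi (P := P) (X := fun i x => x) (fun i => measurable_id))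
  have h2 := indep_iSup_of_disjoint (fun i => (measurable_pi_apply i).comap_le) h1 hAB
  rw [IndepFun_iff_Indep]
  exact indep_of_indep_of_le_left (indep_of_indep_of_le_right h2
    (measurable_iSup_comap_of_dependsOn hG hB).comap_le)
    (measurable_iSup_comap_of_dependsOn hF hA).comap_le

/-- Induction over the σ-algebra generated by the cylinders. For a disjoint union, truncate where
the tail has measure below `ε / 2` and approximate the `i`-th set within `δ i`, where the `δ i` sum
to less than `ε / 2`. -/
theorem exists_dependsOn_measure_symmDiff_lt (μ : Measure (∀ i, X i)) [IsFiniteMeasure μ]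
    {A : Set (∀ i, X i)} (hA : MeasurableSet A) {ε : ℝ≥0∞} (hε : ε ≠ 0) :
    ∃ (I : Finset ι) (C : Set (∀ i, X i)), MeasurableSet C ∧ DependsOn (· ∈ C) (I : Set ι) ∧
      μ (A ∆ C) < ε := by
  classical
  induction A, hA using MeasurableSpace.induction_on_inter generateFrom_measurableCylinders.symm
    isPiSystem_measurableCylinders generalizing ε with
  | empty => exact ⟨∅, ∅, .empty, fun _ _ _ => rfl, by simpa using pos_iff_ne_zero.2 hε⟩
  | basic t ht =>
    obtain ⟨I, S, hS, rfl⟩ := (mem_measurableCylinders _).1 ht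
    refine ⟨I, cylinder I S, .cylinder I hS, fun x y h => ?_, by
      simpa using pos_iff_ne_zero.2 hε⟩
    have : I.restrict x = I.restrict y := funext fun i => h i i.2
    simp [mem_cylinder, this]
  | compl t ht ih =>
    obtain ⟨I, C, hC, hI, h⟩ := ih hε
    refine ⟨I, Cᶜ, hC.compl, fun x y hxy => ?_, ?_⟩
    · simpa using not_congr (hI hxy).to_iff
    · rwa [compl_symmDiff_compl]
  | iUnion f hd hf ih =>
    have hε2 : ε / 2 ≠ 0 := by simpa using hε
    obtain ⟨δ, hδ, hδs⟩ := ENNReal.exists_pos_sum_of_countable' hε2 ℕ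
    choose I C hC hI h using fun i => ih i (hδ i).ne'
    have ht := tendsto_measure_biUnion_Ici_zero_of_pairwise_disjoint (μ := μ)
      (fun i => (hf i).nullMeasurableSet) hd
    obtain ⟨N, hN⟩ := (ht.eventually_lt_const (pos_iff_ne_zero.2 hε2)).exists
    refine ⟨(Finset.range N).biUnion I, ⋃ i ∈ Finset.range N, C i,
      Finset.measurableSet_biUnion _ fun i _ => hC i, ?_, ?_⟩
    · intro x y hxy
      simp only [Set.mem_iUnion, eq_iff_iff]
      refine exists_congr fun i => exists_congr fun hi => ?_
      refine (hI i fun j hj => hxy j ?_).to_iff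
      simp only [Finset.coe_biUnion, Set.mem_iUnion]
      exact ⟨i, hi, hj⟩
    · calc μ ((⋃ i, f i) ∆ (⋃ i ∈ Finset.range N, C i))
          ≤ μ ((⋃ i ≥ N, f i) ∪ ⋃ i, (f i) ∆ (C i)) := by
            refine measure_mono ?_
            rintro x (⟨hx, hx'⟩ | ⟨hx, hx'⟩)
            · obtain ⟨i, hi⟩ := Set.mem_iUnion.1 hx
              by_cases hiN : N ≤ i
              · exact Or.inl (Set.mem_iUnion₂.2 ⟨i, hiN, hi⟩)
              · refine Or.inr (Set.mem_iUnion.2 ⟨i, Or.inl ⟨hi, fun hc => hx' ?_⟩⟩)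
                exact Set.mem_iUnion₂.2 ⟨i, Finset.mem_range.2 (by omega), hc⟩
            · obtain ⟨i, hi, hc⟩ := Set.mem_iUnion₂.1 hx
              refine Or.inr (Set.mem_iUnion.2 ⟨i, Or.inr ⟨hc, fun hf' => hx' ?_⟩⟩)
              exact Set.mem_iUnion.2 ⟨i, hf'⟩
        _ ≤ μ (⋃ i ≥ N, f i) + ∑' i, μ ((f i) ∆ (C i)) :=
            (measure_union_le _ _).trans (by gcongr; exact measure_iUnion_le _)
        _ < ε / 2 + ε / 2 := by
            refine ENNReal.add_lt_add hN (lt_of_le_of_lt ?_ hδs)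
            exact ENNReal.tsum_le_tsum fun i => (h i).le
        _ = ε := ENNReal.add_halves ε

end ProductMeasures

/-- Almost sure properties pass to image measures, without any measurability of the property. -/
theorem ae_map_of_ae_of_standardBorel {S T : Type*} [MeasurableSpace S] [StandardBorelSpace S]
    [MeasurableSpace T] [MeasurableEq T] {μ : Measure S} [IsProbabilityMeasure μ] {π : S → T}
    (hπ : Measurable π) {Q : T → Prop} (h : ∀ᵐ s ∂μ, Q (π s)) : ∀ᵐ t ∂(μ.map π), Q t := by
  have : Nonempty S := μ.nonempty_of_neZero
  obtain ⟨N, hN, hNm, hN0⟩ := exists_measurable_superset_of_null (ae_iff.1 h)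
  -- Disintegrate the law of `(π s, s)` over its first coordinate. For almost every `t` the
  -- conditional law lives on points `s` outside the null set with `π s = t`; one such point yields
  -- `Q t`, whether or not `Q` is measurable.
  have h1 : ∀ᵐ q ∂((μ.map π) ⊗ₘ condDistrib id π μ), q.2 ∈ Nᶜ ∧ q.1 = π q.2 := by
    rw [compProd_map_condDistrib aemeasurable_id]
    refine (ae_map_iff (by fun_prop) ?_).2 ?_
    · exact (measurable_snd hNm.compl).inter
        (measurableSet_eq_fun measurable_fst (hπ.comp measurable_snd))
    · filter_upwards [compl_mem_ae_iff.2 hN0] with s hs using ⟨hs, rfl⟩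
  filter_upwards [Measure.ae_ae_of_ae_compProd h1] with t ht
  obtain ⟨s, hs, e⟩ := ht.exists
  rw [e]
  by_contra hq
  exact hs (hN hq)

/-! ### Homogeneous Markov chains: uniqueness, images, shifts, stationarity. -/

section Markov

variable {S : Type*} [MeasurableSpace S] {S' : Type*} [MeasurableSpace S']

/-- The law `μ` of a random sequence is that of a homogeneous Markov chain with transition
kernel `K` (and any initial law). -/
def IsMarkovLaw (K : Kernel S S) (μ : Measure (ℕ → S)) : Prop :=
  ∀ (n : ℕ) (A : Set (Finset.Iic n → S)) (B : Set S), MeasurableSet A → MeasurableSet B →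
    μ (Preorder.frestrictLe (π := fun _ => S) n ⁻¹' A ∩ (fun Y => Y (n + 1)) ⁻¹' B) =
      ∫⁻ Y in Preorder.frestrictLe (π := fun _ => S) n ⁻¹' A, K (Y n) B ∂μ

/-- The kernel `K` as a kernel from the past up to time `n`. -/
noncomputable def lastKernel (K : Kernel S S) (n : ℕ) : Kernel (Finset.Iic n → S) S :=
  K.comap (fun x : Finset.Iic n → S => x ⟨n, Finset.mem_Iic.2 le_rfl⟩) (measurable_pi_apply _)

instance (K : Kernel S S) [IsMarkovKernel K] (n : ℕ) : IsMarkovKernel (lastKernel K n) := by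
  rw [lastKernel]; infer_instance

theorem measurable_past (n : ℕ) :
    Measurable (Preorder.frestrictLe (π := fun _ : ℕ => S) n) :=
  Preorder.measurable_frestrictLe n

theorem IsMarkovLaw.map_eq_compProd {K : Kernel S S} [IsMarkovKernel K] {μ : Measure (ℕ → S)}
    [IsFiniteMeasure μ] (h : IsMarkovLaw K μ) (n : ℕ) :
    μ.map (fun Y => (Preorder.frestrictLe (π := fun _ => S) n Y, Y (n + 1))) =
      (μ.map (Preorder.frestrictLe (π := fun _ => S) n)) ⊗ₘ lastKernel K n := by
  have hm := measurable_past (S := S) n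
  refine Measure.ext_prod_iff.2 fun {A} {B} hA hB => ?_
  rw [Measure.map_apply (by fun_prop) (hA.prod hB), Measure.compProd_apply_prod hA hB,
    setLIntegral_map hA ((lastKernel K n).measurable_coe hB) hm]
  exact h n A B hA hB

theorem IsMarkovLaw.of_map_eq_compProd {K : Kernel S S} [IsMarkovKernel K] {μ : Measure (ℕ → S)}
    [IsFiniteMeasure μ]
    (h : ∀ n, μ.map (fun Y => (Preorder.frestrictLe (π := fun _ => S) n Y, Y (n + 1))) =
      (μ.map (Preorder.frestrictLe (π := fun _ => S) n)) ⊗ₘ lastKernel K n) :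
    IsMarkovLaw K μ := by
  intro n A B hA hB
  have hm := measurable_past (S := S) n
  have h1 := DFunLike.congr_fun (h n) (A ×ˢ B)
  rw [Measure.map_apply (by fun_prop) (hA.prod hB), Measure.compProd_apply_prod hA hB,
    setLIntegral_map hA ((lastKernel K n).measurable_coe hB) hm] at h1
  exact h1

/-- A Markov law is determined by the kernel and the initial law. -/
theorem IsMarkovLaw.unique {K : Kernel S S} [IsMarkovKernel K] {μ μ' : Measure (ℕ → S)}
    [IsFiniteMeasure μ] [IsFiniteMeasure μ'] (h : IsMarkovLaw K μ) (h' : IsMarkovLaw K μ')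
    (h0 : μ.map (fun Y => Y 0) = μ'.map (fun Y => Y 0)) : μ = μ' := by
  have key : ∀ n, μ.map (Preorder.frestrictLe (π := fun _ => S) n) =
      μ'.map (Preorder.frestrictLe (π := fun _ => S) n) := by
    intro n
    induction n with
    | zero =>
      have e : Preorder.frestrictLe (π := fun _ => S) 0 = (fun (x : S) _ => x) ∘ (fun Y => Y 0) := by
        funext Y i
        have : (i : ℕ) = 0 := Nat.le_zero.1 (Finset.mem_Iic.1 i.2)
        simp [this]
      rw [e, ← Measure.map_map (by fun_prop) (by fun_prop), h0,
        Measure.map_map (by fun_prop) (by fun_prop)]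
    | succ n ih =>
      let g : (Finset.Iic n → S) × S → (Finset.Iic (n + 1) → S) := fun q i =>
        if hi : (i : ℕ) ≤ n then q.1 ⟨i, Finset.mem_Iic.2 hi⟩ else q.2
      have hg : Measurable g := by
        refine measurable_pi_lambda _ fun i => ?_
        by_cases hi : (i : ℕ) ≤ n
        · simp only [g, hi, dite_true]; fun_prop
        · simp only [g, hi, dite_false]; fun_prop
      have e : Preorder.frestrictLe (π := fun _ => S) (n + 1) =
          g ∘ (fun Y => (Preorder.frestrictLe (π := fun _ => S) n Y, Y (n + 1))) := by
        funext Y i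
        by_cases hi : (i : ℕ) ≤ n
        · simp [g, hi]
        · have : (i : ℕ) = n + 1 := by have := Finset.mem_Iic.1 i.2; omega
          simp [g, this]
      rw [e, ← Measure.map_map hg (by fun_prop), h.map_eq_compProd, ih, ← h'.map_eq_compProd,
        Measure.map_map hg (by fun_prop)]
  refine ext_of_generate_finite _ (generateFrom_measurableCylinders (α := fun _ : ℕ => S)).symm
    isPiSystem_measurableCylinders ?_ ?_
  · intro s hs
    rw [measurableCylinders_nat] at hs
    simp only [Set.mem_iUnion, Set.mem_singleton_iff] at hs
    obtain ⟨n, A, hA, rfl⟩ := hs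
    have h1 := DFunLike.congr_fun (key n) A
    rwa [Measure.map_apply (measurable_past n) hA, Measure.map_apply (measurable_past n) hA] at h1
  · have h1 := DFunLike.congr_fun (key 0) Set.univ
    rwa [Measure.map_apply (measurable_past 0) .univ,
      Measure.map_apply (measurable_past 0) .univ] at h1

/-- The law of the Markov chain with kernel `K`, as a function of the starting point. -/
noncomputable def chainLaw (K : Kernel S S) [IsMarkovKernel K] : Kernel S (ℕ → S) :=
  (Kernel.traj (X := fun _ => S) (lastKernel K) 0).comap (fun s _ => s) (by fun_prop)

instance (K : Kernel S S) [IsMarkovKernel K] : IsMarkovKernel (chainLaw K) := by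
  rw [chainLaw]; infer_instance

theorem isMarkovLaw_chainLaw (K : Kernel S S) [IsMarkovKernel K] (s : S) :
    IsMarkovLaw K (chainLaw K s) := by
  refine .of_map_eq_compProd fun n => ?_
  have h1 := Kernel.partialTraj_compProd_eq_map_traj (X := fun _ => S) (κ := lastKernel K)
    (Nat.zero_le n) (x₀ := fun _ => s)
  rw [← Kernel.traj_map_frestrictLe_apply] at h1
  exact h1.symm

theorem map_zero_chainLaw (K : Kernel S S) [IsMarkovKernel K] (s : S) :
    (chainLaw K s).map (fun Y => Y 0) = Measure.dirac s := by
  have e : (fun Y : ℕ → S => Y 0) = (fun x : Finset.Iic 0 → S => x ⟨0, by simp⟩) ∘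
      Preorder.frestrictLe (π := fun _ => S) 0 := rfl
  rw [e, ← Measure.map_map (by fun_prop) (measurable_past 0), chainLaw, Kernel.comap_apply,
    Kernel.traj_map_frestrictLe_apply, Kernel.partialTraj_self, Kernel.id_apply,
    Measure.map_dirac' (measurable_pi_apply _)]

/-- The image of a Markov chain under a map that intertwines the kernels. -/
theorem IsMarkovLaw.map {K : Kernel S S} {K' : Kernel S' S'} {μ : Measure (ℕ → S)}
    (h : IsMarkovLaw K μ) {Φ : S → S'} (hΦ : Measurable Φ)
    (hK : ∀ s, (K s).map Φ = K' (Φ s)) : IsMarkovLaw K' (μ.map (fun Y n => Φ (Y n))) := by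
  intro n A B hA hB
  have hm : Measurable (fun (Y : ℕ → S) n => Φ (Y n)) := by fun_prop
  have hA' : MeasurableSet ((fun (x : Finset.Iic n → S) i => Φ (x i)) ⁻¹' A) :=
    (by fun_prop : Measurable (fun (x : Finset.Iic n → S) i => Φ (x i))) hA
  have hp := measurable_past (S := S') n
  have hK' : Measurable (fun Y : ℕ → S' => K' (Y n) B) :=
    (K'.measurable_coe hB).comp (measurable_pi_apply n)
  rw [Measure.map_apply hm ((hp hA).inter ((by fun_prop :
    Measurable (fun Y : ℕ → S' => Y (n + 1))) hB)), setLIntegral_map (hp hA) hK' hm]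
  refine (h n _ (Φ ⁻¹' B) hA' (hΦ hB)).trans ?_
  refine lintegral_congr fun Y => ?_
  rw [← hK, Measure.map_apply hΦ hB]

/-- The past of the shifted sequence up to `n` is a function of the original past up to `n + 1`, so
its events are among those for which the Markov property is known. -/
theorem IsMarkovLaw.shift {K : Kernel S S} {μ : Measure (ℕ → S)}
    (h : IsMarkovLaw K μ) : IsMarkovLaw K (μ.map (fun Y n => Y (n + 1))) := by
  intro n A B hA hB
  have hm : Measurable (fun (Y : ℕ → S) n => Y (n + 1)) := by fun_prop
  let g : (Finset.Iic (n + 1) → S) → (Finset.Iic n → S) := fun x i =>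
    x ⟨i + 1, Finset.mem_Iic.2 (Nat.succ_le_succ (Finset.mem_Iic.1 i.2))⟩
  have hg : Measurable g := by fun_prop
  have hp := measurable_past (S := S) n
  have hK' : Measurable (fun Y : ℕ → S => K (Y n) B) :=
    (K.measurable_coe hB).comp (measurable_pi_apply n)
  rw [Measure.map_apply hm ((hp hA).inter ((by fun_prop :
    Measurable (fun Y : ℕ → S => Y (n + 1))) hB)), setLIntegral_map (hp hA) hK' hm]
  exact h (n + 1) (g ⁻¹' A) B (hg hA) hB

theorem isMarkovLaw_comp (K : Kernel S S) [IsMarkovKernel K] (ν : Measure S) :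
    IsMarkovLaw K (chainLaw K ∘ₘ ν) := by
  intro n A B hA hB
  have hp := measurable_past (S := S) n
  have hB' : MeasurableSet ((fun Y : ℕ → S => Y (n + 1)) ⁻¹' B) :=
    (by fun_prop : Measurable (fun Y : ℕ → S => Y (n + 1))) hB
  rw [Measure.bind_apply ((hp hA).inter hB') (chainLaw K).aemeasurable,
    ← lintegral_indicator (hp hA), Measure.lintegral_bind (chainLaw K).aemeasurable
    (Measurable.indicator (f := fun Y : ℕ → S => K (Y n) B)
      ((K.measurable_coe hB).comp (measurable_pi_apply n)) (hp hA)).aemeasurable]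
  refine lintegral_congr fun s => ?_
  rw [lintegral_indicator (hp hA)]
  exact isMarkovLaw_chainLaw K s n A B hA hB

theorem map_zero_comp_chainLaw (K : Kernel S S) [IsMarkovKernel K] (ν : Measure S) :
    (chainLaw K ∘ₘ ν).map (fun Y => Y 0) = ν := by
  rw [Measure.map_comp _ _ (by fun_prop)]
  have : (chainLaw K).map (fun Y => Y 0) = Kernel.id := by
    ext s : 1
    rw [Kernel.map_apply _ (by fun_prop), map_zero_chainLaw, Kernel.id_apply]
  rw [this, Measure.id_comp]

theorem IsMarkovLaw.map_succ {K : Kernel S S} [IsMarkovKernel K] {μ : Measure (ℕ → S)}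
    [IsFiniteMeasure μ] (h : IsMarkovLaw K μ) (n : ℕ) :
    μ.map (fun Y => (Y n, Y (n + 1))) = (μ.map (fun Y => Y n)) ⊗ₘ K := by
  refine Measure.ext_prod_iff.2 fun {A} {B} hA hB => ?_
  rw [Measure.map_apply (by fun_prop) (hA.prod hB), Measure.compProd_apply_prod hA hB,
    setLIntegral_map hA (K.measurable_coe hB) (by fun_prop)]
  exact h n ((fun x : Finset.Iic n → S => x ⟨n, Finset.mem_Iic.2 le_rfl⟩) ⁻¹' A) B
    (measurable_pi_apply _ hA) hB

/-- The stationary chain is preserved by the shift. -/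
theorem measurePreserving_shift {K : Kernel S S} [IsMarkovKernel K] {ν : Measure S}
    [IsProbabilityMeasure ν] (hν : K ∘ₘ ν = ν) :
    MeasurePreserving (fun (Y : ℕ → S) n => Y (n + 1)) (chainLaw K ∘ₘ ν) (chainLaw K ∘ₘ ν) := by
  have hm : Measurable (fun (Y : ℕ → S) n => Y (n + 1)) := by fun_prop
  have h1 := isMarkovLaw_comp K ν
  have : IsProbabilityMeasure ((chainLaw K ∘ₘ ν).map (fun (Y : ℕ → S) n => Y (n + 1))) :=
    Measure.isProbabilityMeasure_map hm.aemeasurable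
  refine ⟨hm, h1.shift.unique h1 ?_⟩
  rw [Measure.map_map (by fun_prop) hm, map_zero_comp_chainLaw]
  have e : ((fun Y : ℕ → S => Y 0) ∘ fun (Y : ℕ → S) n => Y (n + 1)) =
      Prod.snd ∘ (fun Y => (Y 0, Y (0 + 1))) := rfl
  rw [e, ← Measure.map_map (by fun_prop) (by fun_prop), h1.map_succ, map_zero_comp_chainLaw,
    ← Measure.snd, Measure.snd_compProd, hν]

/-- The Markov property, integrated against a function of the past and the next step. -/
theorem IsMarkovLaw.integral_eq {K : Kernel S S} [IsMarkovKernel K] {μ : Measure (ℕ → S)}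
    [IsFiniteMeasure μ] (h : IsMarkovLaw K μ) (n : ℕ) {G : (Finset.Iic n → S) × S → ℝ}
    (hG : Measurable G)
    (hi : Integrable (fun Y => G (Preorder.frestrictLe (π := fun _ => S) n Y, Y (n + 1))) μ) :
    ∫ Y, G (Preorder.frestrictLe (π := fun _ => S) n Y, Y (n + 1)) ∂μ =
      ∫ Y, ∫ z, G (Preorder.frestrictLe (π := fun _ => S) n Y, z) ∂(K (Y n)) ∂μ := by
  have hm : Measurable (fun Y : ℕ → S =>
    (Preorder.frestrictLe (π := fun _ => S) n Y, Y (n + 1))) := by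
    have := measurable_past (S := S) n
    fun_prop
  have hi' : Integrable G ((μ.map (Preorder.frestrictLe (π := fun _ => S) n)) ⊗ₘ
      lastKernel K n) := by
    rw [← h.map_eq_compProd, integrable_map_measure hG.aestronglyMeasurable hm.aemeasurable]
    exact hi
  rw [← integral_map hm.aemeasurable hG.aestronglyMeasurable, h.map_eq_compProd,
    Measure.integral_compProd hi', integral_map (measurable_past n).aemeasurable]
  · rfl
  · exact hG.stronglyMeasurable.integral_kernel_prod_right'.aestronglyMeasurable

end Markov

/-! ### Maximal ergodic inequality and the strong law for orthogonal variables. -/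

section Maximal

variable {Ω : Type*} {θ : Ω → Ω}

/-- The maximum of the Birkhoff sums of `g` over at most `n` steps. -/
def maxBirkhoffSum (θ : Ω → Ω) (g : Ω → ℝ) : ℕ → Ω → ℝ
  | 0, _ => 0
  | n + 1, ω => max 0 (g ω + maxBirkhoffSum θ g n (θ ω))

theorem maxBirkhoffSum_nonneg (g : Ω → ℝ) (n : ℕ) (ω : Ω) : 0 ≤ maxBirkhoffSum θ g n ω := by
  cases n with
  | zero => exact le_rfl
  | succ n => exact le_max_left _ _

theorem maxBirkhoffSum_le_succ (g : Ω → ℝ) (n : ℕ) (ω : Ω) :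
    maxBirkhoffSum θ g n ω ≤ maxBirkhoffSum θ g (n + 1) ω := by
  induction n generalizing ω with
  | zero => exact le_max_left _ _
  | succ n ih => exact max_le_max le_rfl (add_le_add le_rfl (ih _))

theorem monotone_maxBirkhoffSum (g : Ω → ℝ) (ω : Ω) :
    Monotone fun n => maxBirkhoffSum θ g n ω :=
  monotone_nat_of_le_succ fun n => maxBirkhoffSum_le_succ g n ω

theorem birkhoffSum_le_maxBirkhoffSum (g : Ω → ℝ) (n : ℕ) (ω : Ω) :
    birkhoffSum θ g n ω ≤ maxBirkhoffSum θ g n ω := by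
  induction n generalizing ω with
  | zero => simp [maxBirkhoffSum]
  | succ n ih =>
    rw [birkhoffSum_succ']
    exact (add_le_add le_rfl (ih _)).trans (le_max_right _ _)

variable [MeasurableSpace Ω] {μ : Measure Ω}

theorem measurable_maxBirkhoffSum (hθ : Measurable θ) {g : Ω → ℝ} (hg : Measurable g) (n : ℕ) :
    Measurable (maxBirkhoffSum θ g n) := by
  induction n with
  | zero => exact measurable_const
  | succ n ih => exact measurable_const.max (hg.add (ih.comp hθ))

theorem integrable_maxBirkhoffSum (hθ : MeasurePreserving θ μ μ) {g : Ω → ℝ}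
    (hg : Integrable g μ) (n : ℕ) : Integrable (maxBirkhoffSum θ g n) μ := by
  induction n with
  | zero => exact integrable_zero _ _ _
  | succ n ih => exact (integrable_zero _ _ _).sup (hg.add (hθ.integrable_comp_of_integrable ih))

/-- The maximal ergodic theorem. -/
theorem setIntegral_maxBirkhoffSum_nonneg (hθ : MeasurePreserving θ μ μ) {g : Ω → ℝ}
    (hgm : Measurable g) (hg : Integrable g μ) (n : ℕ) :
    0 ≤ ∫ ω in {ω | 0 < maxBirkhoffSum θ g n ω}, g ω ∂μ := by
  cases n with
  | zero => simp [maxBirkhoffSum]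
  | succ n =>
    have hM := integrable_maxBirkhoffSum hθ hg (n + 1)
    have hMθ : Integrable (fun ω => maxBirkhoffSum θ g (n + 1) (θ ω)) μ :=
      hθ.integrable_comp_of_integrable hM
    have hE : MeasurableSet {ω | 0 < maxBirkhoffSum θ g (n + 1) ω} :=
      measurableSet_lt measurable_const (measurable_maxBirkhoffSum hθ.measurable hgm _)
    rw [← integral_indicator hE]
    have e : ∫ ω, (maxBirkhoffSum θ g (n + 1) ω - maxBirkhoffSum θ g (n + 1) (θ ω)) ∂μ = 0 := by
      rw [integral_sub hM hMθ, sub_eq_zero]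
      conv_lhs => rw [← hθ.map_eq]
      refine integral_map hθ.measurable.aemeasurable ?_
      exact (measurable_maxBirkhoffSum hθ.measurable hgm _).aestronglyMeasurable
    refine e.symm.le.trans ?_
    -- Garsia's argument, with `M` the maximum over `n + 1` steps. Where `M > 0`, `M ω` is `g ω`
    -- plus a term at most `M (θ ω)`; elsewhere `M ω = 0 ≤ M (θ ω)`. So `M - M ∘ θ` lies below `g`
    -- restricted to `{M > 0}`, and it integrates to zero by invariance.
    refine integral_mono (hM.sub hMθ) (hg.indicator hE) fun ω => ?_
    have h0 := maxBirkhoffSum_nonneg (θ := θ) g (n + 1) (θ ω)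
    have h1 := maxBirkhoffSum_le_succ (θ := θ) g n (θ ω)
    by_cases hω : 0 < maxBirkhoffSum θ g (n + 1) ω
    · simp only [Set.indicator, Set.mem_ofPred_eq, hω, if_true]
      have h2 : maxBirkhoffSum θ g (n + 1) ω = max 0 (g ω + maxBirkhoffSum θ g n (θ ω)) := rfl
      rcases max_cases 0 (g ω + maxBirkhoffSum θ g n (θ ω)) with h | h <;> linarith
    · simp only [Set.indicator, Set.mem_ofPred_eq, hω, if_false]
      linarith

/-- The weak-type maximal inequality for ergodic averages. -/
theorem measure_exists_lt_birkhoffSum_le [IsFiniteMeasure μ] (hθ : MeasurePreserving θ μ μ)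
    {f : Ω → ℝ} (hfm : Measurable f) (hf : Integrable f μ) {ε : ℝ} (hε : 0 < ε) :
    μ {ω | ∃ n : ℕ, ε * n < birkhoffSum θ f n ω} ≤ ENNReal.ofReal ((∫ ω, |f ω| ∂μ) / ε) := by
  -- Subtracting `ε` turns the event "some sum exceeds `ε * n`" into "some sum of `g` is positive",
  -- to which the maximal theorem applies.
  set g : Ω → ℝ := fun ω => f ω - ε with hg
  have hgm : Measurable g := hfm.sub_const ε
  have hgi : Integrable g μ := hf.sub (integrable_const ε)
  have hsum : ∀ n ω, birkhoffSum θ g n ω = birkhoffSum θ f n ω - ε * n := by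
    intro n ω
    simp [birkhoffSum, hg, Finset.sum_sub_distrib, mul_comm]
  have hsub : {ω | ∃ n : ℕ, ε * n < birkhoffSum θ f n ω} ⊆
      ⋃ n, {ω | 0 < maxBirkhoffSum θ g n ω} := by
    rintro ω ⟨n, hn⟩
    refine Set.mem_iUnion.2 ⟨n, lt_of_lt_of_le ?_ (birkhoffSum_le_maxBirkhoffSum g n ω)⟩
    rw [hsum]; linarith
  have hmono : Monotone fun n => {ω | 0 < maxBirkhoffSum θ g n ω} := fun a b hab ω hω =>
    lt_of_lt_of_le hω (monotone_maxBirkhoffSum g ω hab)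
  refine (measure_mono hsub).trans ?_
  rw [hmono.measure_iUnion]
  refine iSup_le fun n => ?_
  have h1 := setIntegral_maxBirkhoffSum_nonneg hθ hgm hgi n
  rw [integral_sub hf.integrableOn (integrable_const ε), setIntegral_const, smul_eq_mul] at h1
  have h2 : ∫ ω in {ω | 0 < maxBirkhoffSum θ g n ω}, f ω ∂μ ≤ ∫ ω, |f ω| ∂μ :=
    (setIntegral_mono hf.integrableOn hf.abs.integrableOn fun ω => le_abs_self _).trans
      (setIntegral_le_integral hf.abs (Eventually.of_forall fun _ => abs_nonneg _))
  rw [ENNReal.le_ofReal_iff_toReal_le (measure_ne_top _ _)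
    (div_nonneg (integral_nonneg fun _ => abs_nonneg _) hε.le), le_div_iff₀ hε]
  exact (by linarith : μ.real _ * ε ≤ _)

/-- Almost sure convergence of ergodic averages passes to limits in `L¹`. -/
theorem ae_tendsto_birkhoffSum_div_of_approx [IsFiniteMeasure μ] (hθ : MeasurePreserving θ μ μ)
    {f : Ω → ℝ} (hfm : Measurable f) (hf : Integrable f μ) {c : ℝ}
    (h : ∀ ε > 0, ∃ (f' : Ω → ℝ) (c' : ℝ), Measurable f' ∧ Integrable f' μ ∧
      ∫ ω, |f ω - f' ω| ∂μ ≤ ε ∧ |c' - c| ≤ ε ∧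
      ∀ᵐ ω ∂μ, Tendsto (fun n : ℕ => birkhoffSum θ f' n ω / n) atTop (𝓝 c')) :
    ∀ᵐ ω ∂μ, Tendsto (fun n : ℕ => birkhoffSum θ f n ω / n) atTop (𝓝 c) := by
  have key : ∀ ε > 0, ∀ᵐ ω ∂μ, ∀ᶠ n : ℕ in atTop, |birkhoffSum θ f n ω / n - c| ≤ 3 * ε := by
    intro ε hε
    rw [ae_iff, ← nonpos_iff_eq_zero]
    refine ENNReal.le_of_forall_pos_le_add fun δ hδ _ => ?_
    -- An `L¹` error of `δ * ε` makes the weak-type bound at height `ε` at most `δ`, which is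
    -- arbitrary. The three errors of size `ε` are the maximal one, the convergence for `f'`, and
    -- `|c' - c|`.
    obtain ⟨f', c', hf'm, hf', h1, h2, h3⟩ := h (min ε (δ * ε))
      (lt_min hε (mul_pos (by exact_mod_cast hδ) hε))
    have hd : Measurable fun ω => |f ω - f' ω| := (hfm.sub hf'm).abs
    have h4 := measure_exists_lt_birkhoffSum_le hθ hd (hf.sub hf').abs hε
    have h5 : μ {ω | ¬ ∀ᶠ n : ℕ in atTop, |birkhoffSum θ f n ω / n - c| ≤ 3 * ε} ≤
        μ {ω | ∃ n : ℕ, ε * n < birkhoffSum θ (fun ω => |f ω - f' ω|) n ω} := by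
      refine measure_mono_ae ?_
      filter_upwards [h3] with ω hω hbad
      by_contra hgood
      apply hbad
      have hgood' : ∀ n : ℕ, birkhoffSum θ (fun ω => |f ω - f' ω|) n ω ≤ ε * n := by
        simpa using fun n hn => hgood ⟨n, hn⟩
      filter_upwards [eventually_gt_atTop 0, Metric.tendsto_nhds.1 hω ε hε] with n hn hn'
      have hn0 : (0 : ℝ) < n := by exact_mod_cast hn
      have h6 : |birkhoffSum θ f n ω / n - birkhoffSum θ f' n ω / n| ≤ ε := by
        rw [← sub_div, abs_div, abs_of_pos hn0, div_le_iff₀ hn0]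
        refine le_trans ?_ (hgood' n)
        rw [birkhoffSum, birkhoffSum, ← Finset.sum_sub_distrib]
        exact Finset.abs_sum_le_sum_abs _ _
      have h7 : |c' - c| ≤ ε := h2.trans (min_le_left _ _)
      rw [Real.dist_eq] at hn'
      calc |birkhoffSum θ f n ω / n - c|
          = |(birkhoffSum θ f n ω / n - birkhoffSum θ f' n ω / n) +
              (birkhoffSum θ f' n ω / n - c') + (c' - c)| := by ring_nf
        _ ≤ _ := abs_add_three _ _ _
        _ ≤ 3 * ε := by linarith
    rw [zero_add]
    refine h5.trans (h4.trans ?_)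
    rw [← ENNReal.ofReal_coe_nnreal]
    refine ENNReal.ofReal_le_ofReal ?_
    rw [div_le_iff₀ hε]
    simpa using h1.trans (min_le_right _ _)
  have key' : ∀ᵐ ω ∂μ, ∀ k : ℕ, ∀ᶠ n : ℕ in atTop,
      |birkhoffSum θ f n ω / n - c| ≤ 3 * (1 / ((k : ℝ) + 1)) :=
    ae_all_iff.2 fun k => key _ Nat.one_div_pos_of_nat
  filter_upwards [key'] with ω hω
  rw [Metric.tendsto_nhds]
  intro ε hε
  obtain ⟨k, hk⟩ := exists_nat_one_div_lt (show 0 < ε / 3 by positivity)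
  filter_upwards [hω k] with n hn
  rw [Real.dist_eq]
  linarith

/-- The strong law of large numbers for bounded orthogonal random variables. -/
theorem ae_tendsto_sum_div_of_orthogonal [IsProbabilityMeasure μ] {D : ℕ → Ω → ℝ}
    (hD : ∀ i, Measurable (D i)) {B : ℝ} (hB : ∀ i ω, |D i ω| ≤ B)
    (ho : ∀ i j, i < j → ∫ ω, D i ω * D j ω ∂μ = 0) :
    ∀ᵐ ω ∂μ, Tendsto (fun n : ℕ => (∑ i ∈ Finset.range n, D i ω) / n) atTop (𝓝 0) := by
  have hB0 : 0 ≤ B := by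
    obtain ⟨ω⟩ := μ.nonempty_of_neZero
    exact (abs_nonneg _).trans (hB 0 ω)
  have hint : ∀ i j, Integrable (fun ω => D i ω * D j ω) μ := fun i j =>
    Integrable.of_bound ((hD i).mul (hD j)).aestronglyMeasurable (B * B)
      (Eventually.of_forall fun ω => by
        rw [Real.norm_eq_abs, abs_mul]
        exact mul_le_mul (hB i ω) (hB j ω) (abs_nonneg _) hB0)
  have hsq : ∀ n : ℕ, ∫ ω, (∑ i ∈ Finset.range n, D i ω) ^ 2 ∂μ ≤ n * B ^ 2 := by
    intro n
    simp_rw [sq, Finset.sum_mul_sum]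
    rw [integral_finsetSum _ fun i _ => integrable_finsetSum _ fun j _ => hint i j]
    have : ∀ i ∈ Finset.range n, ∫ ω, ∑ j ∈ Finset.range n, D i ω * D j ω ∂μ ≤ B * B := by
      intro i hi
      rw [integral_finsetSum _ fun j _ => hint i j, Finset.sum_eq_single_of_mem i hi]
      · calc ∫ ω, D i ω * D i ω ∂μ ≤ ∫ ω, B * B ∂μ := by
              refine integral_mono (hint i i) (integrable_const _) fun ω => ?_
              have := hB i ω
              calc D i ω * D i ω = |D i ω| * |D i ω| := (abs_mul_abs_self _).symm
                _ ≤ B * B := mul_le_mul this this (abs_nonneg _) hB0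
          _ = B * B := by simp
      · intro j _ hji
        rcases lt_or_gt_of_ne hji with h | h
        · rw [← ho j i h]; simp_rw [mul_comm]
        · exact ho i j h
    refine (Finset.sum_le_sum this).trans ?_
    simp
  set S : ℕ → Ω → ℝ := fun n ω => ∑ i ∈ Finset.range n, D i ω with hS
  have hSm : ∀ n, Measurable (S n) := fun n => Finset.measurable_sum _ fun i _ => hD i
  have hSb : ∀ n ω, |S n ω| ≤ n * B := fun n ω =>
    (Finset.abs_sum_le_sum_abs _ _).trans
      ((Finset.sum_le_sum fun i _ => hB i ω).trans (by simp))
  -- Along the squares the second moments are at most `B² / k²`, hence summable, so `S (k ^ 2) / k ^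
  -- 2` tends to `0` almost surely. The term `k = 0` vanishes because division by zero gives zero.
  have hsumm : ∑' k : ℕ, ∫⁻ ω, ENNReal.ofReal ((S (k ^ 2) ω / (k : ℝ) ^ 2) ^ 2) ∂μ ≠ ∞ := by
    have hb : ∀ k : ℕ, ∫⁻ ω, ENNReal.ofReal ((S (k ^ 2) ω / (k : ℝ) ^ 2) ^ 2) ∂μ ≤
        ENNReal.ofReal (B ^ 2 * (1 / (k : ℝ) ^ 2)) := by
      intro k
      rw [← ofReal_integral_eq_lintegral_ofReal]
      · refine ENNReal.ofReal_le_ofReal ?_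
        simp_rw [div_pow]
        rw [integral_div]
        rcases Nat.eq_zero_or_pos k with rfl | hk
        · simp
        · have hk' : (0 : ℝ) < k := by exact_mod_cast hk
          rw [div_le_iff₀ (by positivity)]
          refine (hsq (k ^ 2)).trans (le_of_eq ?_)
          push_cast
          field_simp
      · refine Integrable.of_bound (((hSm _).div_const _).pow_const _).aestronglyMeasurable
          (((k ^ 2 : ℕ) * B / (k : ℝ) ^ 2) ^ 2) (Eventually.of_forall fun ω => ?_)
        rw [Real.norm_eq_abs, abs_pow, abs_div, abs_of_nonneg (sq_nonneg (k : ℝ))]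
        gcongr
        exact hSb _ ω
      · exact Eventually.of_forall fun ω => sq_nonneg _
    refine ne_top_of_le_ne_top ?_ (ENNReal.tsum_le_tsum hb)
    exact ((Real.summable_one_div_nat_pow.2 one_lt_two).mul_left _).tsum_ofReal_ne_top
  rw [← lintegral_tsum fun k =>
    (((hSm _).div_const _).pow_const _).ennreal_ofReal.aemeasurable] at hsumm
  filter_upwards [ae_lt_top' (AEMeasurable.tsum fun k =>
    (((hSm _).div_const _).pow_const _).ennreal_ofReal.aemeasurable) hsumm] with ω hω
  have h1 : Tendsto (fun k : ℕ => |S (k ^ 2) ω / (k : ℝ) ^ 2|) atTop (𝓝 0) := by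
    have h2 := ENNReal.tendsto_atTop_zero_of_tsum_ne_top hω.ne
    have h3 := (ENNReal.tendsto_toReal ENNReal.zero_ne_top).comp h2
    have h4 := (Real.continuous_sqrt.tendsto 0).comp h3
    rw [Real.sqrt_zero] at h4
    refine h4.congr fun k => ?_
    simp only [Function.comp_apply]
    rw [ENNReal.toReal_ofReal (sq_nonneg _), Real.sqrt_sq_eq_abs]
  have h2 : Tendsto (fun k : ℕ => |S (k ^ 2) ω / (k : ℝ) ^ 2| + 2 * B / k) atTop (𝓝 0) := by
    simpa using h1.add (tendsto_const_div_atTop_nhds_zero_nat (2 * B))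
  have hsqrt : Tendsto Nat.sqrt atTop atTop :=
    tendsto_atTop.2 fun b => by
      filter_upwards [eventually_ge_atTop (b * b)] with n hn using Nat.le_sqrt.2 hn
  refine squeeze_zero_norm' ?_ (h2.comp hsqrt)
  filter_upwards [eventually_gt_atTop 0] with n hn
  simp only [Function.comp_apply]
  -- Between consecutive squares at most `2 * k` terms are added, at a cost of `2 * k * B`,
  -- negligible against `k ^ 2`.
  set k := Nat.sqrt n with hk
  have hk0 : 0 < k := Nat.sqrt_pos.2 hn
  have hkn : k ^ 2 ≤ n := Nat.sqrt_le' n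
  have hnk : n ≤ k ^ 2 + 2 * k := by
    have := Nat.sqrt_le_add n
    rw [← hk] at this
    nlinarith
  have hk0' : (0 : ℝ) < k := by exact_mod_cast hk0
  have hn0 : (0 : ℝ) < n := by exact_mod_cast hn
  have hkn' : (k : ℝ) ^ 2 ≤ n := by exact_mod_cast hkn
  have h3 : |S n ω| ≤ |S (k ^ 2) ω| + 2 * k * B := by
    have h4 : S n ω = S (k ^ 2) ω + ∑ i ∈ Finset.Ico (k ^ 2) n, D i ω :=
      (Finset.sum_range_add_sum_Ico _ hkn).symm
    rw [h4]
    refine (abs_add_le _ _).trans (add_le_add le_rfl ?_)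
    refine (Finset.abs_sum_le_sum_abs _ _).trans ((Finset.sum_le_sum fun i _ => hB i ω).trans ?_)
    rw [Finset.sum_const, Nat.card_Ico, nsmul_eq_mul]
    refine mul_le_mul_of_nonneg_right ?_ hB0
    exact_mod_cast (by omega : n - k ^ 2 ≤ 2 * k)
  rw [Real.norm_eq_abs, abs_div, abs_div, abs_of_pos hn0, abs_of_nonneg (sq_nonneg (k : ℝ))]
  calc |S n ω| / n ≤ (|S (k ^ 2) ω| + 2 * k * B) / n := by gcongr
    _ ≤ (|S (k ^ 2) ω| + 2 * k * B) / (k : ℝ) ^ 2 := by gcongr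
    _ = |S (k ^ 2) ω| / (k : ℝ) ^ 2 + 2 * B / k := by field_simp

end Maximal

/-! ### The ergodic theorem for a stationary Markov chain without nonconstant harmonic functions. -/

section MarkovErgodic

variable {S : Type*} [MeasurableSpace S]

theorem measurable_kernel_integral (K : Kernel S S) [IsMarkovKernel K] {g : S → ℝ}
    (hg : Measurable g) : Measurable fun s => ∫ z, g z ∂(K s) :=
  (hg.stronglyMeasurable.integral_kernel).measurable

theorem abs_kernel_integral_le (K : Kernel S S) [IsMarkovKernel K] {g : S → ℝ} {C : ℝ}
    (hC : ∀ s, |g s| ≤ C) (s : S) : |∫ z, g z ∂(K s)| ≤ C := by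
  simpa using norm_integral_le_of_norm_le_const (f := g) (μ := K s) (Eventually.of_forall hC)

theorem integrable_of_measurable_of_abs_le {α : Type*} [MeasurableSpace α] {μ : Measure α}
    [IsFiniteMeasure μ] {g : α → ℝ} (hg : Measurable g) {C : ℝ} (hC : ∀ s, |g s| ≤ C) :
    Integrable g μ :=
  Integrable.of_bound hg.aestronglyMeasurable C (Eventually.of_forall hC)

/-- If every square integrable function orthogonal to the bounded coboundaries is constant, then
centred integrable functions can be approximated in `L¹` by bounded coboundaries. -/
theorem exists_coboundary_approx {ν : Measure S} [IsProbabilityMeasure ν] (K : Kernel S S)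
    [IsMarkovKernel K]
    (H : ∀ h : S → ℝ, Measurable h → MemLp h 2 ν →
      (∀ (g : S → ℝ) (C : ℝ), Measurable g → (∀ s, |g s| ≤ C) →
        ∫ s, h s * (g s - ∫ z, g z ∂(K s)) ∂ν = 0) → ∃ c, h =ᵐ[ν] fun _ => c)
    {f : S → ℝ} (hf : Integrable f ν) {ε : ℝ} (hε : 0 < ε) :
    ∃ (g : S → ℝ) (C : ℝ), Measurable g ∧ (∀ s, |g s| ≤ C) ∧
      ∫ s, |f s - (∫ z, f z ∂ν) - (g s - ∫ z, g z ∂(K s))| ∂ν ≤ ε := by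
  -- `f` is only integrable and duality needs `L²`: replace `f` by a simple function. The three
  -- thirds of `ε` pay for `f - f0`, for the difference of the means, and for the approximation in
  -- `L²`.
  obtain ⟨f0, hf0, -⟩ := (memLp_one_iff_integrable.2 hf).exists_simpleFunc_eLpNorm_sub_lt
    ENNReal.one_ne_top (ε := ENNReal.ofReal (ε / 3)) (by simpa using hε)
  have hf0i : Integrable f0 ν := f0.integrable_of_isFiniteMeasure
  have hf01 : ∫ s, |f s - f0 s| ∂ν ≤ ε / 3 := by
    have h1 := (eLpNorm_one_eq_lintegral_enorm (f := f - ⇑f0) (μ := ν)) ▸ hf0.le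
    have h2 := (hf.sub hf0i).norm
    have h3 := ofReal_integral_norm_eq_lintegral_enorm (hf.sub hf0i)
    rw [← h3] at h1
    exact (ENNReal.ofReal_le_ofReal_iff (by positivity)).1 h1
  have hmean : |(∫ s, f s ∂ν) - ∫ s, f0 s ∂ν| ≤ ε / 3 := by
    rw [← integral_sub hf hf0i]
    exact (abs_integral_le_integral_abs).trans hf01
  set c0 := ∫ s, f0 s ∂ν with hc0
  have hF : MemLp (fun s => f0 s - c0) 2 ν := (f0.memLp_of_isFiniteMeasure 2 ν).sub (memLp_const c0)
  let U : Submodule ℝ (Lp ℝ 2 ν) :=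
    { carrier := {φ | ∃ (g : S → ℝ) (C : ℝ), Measurable g ∧ (∀ s, |g s| ≤ C) ∧
        φ =ᵐ[ν] fun s => g s - ∫ z, g z ∂(K s)}
      zero_mem' := ⟨fun _ => 0, 0, measurable_const, by simp, by
        filter_upwards [Lp.coeFn_zero ℝ 2 ν] with s _
        simp⟩
      add_mem' := by
        rintro φ ψ ⟨g, C, hg, hC, hφ⟩ ⟨g', C', hg', hC', hψ⟩
        refine ⟨fun s => g s + g' s, C + C', hg.add hg', fun s =>
          (abs_add_le _ _).trans (add_le_add (hC s) (hC' s)), ?_⟩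
        filter_upwards [Lp.coeFn_add φ ψ, hφ, hψ] with s h1 h2 h3
        rw [h1, Pi.add_apply, h2, h3, integral_add
          (integrable_of_measurable_of_abs_le hg hC) (integrable_of_measurable_of_abs_le hg' hC')]
        ring
      smul_mem' := by
        rintro a φ ⟨g, C, hg, hC, hφ⟩
        refine ⟨fun s => a * g s, |a| * C, hg.const_mul a, fun s => by
          rw [abs_mul]; exact mul_le_mul_of_nonneg_left (hC s) (abs_nonneg a), ?_⟩
        filter_upwards [Lp.coeFn_smul a φ, hφ] with s h1 h2
        rw [h1, Pi.smul_apply, h2, integral_const_mul, smul_eq_mul]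
        ring }
  -- The closure of `U` is its double orthogonal complement. By `H` everything orthogonal to `U` is
  -- constant, and `f0 - c0` has mean zero, so it is orthogonal to constants.
  have hmem : hF.toLp ∈ U.topologicalClosure := by
    rw [← Submodule.orthogonal_orthogonal_eq_closure, Submodule.mem_orthogonal']
    intro h hh
    rw [Submodule.mem_orthogonal'] at hh
    obtain ⟨h', hh'm, hh'⟩ := (Lp.aestronglyMeasurable h).aemeasurable
    have hL : MemLp h' 2 ν := (memLp_congr_ae hh').1 (Lp.memLp h)
    obtain ⟨c, hc⟩ := H h' hh'm hL (by
      intro g C hg hC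
      have hgK := measurable_kernel_integral K hg
      have hb : ∀ s, |g s - ∫ z, g z ∂(K s)| ≤ C + C := fun s =>
        (abs_sub _ _).trans (add_le_add (hC s) (abs_kernel_integral_le K hC s))
      have hgL : MemLp (fun s => g s - ∫ z, g z ∂(K s)) 2 ν :=
        MemLp.of_bound (hg.sub hgK).aestronglyMeasurable (C + C) (Eventually.of_forall hb)
      have h1 := hh hgL.toLp ⟨g, C, hg, hC, hgL.coeFn_toLp⟩
      rw [L2.inner_def] at h1
      rw [← h1]
      refine integral_congr_ae ?_
      filter_upwards [hh', hgL.coeFn_toLp] with s h2 h3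
      rw [h2, h3]
      simp [mul_comm])
    rw [L2.inner_def]
    have h1 : ∫ s, (f0 s - c0) * c ∂ν = 0 := by
      rw [integral_mul_const, integral_sub hf0i (integrable_const _)]
      simp [hc0]
    rw [← h1]
    refine integral_congr_ae ?_
    filter_upwards [hh', hc, hF.coeFn_toLp] with s h2 h3 h4
    rw [h2, h3, h4]
    simp [mul_comm]
  obtain ⟨φ, ⟨g, C, hg, hC, hφ⟩, hdist⟩ := Metric.mem_closure_iff.1
    (show hF.toLp ∈ closure (U : Set (Lp ℝ 2 ν)) from hmem) (ε / 3) (by positivity)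
  refine ⟨g, C, hg, hC, ?_⟩
  have hgK := measurable_kernel_integral K hg
  have hcb : Integrable (fun s => g s - ∫ z, g z ∂(K s)) ν :=
    (integrable_of_measurable_of_abs_le hg hC).sub
      (integrable_of_measurable_of_abs_le hgK (abs_kernel_integral_le K hC))
  have hi0 : Integrable (fun s => f0 s - c0 - (g s - ∫ z, g z ∂(K s))) ν :=
    (hf0i.sub (integrable_const _)).sub hcb
  have h2 : ∫ s, |f0 s - c0 - (g s - ∫ z, g z ∂(K s))| ∂ν ≤ ε / 3 := by
    rw [Lp.dist_def] at hdist
    have h3 : eLpNorm (fun s => f0 s - c0 - (g s - ∫ z, g z ∂(K s))) 1 ν ≤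
        eLpNorm (⇑hF.toLp - ⇑φ) 2 ν := by
      refine (eLpNorm_le_eLpNorm_of_exponent_le (one_le_two) hi0.aestronglyMeasurable).trans
        (le_of_eq (eLpNorm_congr_ae ?_))
      filter_upwards [hφ, hF.coeFn_toLp] with s h4 h5
      simp [h4, h5]
    have hfin : eLpNorm (⇑hF.toLp - ⇑φ) 2 ν ≠ ∞ := ((Lp.memLp _).sub (Lp.memLp _)).2.ne
    have h4 := ENNReal.toReal_mono hfin h3
    rw [eLpNorm_one_eq_lintegral_enorm, ← integral_norm_eq_lintegral_enorm
      hi0.aestronglyMeasurable] at h4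
    exact h4.trans hdist.le
  have hfi : Integrable (fun s => |f s - f0 s|) ν := (hf.sub hf0i).abs
  calc ∫ s, |f s - (∫ z, f z ∂ν) - (g s - ∫ z, g z ∂(K s))| ∂ν
      ≤ ∫ s, (|f s - f0 s| + ε / 3 + |f0 s - c0 - (g s - ∫ z, g z ∂(K s))|) ∂ν := by
        refine integral_mono (((hf.sub (integrable_const _)).sub hcb).abs)
          ((hfi.add (integrable_const _)).add hi0.abs) fun s => ?_
        have h3 : f s - (∫ z, f z ∂ν) - (g s - ∫ z, g z ∂(K s)) = (f s - f0 s) +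
          (-((∫ z, f z ∂ν) - c0)) + (f0 s - c0 - (g s - ∫ z, g z ∂(K s))) := by ring
        simp only
        rw [h3]
        refine (abs_add_three _ _ _).trans ?_
        rw [abs_neg]
        linarith
    _ ≤ ε := by
        have h5 : Integrable (fun s => |f s - f0 s| + ε / 3) ν := hfi.add (integrable_const _)
        rw [integral_add h5 hi0.abs, integral_add hfi (integrable_const _)]
        simp only [integral_const, probReal_univ, smul_eq_mul, one_mul]
        linarith

/-- Write `g (Y i) - K g (Y i)` as the bounded martingale difference `g (Y (i + 1)) - K g (Y i)`
plus the telescoping term `g (Y i) - g (Y (i + 1))`. Martingale differences are orthogonal, so the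
strong law applies; the telescoped sum is bounded. Stationarity plays no role. -/
theorem ae_tendsto_average_coboundary {μ : Measure (ℕ → S)} [IsProbabilityMeasure μ]
    {K : Kernel S S} [IsMarkovKernel K] (hμ : IsMarkovLaw K μ) {g : S → ℝ} {C : ℝ}
    (hg : Measurable g) (hC : ∀ s, |g s| ≤ C) :
    ∀ᵐ Y ∂μ, Tendsto (fun n : ℕ =>
      (∑ i ∈ Finset.range n, (g (Y i) - ∫ z, g z ∂(K (Y i)))) / n) atTop (𝓝 0) := by
  have hgK := measurable_kernel_integral K hg
  have hKC := abs_kernel_integral_le K hC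
  have h1 := ae_tendsto_sum_div_of_orthogonal (μ := μ)
    (D := fun i Y => g (Y (i + 1)) - ∫ z, g z ∂(K (Y i))) (B := C + C)
    (fun i => (hg.comp (measurable_pi_apply _)).sub (hgK.comp (measurable_pi_apply _)))
    (fun i Y => (abs_sub _ _).trans (add_le_add (hC _) (hKC _))) (by
      intro i j hij
      let G : (Finset.Iic j → S) × S → ℝ := fun q =>
        (g (q.1 ⟨i + 1, Finset.mem_Iic.2 hij⟩) - ∫ z, g z ∂(K (q.1 ⟨i, Finset.mem_Iic.2 hij.le⟩))) *
          (g q.2 - ∫ z, g z ∂(K (q.1 ⟨j, Finset.mem_Iic.2 le_rfl⟩)))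
      have hG : Measurable G := by
        refine Measurable.mul (Measurable.sub (by fun_prop) (hgK.comp (by fun_prop)))
          (Measurable.sub (by fun_prop) (hgK.comp (by fun_prop)))
      have hGb : ∀ q, |G q| ≤ (C + C) * (C + C) := fun q => by
        rw [abs_mul]
        exact mul_le_mul ((abs_sub _ _).trans (add_le_add (hC _) (hKC _)))
          ((abs_sub _ _).trans (add_le_add (hC _) (hKC _))) (abs_nonneg _)
          ((abs_nonneg _).trans ((abs_sub _ _).trans (add_le_add (hC (q.2)) (hKC q.2))))
      refine (hμ.integral_eq j hG (integrable_of_measurable_of_abs_le (hG.comp ?_)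
        fun Y => hGb _)).trans ?_
      · exact (measurable_past j).prodMk (measurable_pi_apply _)
      · rw [← integral_zero (ℕ → S) ℝ]
        refine integral_congr_ae (Eventually.of_forall fun Y => ?_)
        simp only [G, Preorder.frestrictLe_apply]
        rw [integral_const_mul, integral_sub (integrable_of_measurable_of_abs_le hg hC)
          (integrable_const _)]
        simp)
  filter_upwards [h1] with Y hY
  have h2 : Tendsto (fun n : ℕ => (g (Y 0) - g (Y n)) / n) atTop (𝓝 0) := by
    refine squeeze_zero_norm (fun n => ?_) (tendsto_const_div_atTop_nhds_zero_nat (C + C))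
    rw [Real.norm_eq_abs, abs_div, Nat.abs_cast]
    gcongr
    exact (abs_sub _ _).trans (add_le_add (hC _) (hC _))
  have h3 := hY.add h2
  rw [add_zero] at h3
  refine h3.congr fun n => ?_
  rw [← add_div]
  congr 1
  have := Finset.sum_range_sub (fun i => g (Y i)) n
  simp only [Finset.sum_sub_distrib] at this ⊢
  linarith

/-- The pointwise ergodic theorem for a stationary Markov chain. -/
theorem ae_tendsto_average_chainLaw {ν : Measure S} [IsProbabilityMeasure ν] (K : Kernel S S)
    [IsMarkovKernel K] (hν : K ∘ₘ ν = ν)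
    (H : ∀ h : S → ℝ, Measurable h → MemLp h 2 ν →
      (∀ (g : S → ℝ) (C : ℝ), Measurable g → (∀ s, |g s| ≤ C) →
        ∫ s, h s * (g s - ∫ z, g z ∂(K s)) ∂ν = 0) → ∃ c, h =ᵐ[ν] fun _ => c)
    {f : S → ℝ} (hfm : Measurable f) (hf : Integrable f ν) :
    ∀ᵐ s ∂ν, ∀ᵐ Y ∂(chainLaw K s), Tendsto (fun n : ℕ =>
      (∑ i ∈ Finset.range n, f (Y i)) / n) atTop (𝓝 (∫ z, f z ∂ν)) := by
  have hθ := measurePreserving_shift hν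
  have h0 := map_zero_comp_chainLaw K ν
  have hev : Measurable (fun Y : ℕ → S => Y 0) := measurable_pi_apply 0
  have hiter : ∀ (i : ℕ) (Y : ℕ → S), (fun (Y : ℕ → S) n => Y (n + 1))^[i] Y =
      fun n => Y (n + i) := by
    intro i
    induction i with
    | zero => intro Y; rfl
    | succ i ih =>
      intro Y
      rw [Function.iterate_succ_apply, ih]
      funext n
      congr 1
  have hsum : ∀ (φ : S → ℝ) (n : ℕ) (Y : ℕ → S),
      birkhoffSum (fun (Y : ℕ → S) n => Y (n + 1)) (fun Y => φ (Y 0)) n Y =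
        ∑ i ∈ Finset.range n, φ (Y i) := by
    intro φ n Y
    simp [birkhoffSum, hiter]
  have hint : ∀ φ : S → ℝ, Measurable φ → Integrable φ ν →
      Integrable (fun Y : ℕ → S => φ (Y 0)) (chainLaw K ∘ₘ ν) := by
    intro φ hφ hφi
    rw [← h0] at hφi
    exact hφi.comp_measurable hev
  have key := ae_tendsto_birkhoffSum_div_of_approx hθ (hfm.comp hev) (hint f hfm hf)
    (c := ∫ z, f z ∂ν) (by
      intro ε hε
      obtain ⟨g, C, hg, hC, hgε⟩ := exists_coboundary_approx K H hf hε
      have hgK := measurable_kernel_integral K hg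
      -- The approximant is the exact mean of `f` plus a coboundary, so its averages already have
      -- the right limit and `c' = c`.
      set f' : S → ℝ := fun s => (∫ z, f z ∂ν) + (g s - ∫ z, g z ∂(K s)) with hf'
      have hf'm : Measurable f' := (hg.sub hgK).const_add _
      have hf'i : Integrable f' ν := (integrable_const _).add
        ((integrable_of_measurable_of_abs_le hg hC).sub
          (integrable_of_measurable_of_abs_le hgK (abs_kernel_integral_le K hC)))
      refine ⟨fun Y => f' (Y 0), ∫ z, f z ∂ν, hf'm.comp hev, hint f' hf'm hf'i, ?_, by
        simpa using hε.le, ?_⟩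
      · have h1 : ∫ Y, |f (Y 0) - f' (Y 0)| ∂(chainLaw K ∘ₘ ν) = ∫ s, |f s - f' s| ∂ν := by
          conv_rhs => rw [← h0]
          rw [integral_map hev.aemeasurable]
          exact (hfm.sub hf'm).abs.aestronglyMeasurable
        refine h1.le.trans (le_trans (le_of_eq ?_) hgε)
        simp only [hf', sub_sub]
      · filter_upwards [ae_tendsto_average_coboundary (isMarkovLaw_comp K ν) hg hC] with Y hY
        have h2 := hY.const_add (∫ z, f z ∂ν)
        rw [add_zero] at h2
        refine h2.congr' ?_
        filter_upwards [eventually_gt_atTop 0] with n hn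
        have hn0 : (n : ℝ) ≠ 0 := by exact_mod_cast hn.ne'
        rw [hsum]
        simp only [hf', Finset.sum_add_distrib, Finset.sum_const, Finset.card_range, nsmul_eq_mul]
        field_simp)
  have key2 : ∀ᵐ Y ∂(chainLaw K ∘ₘ ν), Tendsto (fun n : ℕ =>
      (∑ i ∈ Finset.range n, f (Y i)) / n) atTop (𝓝 (∫ z, f z ∂ν)) := by
    filter_upwards [key] with Y hY
    refine hY.congr fun n => ?_
    rw [← hsum]
    rfl
  exact Measure.ae_ae_of_ae_comp key2

end MarkovErgodic

/-! ### Galton–Watson trees: `Z_n / m^n` converges almost surely, with an `L²` limit of mean one. -/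

namespace GWRay

theorem lintegral_lawOf (q : ℕ → ℝ) (g : ℕ → ℝ≥0∞) :
    ∫⁻ k, g k ∂(lawOf q) = ∑' k, ENNReal.ofReal (q k) * g k := by
  simp [lawOf, lintegral_sum_measure, lintegral_smul_measure, lintegral_dirac]

namespace OffspringLaw

variable (p : OffspringLaw)

/-- Exponentials dominate powers. This is the only use of the exponential moment, and only the
exponents `1` and `2` are needed. -/
theorem summable_pow_mul (j : ℕ) : Summable fun k : ℕ => (k : ℝ) ^ j * p.prob k := by
  obtain ⟨β, hβ, hs⟩ := p.exp_moment
  refine Summable.of_norm_bounded_eventually_nat hs ?_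
  have h := (tendsto_pow_const_div_const_pow_of_one_lt j hβ).eventually_le_const one_pos
  filter_upwards [h] with k hk
  have hβk : 0 < β ^ k := pow_pos (by linarith) k
  rw [div_le_one hβk] at hk
  rw [Real.norm_of_nonneg (mul_nonneg (by positivity) (p.nonneg k))]
  exact mul_le_mul_of_nonneg_right hk (p.nonneg k)

theorem lintegral_ordinary_id : ∫⁻ k, (k : ℝ≥0∞) ∂p.ordinary = ENNReal.ofReal p.mean := by
  rw [ordinary, lintegral_lawOf, mean, ENNReal.ofReal_tsum_of_nonneg
    (fun k => mul_nonneg k.cast_nonneg (p.nonneg k)) p.hasSum_mean.summable]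
  refine tsum_congr fun k => ?_
  rw [ENNReal.ofReal_mul k.cast_nonneg, ENNReal.ofReal_natCast, mul_comm]

theorem lintegral_ordinary_sq_ne_top : ∫⁻ k, (k : ℝ≥0∞) ^ 2 ∂p.ordinary ≠ ∞ := by
  rw [ordinary, lintegral_lawOf]
  refine ne_of_eq_of_ne (tsum_congr fun k => ?_) (p.summable_pow_mul 2).tsum_ofReal_ne_top
  rw [ENNReal.ofReal_mul (by positivity), ENNReal.ofReal_pow k.cast_nonneg,
    ENNReal.ofReal_natCast, mul_comm]

theorem lintegral_averaged_id_ne_top : ∫⁻ k, (k : ℝ≥0∞) ∂p.averaged ≠ ∞ := by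
  rw [averaged, lintegral_lawOf]
  have hm := p.mean_pos
  have hs : Summable fun k : ℕ => (p.mean + k) * p.prob k / (2 * p.mean) * k := by
    have := (((p.summable_pow_mul 1).mul_left p.mean).add (p.summable_pow_mul 2)).div_const
      (2 * p.mean)
    refine this.congr fun k => ?_
    ring
  refine ne_of_eq_of_ne (tsum_congr fun k => ?_) hs.tsum_ofReal_ne_top
  rw [ENNReal.ofReal_mul (div_nonneg (mul_nonneg (by positivity) (p.nonneg k)) (by positivity)),
    ENNReal.ofReal_natCast]

end OffspringLaw

/-- The subtree of the `i`-th child of the root. -/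
def RootedTree.child (τ : RootedTree) (i : ℕ) : RootedTree := fun w => τ (w ++ [i])

/-- Generations are defined by adding a last step, at the head of the word. Independence of the
branches requires splitting off the first step from the root, which is the last letter. -/
theorem mem_generation_succ (τ : RootedTree) (n : ℕ) (w : List ℕ) :
    w ∈ τ.generation (n + 1) ↔
      ∃ i < τ [], ∃ u ∈ (τ.child i).generation n, w = u ++ [i] := by
  induction n generalizing w with
  | zero =>
    simp only [RootedTree.generation, Finset.singleton_biUnion, Finset.mem_image, Finset.mem_range,
      Finset.mem_singleton]
    constructor
    · rintro ⟨i, hi, rfl⟩; exact ⟨i, hi, [], rfl, rfl⟩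
    · rintro ⟨i, hi, u, rfl, rfl⟩; exact ⟨i, hi, rfl⟩
  | succ n ih =>
    rw [RootedTree.generation]
    simp only [Finset.mem_biUnion, Finset.mem_image, Finset.mem_range, ih]
    constructor
    · rintro ⟨v, ⟨i, hi, u, hu, rfl⟩, j, hj, rfl⟩
      refine ⟨i, hi, j :: u, ?_, rfl⟩
      rw [RootedTree.generation]
      simp only [Finset.mem_biUnion, Finset.mem_image, Finset.mem_range]
      exact ⟨u, hu, j, hj, rfl⟩
    · rintro ⟨i, hi, u', hu', rfl⟩
      rw [RootedTree.generation] at hu'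
      simp only [Finset.mem_biUnion, Finset.mem_image, Finset.mem_range] at hu'
      obtain ⟨u, hu, j, hj, rfl⟩ := hu'
      exact ⟨u ++ [i], ⟨i, hi, u, hu, rfl⟩, j, hj, rfl⟩

theorem card_generation_succ (τ : RootedTree) (n : ℕ) :
    (τ.generation (n + 1)).card =
      ∑ i ∈ Finset.range (τ []), ((τ.child i).generation n).card := by
  have h : τ.generation (n + 1) = (Finset.range (τ [])).biUnion
      fun i => ((τ.child i).generation n).image (fun u => u ++ [i]) := by
    ext w
    simp only [mem_generation_succ, Finset.mem_biUnion, Finset.mem_image, Finset.mem_range]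
    refine exists_congr fun i => and_congr_right fun _ => exists_congr fun u =>
      and_congr_right fun _ => eq_comm
  rw [h, Finset.card_biUnion]
  · exact Finset.sum_congr rfl fun i _ =>
      Finset.card_image_of_injective _ fun a b hab => by simpa using hab
  · intro i _ j _ hij
    rw [Function.onFun, Finset.disjoint_left]
    intro w hw hw'
    obtain ⟨u, -, rfl⟩ := Finset.mem_image.1 hw
    obtain ⟨u', -, h'⟩ := Finset.mem_image.1 hw'
    exact hij (by simpa using (List.append_inj_right' h' rfl).symm)

theorem measurable_child (i : ℕ) : Measurable fun τ : RootedTree => τ.child i :=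
  measurable_pi_lambda _ fun _ => measurable_pi_apply _

theorem measurable_sum_range {α β : Type*} [MeasurableSpace α] [MeasurableSpace β]
    [AddCommMonoid β] [MeasurableAdd₂ β]
    {N : α → ℕ} (hN : Measurable N) {F : ℕ → α → β} (hF : ∀ i, Measurable (F i)) :
    Measurable fun x => ∑ i ∈ Finset.range (N x), F i x := by
  have h : Measurable fun q : ℕ × α => ∑ i ∈ Finset.range q.1, F i q.2 :=
    measurable_from_prod_countable_right fun k =>
      (Finset.measurable_sum (Finset.range k) fun i _ => hF i :
        Measurable fun x => ∑ i ∈ Finset.range k, F i x)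
  exact h.comp (hN.prodMk measurable_id)

theorem measurable_card_generation (n : ℕ) :
    Measurable fun τ : RootedTree => (τ.generation n).card := by
  induction n with
  | zero => exact measurable_const
  | succ n ih =>
    simp_rw [card_generation_succ]
    exact measurable_sum_range (measurable_pi_apply _) fun i => ih.comp (measurable_child i)

variable (p : OffspringLaw)

theorem map_child_GW (i : ℕ) : (GW p).map (fun τ => τ.child i) = GW p :=
  Measure.map_infinitePi_infinitePi_of_inj (P := fun _ : List ℕ => p.ordinary)
    (f := fun w : List ℕ => w ++ [i]) fun a b h => by simpa using h

theorem measurePreserving_child (i : ℕ) :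
    MeasurePreserving (fun τ : RootedTree => τ.child i) (GW p) (GW p) :=
  ⟨measurable_child i, map_child_GW p i⟩

/-- Conditioning on the root degree: `hF'` says that `F k` ignores the root, so it is independent of
the number of children. -/
theorem lintegral_GW_root {F : ℕ → RootedTree → ℝ≥0∞} (hF : ∀ k, Measurable (F k))
    (hF' : ∀ k τ x, F k (Function.update τ [] x) = F k τ) :
    ∫⁻ τ, F (τ []) τ ∂(GW p) = ∫⁻ k, ∫⁻ τ, F k τ ∂(GW p) ∂p.ordinary := by
  have hm : Measurable fun τ : RootedTree => F (τ []) τ := by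
    have h : Measurable fun q : ℕ × RootedTree => F q.1 q.2 :=
      measurable_from_prod_countable_right hF
    have h' : Measurable fun τ : RootedTree => (τ [], τ) :=
      (measurable_pi_apply []).prodMk measurable_id
    exact h.comp h'
  rw [GW, lintegral_infinitePi_update_symm (P := fun _ : List ℕ => p.ordinary) [] (fun _ _ => rfl)
    hm]
  simp only [Function.update_self, hF']

theorem child_update (τ : RootedTree) (i x : ℕ) :
    RootedTree.child (Function.update τ [] x) i = τ.child i := by
  funext w
  simp [RootedTree.child, Function.update]

/-- Wald's identity: each child carries a copy of `GW` independent of the number of children, whose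
mean is `m`. -/
theorem lintegral_sum_child {F : RootedTree → ℝ≥0∞} (hF : Measurable F) :
    ∫⁻ τ, ∑ i ∈ Finset.range (τ []), F (τ.child i) ∂(GW p) =
      ENNReal.ofReal p.mean * ∫⁻ τ, F τ ∂(GW p) := by
  have hm : ∀ i, Measurable fun τ : RootedTree => F (τ.child i) := fun i =>
    hF.comp (measurable_child i)
  rw [lintegral_GW_root p (F := fun k τ => ∑ i ∈ Finset.range k, F (τ.child i))
    (fun k => Finset.measurable_sum _ fun i _ => hm i) (fun k τ x => by simp only [child_update])]
  have : ∀ k : ℕ, ∫⁻ τ, ∑ i ∈ Finset.range k, F (τ.child i) ∂(GW p) =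
      k * ∫⁻ τ, F τ ∂(GW p) := by
    intro k
    rw [lintegral_finsetSum _ fun i _ => hm i]
    simp [(measurePreserving_child p _).lintegral_comp hF]
  simp_rw [this]
  rw [lintegral_mul_const _ (by fun_prop), p.lintegral_ordinary_id]

theorem indepFun_child {i j : ℕ} (hij : i ≠ j) :
    IndepFun (fun τ : RootedTree => τ.child i) (fun τ => τ.child j) (GW p) := by
  refine indepFun_infinitePi_of_dependsOn (measurable_child i) (measurable_child j)
    (A := {w | ∃ u, w = u ++ [i]}) (B := {w | ∃ u, w = u ++ [j]}) ?_ ?_ ?_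
  · intro τ τ' h
    funext w
    exact h _ ⟨w, rfl⟩
  · intro τ τ' h
    funext w
    exact h _ ⟨w, rfl⟩
  · rw [Set.disjoint_left]
    rintro _ ⟨u, rfl⟩ ⟨u', h'⟩
    exact hij (by simpa using (List.append_inj_right' h' rfl))

/-- Given the number of children, the terms are independent and centred; the cross terms vanish and
only the diagonal survives. -/
theorem lintegral_sq_sum_child {φ : RootedTree → ℝ} (hφ : Measurable φ)
    (h2 : MemLp φ 2 (GW p)) (h0 : ∫ τ, φ τ ∂(GW p) = 0) :
    ∫⁻ τ, ENNReal.ofReal ((∑ i ∈ Finset.range (τ []), φ (τ.child i)) ^ 2) ∂(GW p) =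
      ENNReal.ofReal p.mean * ∫⁻ τ, ENNReal.ofReal (φ τ ^ 2) ∂(GW p) := by
  have hm : ∀ i, Measurable fun τ : RootedTree => φ (τ.child i) := fun i =>
    hφ.comp (measurable_child i)
  have hL : ∀ i, MemLp (fun τ : RootedTree => φ (τ.child i)) 2 (GW p) := fun i =>
    h2.comp_measurePreserving (measurePreserving_child p i)
  rw [lintegral_GW_root p
    (F := fun k τ => ENNReal.ofReal ((∑ i ∈ Finset.range k, φ (τ.child i)) ^ 2))
    (fun k => ((Finset.measurable_sum _ fun i _ => hm i).pow_const 2).ennreal_ofReal)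
    (fun k τ x => by simp only [child_update])]
  have : ∀ k : ℕ, ∫⁻ τ, ENNReal.ofReal ((∑ i ∈ Finset.range k, φ (τ.child i)) ^ 2) ∂(GW p) =
      k * ∫⁻ τ, ENNReal.ofReal (φ τ ^ 2) ∂(GW p) := by
    intro k
    have hLk : MemLp (fun τ : RootedTree => ∑ i ∈ Finset.range k, φ (τ.child i)) 2 (GW p) :=
      memLp_finsetSum _ fun i _ => hL i
    rw [← ofReal_integral_eq_lintegral_ofReal hLk.integrable_sq
      (Eventually.of_forall fun _ => sq_nonneg _), ← ofReal_integral_eq_lintegral_ofReal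
      h2.integrable_sq (Eventually.of_forall fun _ => sq_nonneg _), ← ENNReal.ofReal_natCast,
      ← ENNReal.ofReal_mul k.cast_nonneg]
    congr 1
    have hprod : ∀ i j, Integrable (fun τ : RootedTree => φ (τ.child i) * φ (τ.child j)) (GW p) :=
      fun i j => (hL i).integrable_mul (hL j)
    have hmean : ∀ i, ∫ τ, φ (RootedTree.child τ i) ∂(GW p) = 0 := by
      intro i
      rw [← h0]
      conv_rhs => rw [← map_child_GW p i]
      exact (integral_map (measurable_child i).aemeasurable hφ.aestronglyMeasurable).symm
    have hoff : ∀ i j, i ≠ j → ∫ τ, φ (RootedTree.child τ i) * φ (RootedTree.child τ j) ∂(GW p) = 0 := by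
      intro i j hij
      have := ((indepFun_child p hij).comp hφ hφ).integral_fun_mul_eq_mul_integral
        (hm i).aestronglyMeasurable (hm j).aestronglyMeasurable
      simp only [Function.comp_apply] at this
      rw [this, hmean i, zero_mul]
    have hdiag : ∀ i, ∫ τ, φ (RootedTree.child τ i) * φ (RootedTree.child τ i) ∂(GW p) =
        ∫ τ, φ τ ^ 2 ∂(GW p) := by
      intro i
      conv_rhs => rw [← map_child_GW p i]
      rw [integral_map (measurable_child i).aemeasurable (hφ.pow_const 2).aestronglyMeasurable]
      simp only [sq]
    have hexp : ∀ τ : RootedTree, (∑ i ∈ Finset.range k, φ (τ.child i)) ^ 2 =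
        ∑ i ∈ Finset.range k, ∑ j ∈ Finset.range k, φ (τ.child i) * φ (τ.child j) := fun τ => by
      rw [sq, Finset.sum_mul_sum]
    simp_rw [hexp]
    rw [integral_finsetSum _ fun i _ => integrable_finsetSum _ fun j _ => hprod i j]
    have : ∀ i ∈ Finset.range k, ∫ τ, ∑ j ∈ Finset.range k,
        φ (RootedTree.child τ i) * φ (RootedTree.child τ j) ∂(GW p) = ∫ τ, φ τ ^ 2 ∂(GW p) := by
      intro i hi
      rw [integral_finsetSum _ fun j _ => hprod i j, Finset.sum_eq_single_of_mem i hi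
        fun j _ hji => hoff i j hji.symm, hdiag]
    rw [Finset.sum_congr rfl this]
    simp
  simp_rw [this]
  rw [lintegral_mul_const _ (by fun_prop), p.lintegral_ordinary_id]

/-- The normalized generation sizes `Z_n / m^n`. -/
noncomputable def normGen (n : ℕ) (τ : RootedTree) : ℝ := ((τ.generation n).card : ℝ) / p.mean ^ n

/-- The increments of the normalized generation sizes. -/
noncomputable def normGenDiff (n : ℕ) (τ : RootedTree) : ℝ := normGen p (n + 1) τ - normGen p n τ

theorem measurable_normGen (n : ℕ) : Measurable (normGen p n) :=
  ((measurable_from_top (f := fun k : ℕ => (k : ℝ))).comp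
    (measurable_card_generation n)).div_const _

theorem measurable_normGenDiff (n : ℕ) : Measurable (normGenDiff p n) :=
  (measurable_normGen p _).sub (measurable_normGen p _)

theorem normGen_nonneg (n : ℕ) (τ : RootedTree) : 0 ≤ normGen p n τ :=
  div_nonneg (Nat.cast_nonneg _) (pow_pos p.mean_pos n).le

theorem normGen_succ (n : ℕ) (τ : RootedTree) :
    normGen p (n + 1) τ = p.mean⁻¹ * ∑ i ∈ Finset.range (τ []), normGen p n (τ.child i) := by
  have hm := p.mean_pos.ne'
  simp only [normGen, card_generation_succ, ← Finset.sum_div]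
  push_cast
  field_simp
  ring

theorem normGenDiff_succ (n : ℕ) (τ : RootedTree) :
    normGenDiff p (n + 1) τ =
      p.mean⁻¹ * ∑ i ∈ Finset.range (τ []), normGenDiff p n (τ.child i) := by
  simp only [normGenDiff, Finset.sum_sub_distrib, mul_sub]
  rw [normGen_succ p (n + 1), normGen_succ p n]

theorem lintegral_normGen (n : ℕ) : ∫⁻ τ, ENNReal.ofReal (normGen p n τ) ∂(GW p) = 1 := by
  induction n with
  | zero => simp [normGen, RootedTree.generation]
  | succ n ih =>
    have hm := p.mean_pos
    have e : ∀ τ, ENNReal.ofReal (normGen p (n + 1) τ) = ENNReal.ofReal p.mean⁻¹ *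
        ∑ i ∈ Finset.range (τ []), ENNReal.ofReal (normGen p n (τ.child i)) := by
      intro τ
      rw [normGen_succ, ENNReal.ofReal_mul (by positivity),
        ENNReal.ofReal_sum_of_nonneg fun i _ => normGen_nonneg p _ _]
    simp_rw [e]
    have hmeas : Measurable fun τ : RootedTree =>
        ∑ i ∈ Finset.range (τ []), ENNReal.ofReal (normGen p n (τ.child i)) :=
      measurable_sum_range (measurable_pi_apply _)
        fun i => ((measurable_normGen p n).comp (measurable_child i)).ennreal_ofReal
    rw [lintegral_const_mul _ hmeas,
      lintegral_sum_child p (measurable_normGen p n).ennreal_ofReal, ih, mul_one,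
      ← ENNReal.ofReal_mul (by positivity), inv_mul_cancel₀ hm.ne', ENNReal.ofReal_one]

theorem integrable_normGen (n : ℕ) : Integrable (normGen p n) (GW p) := by
  refine ⟨(measurable_normGen p n).aestronglyMeasurable, ?_⟩
  rw [hasFiniteIntegral_iff_ofReal (Eventually.of_forall (normGen_nonneg p n)),
    lintegral_normGen]
  exact ENNReal.one_lt_top

theorem integral_normGen (n : ℕ) : ∫ τ, normGen p n τ ∂(GW p) = 1 := by
  rw [integral_eq_lintegral_of_nonneg_ae (Eventually.of_forall (normGen_nonneg p n))
    (measurable_normGen p n).aestronglyMeasurable, lintegral_normGen, ENNReal.toReal_one]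

theorem integral_normGenDiff (n : ℕ) : ∫ τ, normGenDiff p n τ ∂(GW p) = 0 := by
  simp only [normGenDiff]
  rw [integral_sub (integrable_normGen p _) (integrable_normGen p _), integral_normGen,
    integral_normGen, sub_self]

theorem lintegral_root_GW (g : ℕ → ℝ≥0∞) :
    ∫⁻ τ, g (τ []) ∂(GW p) = ∫⁻ k, g k ∂p.ordinary := by
  rw [lintegral_GW_root p (F := fun k _ => g k) (fun _ => measurable_const) (fun _ _ _ => rfl)]
  simp

theorem lintegral_sq_normGenDiff_zero_ne_top :
    ∫⁻ τ, ENNReal.ofReal (normGenDiff p 0 τ ^ 2) ∂(GW p) ≠ ∞ := by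
  have hm := p.one_lt_mean
  change 1 < p.mean at hm
  have hle : ∀ τ : RootedTree, ENNReal.ofReal (normGenDiff p 0 τ ^ 2) ≤
      (τ [] : ℝ≥0∞) ^ 2 + 1 := by
    intro τ
    have e : normGenDiff p 0 τ = (τ [] : ℝ) / p.mean - 1 := by
      have h1 : (τ.generation 1).card = τ [] := by
        rw [card_generation_succ τ 0]; simp [RootedTree.generation]
      simp only [normGenDiff, normGen, zero_add, h1]
      simp [RootedTree.generation]
    have h1 : (τ [] : ℝ) / p.mean ≤ τ [] := div_le_self (Nat.cast_nonneg _) hm.le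
    have h2 : 0 ≤ (τ [] : ℝ) / p.mean := by positivity
    have h3 : normGenDiff p 0 τ ^ 2 ≤ (τ [] : ℝ) ^ 2 + 1 := by
      rw [e]; nlinarith
    refine (ENNReal.ofReal_le_ofReal h3).trans (le_of_eq ?_)
    rw [ENNReal.ofReal_add (by positivity) zero_le_one, ENNReal.ofReal_pow (Nat.cast_nonneg _),
      ENNReal.ofReal_natCast, ENNReal.ofReal_one]
  refine ne_top_of_le_ne_top ?_ (lintegral_mono hle)
  rw [lintegral_add_right _ measurable_const, lintegral_root_GW p fun k => (k : ℝ≥0∞) ^ 2]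
  simpa using p.lintegral_ordinary_sq_ne_top

theorem memLp_two_of_lintegral_sq {α : Type*} [MeasurableSpace α] {μ : Measure α} {f : α → ℝ}
    (hf : Measurable f) (h : ∫⁻ x, ENNReal.ofReal (f x ^ 2) ∂μ ≠ ∞) : MemLp f 2 μ := by
  rw [memLp_two_iff_integrable_sq hf.aestronglyMeasurable]
  refine ⟨(hf.pow_const 2).aestronglyMeasurable, ?_⟩
  rw [hasFiniteIntegral_iff_ofReal (Eventually.of_forall fun _ => sq_nonneg _)]
  exact h.lt_top

theorem eLpNorm_two_eq {α : Type*} [MeasurableSpace α] {μ : Measure α} (f : α → ℝ) :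
    eLpNorm f 2 μ = (∫⁻ x, ENNReal.ofReal (f x ^ 2) ∂μ) ^ (1 / 2 : ℝ) := by
  rw [eLpNorm_eq_lintegral_rpow_enorm_toReal two_ne_zero ENNReal.ofNat_ne_top]
  simp only [ENNReal.toReal_ofNat, ENNReal.rpow_ofNat]
  congr 2
  funext x
  rw [← sq_abs, ENNReal.ofReal_pow (abs_nonneg _), ← Real.enorm_eq_ofReal_abs]

/-- Each generation brings a factor `m⁻²` from the normalization and `m` from the expected number of
children. The resulting decay `m⁻ⁿ` makes the telescoping series for `Z_n / m^n` converge
absolutely, so no martingale convergence theorem is needed. -/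
theorem lintegral_sq_normGenDiff (n : ℕ) :
    ∫⁻ τ, ENNReal.ofReal (normGenDiff p n τ ^ 2) ∂(GW p) =
      ENNReal.ofReal p.mean⁻¹ ^ n * ∫⁻ τ, ENNReal.ofReal (normGenDiff p 0 τ ^ 2) ∂(GW p) := by
  induction n with
  | zero => simp
  | succ n ih =>
    have hm := p.mean_pos
    have hfin : ∫⁻ τ, ENNReal.ofReal (normGenDiff p n τ ^ 2) ∂(GW p) ≠ ∞ := by
      rw [ih]
      exact ENNReal.mul_ne_top (ENNReal.pow_ne_top ENNReal.ofReal_ne_top)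
        (lintegral_sq_normGenDiff_zero_ne_top p)
    have e : ∀ τ, ENNReal.ofReal (normGenDiff p (n + 1) τ ^ 2) = ENNReal.ofReal (p.mean⁻¹ ^ 2) *
        ENNReal.ofReal ((∑ i ∈ Finset.range (τ []), normGenDiff p n (τ.child i)) ^ 2) := by
      intro τ
      rw [normGenDiff_succ, mul_pow, ENNReal.ofReal_mul (by positivity)]
    simp_rw [e]
    have hmeas : Measurable fun τ : RootedTree =>
        ∑ i ∈ Finset.range (τ []), normGenDiff p n (τ.child i) :=
      measurable_sum_range (measurable_pi_apply _)
        fun i => (measurable_normGenDiff p n).comp (measurable_child i)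
    rw [lintegral_const_mul _ (hmeas.pow_const 2).ennreal_ofReal,
      lintegral_sq_sum_child p (measurable_normGenDiff p n)
        (memLp_two_of_lintegral_sq (measurable_normGenDiff p n) hfin) (integral_normGenDiff p n),
      ih, ← mul_assoc, ← mul_assoc, ← ENNReal.ofReal_mul (by positivity),
      (by field_simp : p.mean⁻¹ ^ 2 * p.mean = p.mean⁻¹), ← pow_succ']

theorem tsum_eLpNorm_normGenDiff_ne_top :
    ∑' n, eLpNorm (normGenDiff p n) 2 (GW p) ≠ ∞ := by
  have hm := p.one_lt_mean
  change 1 < p.mean at hm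
  have e : ∀ n, eLpNorm (normGenDiff p n) 2 (GW p) =
      (ENNReal.ofReal p.mean⁻¹ ^ (1 / 2 : ℝ)) ^ n * eLpNorm (normGenDiff p 0) 2 (GW p) := by
    intro n
    rw [eLpNorm_two_eq, lintegral_sq_normGenDiff, eLpNorm_two_eq,
      ENNReal.mul_rpow_of_nonneg _ _ (by positivity), ← ENNReal.rpow_natCast,
      ← ENNReal.rpow_natCast, ← ENNReal.rpow_mul, ← ENNReal.rpow_mul, mul_comm (n : ℝ)]
  rw [tsum_congr e, ENNReal.tsum_mul_right, ENNReal.tsum_geometric]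
  refine ENNReal.mul_ne_top ?_ ?_
  · rw [Ne, ENNReal.inv_eq_top, tsub_eq_zero_iff_le, not_le]
    refine ENNReal.rpow_lt_one ?_ (by positivity)
    rw [ENNReal.ofReal_lt_one]
    exact inv_lt_one_of_one_lt₀ hm
  · rw [eLpNorm_two_eq]
    exact ENNReal.rpow_ne_top_of_nonneg (by positivity) (lintegral_sq_normGenDiff_zero_ne_top p)

theorem normGen_eq_sum (n : ℕ) (τ : RootedTree) :
    normGen p n τ = 1 + ∑ k ∈ Finset.range n, normGenDiff p k τ := by
  have h := Finset.sum_range_sub (fun k => normGen p k τ) n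
  have h0 : normGen p 0 τ = 1 := by simp [normGen, RootedTree.generation]
  simp only [normGenDiff]
  linarith

/-- Used twice: with Fatou it puts `W` in `L²`, and it bounds the densities of the iterates of `up`.
-/
theorem exists_eLpNorm_normGen_le :
    ∃ C : ℝ≥0∞, C ≠ ∞ ∧ ∀ n, eLpNorm (normGen p n) 2 (GW p) ≤ C := by
  refine ⟨1 + ∑' n, eLpNorm (normGenDiff p n) 2 (GW p),
    ENNReal.add_ne_top.2 ⟨ENNReal.one_ne_top, tsum_eLpNorm_normGenDiff_ne_top p⟩, fun n => ?_⟩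
  have e : normGen p n = (fun _ => (1 : ℝ)) + ∑ k ∈ Finset.range n, normGenDiff p k := by
    funext τ
    simp [normGen_eq_sum p n τ]
  rw [e]
  refine (eLpNorm_add_le aestronglyMeasurable_const
    (Finset.aestronglyMeasurable_sum _ fun k _ =>
      (measurable_normGenDiff p k).aestronglyMeasurable) one_le_two).trans ?_
  refine add_le_add ?_ ?_
  · rw [eLpNorm_const _ two_ne_zero (NeZero.ne _)]
    simp
  · exact (eLpNorm_sum_le (fun k _ => (measurable_normGenDiff p k).aestronglyMeasurable)
      one_le_two).trans (ENNReal.sum_le_tsum _)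

theorem lintegral_tsum_normGenDiff_ne_top :
    ∫⁻ τ, ∑' n, ‖normGenDiff p n τ‖ₑ ∂(GW p) ≠ ∞ := by
  rw [lintegral_tsum fun n => (measurable_normGenDiff p n).enorm.aemeasurable]
  refine ne_top_of_le_ne_top (tsum_eLpNorm_normGenDiff_ne_top p)
    (ENNReal.tsum_le_tsum fun n => ?_)
  rw [← eLpNorm_one_eq_lintegral_enorm]
  exact eLpNorm_le_eLpNorm_of_exponent_le one_le_two
    (measurable_normGenDiff p n).aestronglyMeasurable

theorem ae_tsum_normGenDiff_ne_top : ∀ᵐ τ ∂(GW p), ∑' n, ‖normGenDiff p n τ‖ₑ ≠ ∞ := by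
  filter_upwards [ae_lt_top' (AEMeasurable.tsum fun n =>
    (measurable_normGenDiff p n).enorm.aemeasurable) (lintegral_tsum_normGenDiff_ne_top p)]
    with τ hτ using hτ.ne

theorem ae_tendsto_rootW :
    ∀ᵐ τ ∂(GW p), Tendsto (fun n => normGen p n τ) atTop (𝓝 (rootW p τ)) := by
  filter_upwards [ae_tsum_normGenDiff_ne_top p] with τ hτ
  have hs : Summable fun n => normGenDiff p n τ := by
    refine Summable.of_nnnorm ?_
    exact ENNReal.tsum_coe_ne_top_iff_summable.1 hτ
  have h : Tendsto (fun n => normGen p n τ) atTop (𝓝 (1 + ∑' n, normGenDiff p n τ)) := by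
    simp_rw [normGen_eq_sum]
    exact hs.hasSum.tendsto_sum_nat.const_add 1
  exact tendsto_nhds_limUnder ⟨_, h⟩

theorem measurable_rootW : Measurable (rootW p) :=
  (StronglyMeasurable.limUnder fun n => (measurable_normGen p n).stronglyMeasurable).measurable

theorem memLp_rootW : MemLp (rootW p) 2 (GW p) := by
  obtain ⟨C, hC, h⟩ := exists_eLpNorm_normGen_le p
  refine ⟨(measurable_rootW p).aestronglyMeasurable, ?_⟩
  have h1 := Lp.eLpNorm_lim_le_liminf_eLpNorm (μ := GW p) (p := 2)
    (fun n => (measurable_normGen p n).aestronglyMeasurable) (rootW p) (ae_tendsto_rootW p)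
  refine lt_of_le_of_lt (h1.trans ?_) hC.lt_top
  refine (liminf_le_liminf (Eventually.of_forall h)).trans ?_
  simp

/-- Dominated convergence, with `1` plus the sum of the absolute increments as the integrable bound.
-/
theorem integral_rootW : ∫ τ, rootW p τ ∂(GW p) = 1 := by
  have h1 : Tendsto (fun n => ∫ τ, normGen p n τ ∂(GW p)) atTop (𝓝 (∫ τ, rootW p τ ∂(GW p))) := by
    refine tendsto_integral_of_dominated_convergence
      (fun τ => 1 + (∑' n, ‖normGenDiff p n τ‖ₑ).toReal)
      (fun n => (measurable_normGen p n).aestronglyMeasurable) ?_ ?_ (ae_tendsto_rootW p)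
    · exact (integrable_const _).add (integrable_toReal_of_lintegral_ne_top
        (AEMeasurable.tsum fun n => (measurable_normGenDiff p n).enorm.aemeasurable)
        (lintegral_tsum_normGenDiff_ne_top p))
    · intro n
      filter_upwards [ae_tsum_normGenDiff_ne_top p] with τ hτ
      rw [normGen_eq_sum]
      refine (norm_add_le _ _).trans (add_le_add (by simp) ?_)
      refine (norm_sum_le _ _).trans ?_
      have h2 := ENNReal.toReal_mono hτ
        (ENNReal.sum_le_tsum (f := fun n => ‖normGenDiff p n τ‖ₑ) (Finset.range n))
      rw [ENNReal.toReal_sum fun k _ => enorm_ne_top] at h2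
      simpa using h2
  simp_rw [integral_normGen] at h1
  exact tendsto_nhds_unique h1 tendsto_const_nhds

theorem integrable_rootW_sq : Integrable (fun τ => rootW p τ ^ 2) (GW p) :=
  (memLp_rootW p).integrable_sq

/-- `W` has mean one, so it cannot vanish almost surely. -/
theorem eta_pos : 0 < eta p := by
  rw [eta, integral_pos_iff_support_of_nonneg (fun _ => sq_nonneg _) (integrable_rootW_sq p),
    pos_iff_ne_zero]
  intro h
  have h1 : rootW p =ᵐ[GW p] 0 := by
    rw [Filter.EventuallyEq, ae_iff]
    convert h using 2
    ext τ
    simp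
  have h2 := integral_rootW p
  rw [integral_congr_ae h1] at h2
  simp at h2

end GWRay

/-! ### Trees with a marked ray: existence of `W` and integrability of `μ_o²`. -/

namespace GWRay

theorem parent_of_mem_offspring {T : RayTree} {u v : Vertex} (h : u ∈ offspring T v) :
    parent u = v := by
  rcases v with ⟨_ | j, _ | ⟨k, w⟩⟩ <;>
    simp only [offspring, Finset.mem_insert, Finset.mem_image, Finset.mem_range] at h
  · obtain ⟨i, -, rfl⟩ := h; rfl
  · obtain ⟨i, -, rfl⟩ := h; rfl
  · rcases h with rfl | ⟨i, -, rfl⟩ <;> rfl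
  · obtain ⟨i, -, rfl⟩ := h; rfl

/-- The ancestor is recovered from the descendant, so distinct offspring have disjoint sets of
descendants; `Z_succ` rests on this. -/
theorem parent_iterate_of_mem_descendants {T : RayTree} {v u : Vertex} {n : ℕ}
    (h : u ∈ descendants T v n) : parent^[n] u = v := by
  induction n generalizing u with
  | zero => simpa [descendants] using h
  | succ n ih =>
    rw [descendants, Finset.mem_biUnion] at h
    obtain ⟨w, hw, hu⟩ := h
    rw [Function.iterate_succ_apply, parent_of_mem_offspring hu, ih hw]

theorem descendants_succ' (T : RayTree) (v : Vertex) (n : ℕ) :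
    descendants T v (n + 1) = (offspring T v).biUnion fun u => descendants T u n := by
  induction n with
  | zero => ext u; simp [descendants]
  | succ n ih =>
    rw [descendants, ih, Finset.biUnion_biUnion]
    rfl

theorem Z_succ (T : RayTree) (v : Vertex) (n : ℕ) :
    Z T v (n + 1) = ∑ u ∈ offspring T v, Z T u n := by
  rw [Z, descendants_succ', Finset.card_biUnion]
  · rfl
  · intro a _ b _ hab
    rw [Function.onFun, Finset.disjoint_left]
    intro u hu hu'
    exact hab ((parent_iterate_of_mem_descendants hu).symm.trans
      (parent_iterate_of_mem_descendants hu'))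

/-- The vertices that are not among `v_1, v_2, …`. -/
def OffRay (v : Vertex) : Prop := v.path ≠ [] ∨ v.ray = 0

/-- The tree of the descendants of a vertex that is not among `v_1, v_2, …`. -/
def subtree (T : RayTree) (v : Vertex) : RootedTree := fun u => T ⟨v.ray, u ++ v.path⟩

theorem offspring_of_offRay (T : RayTree) {v : Vertex} (hv : OffRay v) :
    offspring T v = (Finset.range (T v)).image fun i => ⟨v.ray, i :: v.path⟩ := by
  rcases v with ⟨_ | j, _ | ⟨k, w⟩⟩
  · rfl
  · rfl
  · simp [OffRay] at hv
  · rfl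

theorem offspring_ray_succ (T : RayTree) (j : ℕ) :
    offspring T ⟨j + 1, []⟩ = insert ⟨j, []⟩
      ((Finset.range (T ⟨j + 1, []⟩ - 1)).image fun i => ⟨j + 1, [i]⟩) := rfl

theorem sum_offspring_of_offRay {β : Type*} [AddCommMonoid β] (T : RayTree) {v : Vertex}
    (hv : OffRay v) (φ : Vertex → β) :
    ∑ u ∈ offspring T v, φ u = ∑ i ∈ Finset.range (T v), φ ⟨v.ray, i :: v.path⟩ := by
  rw [offspring_of_offRay T hv, Finset.sum_image]
  intro a _ b _ h
  simpa using h

theorem sum_offspring_ray_succ {β : Type*} [AddCommMonoid β] (T : RayTree) (j : ℕ)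
    (φ : Vertex → β) :
    ∑ u ∈ offspring T ⟨j + 1, []⟩, φ u =
      φ ⟨j, []⟩ + ∑ i ∈ Finset.range (T ⟨j + 1, []⟩ - 1), φ ⟨j + 1, [i]⟩ := by
  rw [offspring_ray_succ, Finset.sum_insert (by simp), Finset.sum_image]
  intro a _ b _ h
  simpa using h

theorem deg_of_offRay (T : RayTree) {v : Vertex} (hv : OffRay v) : deg T v = T v := by
  rw [deg, Finset.card_eq_sum_ones, sum_offspring_of_offRay T hv]
  simp

theorem offRay_root : OffRay root := Or.inr rfl

theorem offRay_cons (j k : ℕ) (w : List ℕ) : OffRay ⟨j, k :: w⟩ := Or.inl (by simp)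

theorem Z_of_offRay (T : RayTree) {v : Vertex} (hv : OffRay v) (n : ℕ) :
    Z T v n = ((subtree T v).generation n).card := by
  induction n generalizing v with
  | zero => simp [Z, descendants, RootedTree.generation]
  | succ n ih =>
    rw [Z_succ, sum_offspring_of_offRay T hv, card_generation_succ]
    refine Finset.sum_congr (by simp [subtree]) fun i _ => ?_
    rw [ih (offRay_cons _ _ _)]
    congr 2
    funext w
    simp [subtree, RootedTree.child]

variable (p : OffspringLaw)

theorem W_of_offRay (T : RayTree) {v : Vertex} (hv : OffRay v) :
    W p T v = rootW p (subtree T v) := by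
  simp only [W, rootW, Z_of_offRay T hv]

theorem measurable_subtree (v : Vertex) : Measurable fun T : RayTree => subtree T v :=
  measurable_pi_lambda _ fun _ => measurable_pi_apply _

/-- Strictly off the ray every descendant has a nonempty path, hence offspring law `p`. The root is
excluded, since its own degree has the averaged law. -/
theorem map_subtree_IGWR (j k : ℕ) (w : List ℕ) :
    (IGWR p).map (fun T => subtree T ⟨j, k :: w⟩) = GW p := by
  have h := Measure.map_infinitePi_infinitePi_of_inj (P := offspringLawAt p)
    (f := fun u : List ℕ => (⟨j, u ++ k :: w⟩ : Vertex)) fun a b h => by simpa using h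
  refine h.trans ?_
  have e : ∀ u : List ℕ, offspringLawAt p ⟨j, u ++ k :: w⟩ = p.ordinary := by
    intro u
    rcases j with _ | j <;> rcases u with _ | ⟨a, u⟩ <;> rfl
  rw [GW]
  congr 1
  funext u
  exact e u

/-- The limits that define `W` exist at `v`. -/
def HasW (T : RayTree) (v : Vertex) : Prop :=
  Tendsto (fun n : ℕ => (Z T v n : ℝ) / p.mean ^ n) atTop (𝓝 (W p T v))

theorem tendsto_of_offspring {T : RayTree} {v : Vertex} (h : ∀ u ∈ offspring T v, HasW p T u) :
    Tendsto (fun n : ℕ => (Z T v n : ℝ) / p.mean ^ n) atTop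
      (𝓝 (p.mean⁻¹ * ∑ u ∈ offspring T v, W p T u)) := by
  rw [← tendsto_add_atTop_iff_nat 1]
  have h1 := (tendsto_finsetSum _ h).const_mul p.mean⁻¹
  refine h1.congr fun n => ?_
  have hm := p.mean_pos.ne'
  rw [Z_succ]
  push_cast
  rw [← Finset.sum_div, pow_succ]
  field_simp

theorem hasW_of_offspring {T : RayTree} {v : Vertex} (h : ∀ u ∈ offspring T v, HasW p T u) :
    HasW p T v :=
  tendsto_nhds_limUnder ⟨_, tendsto_of_offspring p h⟩

/-- Harmonicity of `W`: it converts the term `W_v²` of a step to the parent into the squared sum in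
`μ_v²`. -/
theorem W_eq_sum {T : RayTree} (h : ∀ v, HasW p T v) (v : Vertex) :
    W p T v = p.mean⁻¹ * ∑ u ∈ offspring T v, W p T u :=
  tendsto_nhds_unique (h v) (tendsto_of_offspring p fun u _ => h u)

/-- Off the ray the subtrees are `GW` trees. The limits then climb the ray by induction, because the
offspring of `v_{j+1}` are `v_j` and off-ray vertices. -/
theorem ae_hasW : ∀ᵐ T ∂(IGWR p), ∀ v, HasW p T v := by
  have h : ∀ᵐ T ∂(IGWR p), ∀ (j k : ℕ) (w : List ℕ), HasW p T ⟨j, k :: w⟩ := by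
    refine ae_all_iff.2 fun j => ae_all_iff.2 fun k => ae_all_iff.2 fun w => ?_
    have h1 := ae_tendsto_rootW p
    rw [← map_subtree_IGWR p j k w] at h1
    filter_upwards [ae_of_ae_map (measurable_subtree _).aemeasurable h1] with T hT
    rw [HasW, W_of_offRay p T (offRay_cons _ _ _)]
    simp only [Z_of_offRay T (offRay_cons j k w)]
    exact hT
  filter_upwards [h] with T hT
  have hray : ∀ j, HasW p T ⟨j, []⟩ := by
    intro j
    induction j with
    | zero =>
      refine hasW_of_offspring p fun u hu => ?_
      rw [offspring_of_offRay T (Or.inr rfl), Finset.mem_image] at hu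
      obtain ⟨i, -, rfl⟩ := hu
      exact hT _ _ _
    | succ j ih =>
      refine hasW_of_offspring p fun u hu => ?_
      rw [offspring_ray_succ, Finset.mem_insert, Finset.mem_image] at hu
      rcases hu with rfl | ⟨i, -, rfl⟩
      · exact ih
      · exact hT _ _ _
  rintro ⟨j, _ | ⟨k, w⟩⟩
  · exact hray j
  · exact hT _ _ _

theorem muSq_root_eq (T : RayTree) :
    muSq p T root = 1 / (p.mean + T root) *
        ∑ i ∈ Finset.range (T root), rootW p (subtree T ⟨0, [i]⟩) ^ 2 +
      1 / (p.mean * (p.mean + T root)) *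
        (∑ i ∈ Finset.range (T root), rootW p (subtree T ⟨0, [i]⟩)) ^ 2 := by
  rw [muSq, deg_of_offRay T offRay_root, sum_offspring_of_offRay T offRay_root,
    sum_offspring_of_offRay T offRay_root]
  simp only [W_of_offRay p T (offRay_cons _ _ _)]
  rfl

theorem measurable_muSq_root : Measurable fun T => muSq p T root := by
  simp_rw [muSq_root_eq]
  have h0 : Measurable fun T : RayTree => T root := measurable_pi_apply _
  have h1 : Measurable fun T : RayTree => (T root : ℝ) := measurable_from_top.comp h0
  have hW : ∀ i, Measurable fun T : RayTree => rootW p (subtree T ⟨0, [i]⟩) := fun i =>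
    (measurable_rootW p).comp (measurable_subtree _)
  exact ((h1.const_add _).const_div _ |>.mul (measurable_sum_range h0 fun i => (hW i).pow_const 2)).add
    ((((h1.const_add _).const_mul _).const_div _).mul ((measurable_sum_range h0 hW).pow_const 2))

theorem muSq_nonneg (T : RayTree) (v : Vertex) : 0 ≤ muSq p T v := by
  have := p.mean_pos
  rw [muSq]
  positivity

/-- Cauchy–Schwarz bounds the squared sum by `d` times the sum of squares, and `1 / (m + d) + d / (m
(m + d)) = 1 / m`. -/
theorem muSq_root_le (T : RayTree) :
    muSq p T root ≤ p.mean⁻¹ *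
      ∑ i ∈ Finset.range (T root), rootW p (subtree T ⟨0, [i]⟩) ^ 2 := by
  have hm := p.mean_pos
  rw [muSq_root_eq]
  have h := sq_sum_le_card_mul_sum_sq (s := Finset.range (T root))
    (f := fun i => rootW p (subtree T ⟨0, [i]⟩))
  rw [Finset.card_range] at h
  set A := ∑ i ∈ Finset.range (T root), rootW p (subtree T ⟨0, [i]⟩) ^ 2
  have hd : (0 : ℝ) < p.mean + T root := by positivity
  calc _ ≤ 1 / (p.mean + T root) * A + 1 / (p.mean * (p.mean + T root)) * (T root * A) := by gcongr
    _ = p.mean⁻¹ * A := by field_simp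

/-- The bound `muSq_root_le` sums over the children; their number is independent of their `GW`
subtrees, so its mean is `m⁻¹ E[d_o] η`. Since `d_o` has the averaged law, `E[d_o]` involves the
second moment of `p`. -/
theorem integrable_muSq_root : Integrable (fun T => muSq p T root) (IGWR p) := by
  have hm := p.mean_pos
  refine ⟨(measurable_muSq_root p).aestronglyMeasurable, ?_⟩
  rw [hasFiniteIntegral_iff_ofReal (Eventually.of_forall fun T => muSq_nonneg p T root)]
  set F : RootedTree → ℝ≥0∞ := fun τ => ENNReal.ofReal (rootW p τ ^ 2) with hF
  have hFm : Measurable F := ((measurable_rootW p).pow_const 2).ennreal_ofReal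
  have hFi : ∫⁻ τ, F τ ∂(GW p) ≠ ∞ := by
    have := (integrable_rootW_sq p).2
    rw [hasFiniteIntegral_iff_ofReal (Eventually.of_forall fun τ => sq_nonneg _)] at this
    exact this.ne
  have hsub : ∀ i, Measurable fun T : RayTree => F (subtree T ⟨0, [i]⟩) := fun i =>
    hFm.comp (measurable_subtree _)
  have hmeas : Measurable fun T : RayTree =>
      ∑ i ∈ Finset.range (T root), F (subtree T ⟨0, [i]⟩) :=
    measurable_sum_range (measurable_pi_apply _) hsub
  have hle : ∀ T, ENNReal.ofReal (muSq p T root) ≤ ENNReal.ofReal p.mean⁻¹ *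
      ∑ i ∈ Finset.range (T root), F (subtree T ⟨0, [i]⟩) := by
    intro T
    refine (ENNReal.ofReal_le_ofReal (muSq_root_le p T)).trans (le_of_eq ?_)
    rw [ENNReal.ofReal_mul (by positivity), ENNReal.ofReal_sum_of_nonneg fun i _ => sq_nonneg _]
  refine lt_of_le_of_lt (lintegral_mono hle) ?_
  rw [lintegral_const_mul _ hmeas]
  refine ENNReal.mul_lt_top ENNReal.ofReal_lt_top ?_
  rw [IGWR, lintegral_infinitePi_update_symm (P := offspringLawAt p) root (fun _ _ => rfl) hmeas]
  have hin : ∀ k : ℕ, ∫⁻ T, ∑ i ∈ Finset.range (Function.update T root k root),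
      F (subtree (Function.update T root k) ⟨0, [i]⟩) ∂(Measure.infinitePi (offspringLawAt p)) =
      k * ∫⁻ τ, F τ ∂(GW p) := by
    intro k
    have e : ∀ (T : RayTree) (i : ℕ), subtree (Function.update T root k) ⟨0, [i]⟩ =
        subtree T ⟨0, [i]⟩ := by
      intro T i
      funext w
      simp [subtree, root, Function.update]
    simp only [Function.update_self, e]
    rw [lintegral_finsetSum _ fun i _ => hsub i]
    have : ∀ i ∈ Finset.range k, ∫⁻ T, F (subtree T ⟨0, [i]⟩)
        ∂(Measure.infinitePi (offspringLawAt p)) = ∫⁻ τ, F τ ∂(GW p) := by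
      intro i _
      rw [← map_subtree_IGWR p 0 i [], lintegral_map hFm (measurable_subtree _)]
      rfl
    rw [Finset.sum_congr rfl this]
    simp
  simp_rw [hin]
  rw [lintegral_mul_const _ (by fun_prop)]
  exact (ENNReal.mul_ne_top p.lintegral_averaged_id_ne_top hFi).lt_top

end GWRay

/-! ### Rerooting: the environment seen from a vertex, and its Markov chain. -/

namespace GWRay

/-- The increasing enumeration of the numbers other than `i`. -/
def skip (i j : ℕ) : ℕ := if j < i then j else j + 1

/-- The left inverse of `skip i`. -/
def unskip (i j : ℕ) : ℕ := if j < i then j else j - 1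

theorem skip_ne (i j : ℕ) : skip i j ≠ i := by unfold skip; split_ifs <;> omega

theorem unskip_skip (i j : ℕ) : unskip i (skip i j) = j := by
  unfold skip unskip; split_ifs <;> omega

theorem skip_unskip {i j : ℕ} (h : j ≠ i) : skip i (unskip i j) = j := by
  unfold skip unskip; split_ifs <;> omega

/-- Two numberings of the offspring of a ray vertex: all of them from `0` to `k - 1`, or the ray
child, at position `i`, set apart and the others numbered consecutively. `skip i` passes from the
second to the first. -/
theorem sum_range_eq_add_sum_skip {β : Type*} [AddCommMonoid β] {i k : ℕ} (h : i < k) (φ : ℕ → β) :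
    ∑ j ∈ Finset.range k, φ j = φ i + ∑ j ∈ Finset.range (k - 1), φ (skip i j) := by
  have e : Finset.range k = insert i ((Finset.range (k - 1)).image (skip i)) := by
    ext j
    simp only [Finset.mem_range, Finset.mem_insert, Finset.mem_image]
    constructor
    · intro hj
      by_cases hji : j = i
      · exact Or.inl hji
      · refine Or.inr ⟨unskip i j, ?_, skip_unskip hji⟩
        unfold unskip; split_ifs <;> omega
    · rintro (rfl | ⟨a, ha, rfl⟩)
      · exact h
      · unfold skip; split_ifs <;> omega
  rw [e, Finset.sum_insert, Finset.sum_image]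
  · intro a _ b _ hab
    rw [← unskip_skip i a, hab, unskip_skip]
  · simp [skip_ne]

/-- The label, in a tree seen from its root, of the vertex with a given label in the tree seen from
the `i`-th child of the root. -/
def childLabel (i : ℕ) : Vertex → Vertex
  | ⟨0, w⟩ => ⟨0, w ++ [i]⟩
  | ⟨1, w⟩ => ⟨0, w.dropLast ++ (w.getLast?.map (skip i)).toList⟩
  | ⟨n + 2, w⟩ => ⟨n + 1, w⟩

/-- The inverse of `childLabel i`. -/
def parentLabel (i : ℕ) : Vertex → Vertex
  | ⟨0, w⟩ => if w = [] then ⟨1, []⟩ else if w.getLast? = some i then ⟨0, w.dropLast⟩ else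
      ⟨1, w.dropLast ++ (w.getLast?.map (unskip i)).toList⟩
  | ⟨n + 1, w⟩ => ⟨n + 2, w⟩

theorem childLabel_zero (i : ℕ) (w : List ℕ) : childLabel i ⟨0, w⟩ = ⟨0, w ++ [i]⟩ := rfl

theorem childLabel_one_nil (i : ℕ) : childLabel i ⟨1, []⟩ = ⟨0, []⟩ := rfl

/-- After moving to the child `i`, the old root is `v_1` and its other children are numbered without
`i`; the last letter of the word is the step that leaves it. -/
theorem childLabel_one_concat (i j : ℕ) (w : List ℕ) :
    childLabel i ⟨1, w ++ [j]⟩ = ⟨0, w ++ [skip i j]⟩ := by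
  simp [childLabel]

theorem childLabel_add_two (i n : ℕ) (w : List ℕ) :
    childLabel i ⟨n + 2, w⟩ = ⟨n + 1, w⟩ := rfl

theorem parentLabel_root (i : ℕ) : parentLabel i ⟨0, []⟩ = ⟨1, []⟩ := by simp [parentLabel]

theorem parentLabel_concat_self (i : ℕ) (w : List ℕ) :
    parentLabel i ⟨0, w ++ [i]⟩ = ⟨0, w⟩ := by simp [parentLabel]

theorem parentLabel_concat_of_ne {i j : ℕ} (h : j ≠ i) (w : List ℕ) :
    parentLabel i ⟨0, w ++ [j]⟩ = ⟨1, w ++ [unskip i j]⟩ := by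
  simp [parentLabel, h]

theorem parentLabel_succ (i n : ℕ) (w : List ℕ) :
    parentLabel i ⟨n + 1, w⟩ = ⟨n + 2, w⟩ := rfl

theorem parentLabel_childLabel (i : ℕ) (v : Vertex) : parentLabel i (childLabel i v) = v := by
  rcases v with ⟨_ | _ | n, w⟩
  · rw [childLabel_zero, parentLabel_concat_self]
  · rcases List.eq_nil_or_concat' w with rfl | ⟨u, j, rfl⟩
    · exact parentLabel_root i
    · rw [zero_add, childLabel_one_concat, parentLabel_concat_of_ne (skip_ne _ _), unskip_skip]
  · rfl

theorem childLabel_parentLabel (i : ℕ) (v : Vertex) : childLabel i (parentLabel i v) = v := by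
  rcases v with ⟨_ | n, w⟩
  · rcases List.eq_nil_or_concat' w with rfl | ⟨u, j, rfl⟩
    · rw [parentLabel_root, childLabel_one_nil]
    · by_cases h : j = i
      · subst h
        rw [parentLabel_concat_self, childLabel_zero]
      · rw [parentLabel_concat_of_ne h, childLabel_one_concat, skip_unskip h]
  · rfl

theorem childLabel_injective (i : ℕ) : Function.Injective (childLabel i) :=
  Function.LeftInverse.injective (parentLabel_childLabel i)

theorem parentLabel_injective (i : ℕ) : Function.Injective (parentLabel i) :=
  Function.LeftInverse.injective (childLabel_parentLabel i)

/-- The generation of a vertex, counted upwards from the root. -/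
def level (v : Vertex) : ℤ := v.ray - v.path.length

theorem level_parentLabel (i : ℕ) (v : Vertex) : level (parentLabel i v) = level v + 1 := by
  rcases v with ⟨_ | n, w⟩
  · rcases List.eq_nil_or_concat' w with rfl | ⟨u, j, rfl⟩
    · rw [parentLabel_root]; simp [level]
    · by_cases h : j = i
      · subst h
        rw [parentLabel_concat_self]; simp [level]
      · rw [parentLabel_concat_of_ne h]; simp [level]
  · rw [parentLabel_succ]; simp [level]; ring

/-- A tree with a marked ray, together with the position of every vertex of the ray among the
offspring of its parent. -/
abbrev Env := Vertex → ℕ × ℕ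

/-- The underlying tree with a marked ray. -/
def toTree (s : Env) : RayTree := fun v => (s v).1

/-- The tree seen from the parent `v_1` of the root. -/
noncomputable def up (s : Env) : Env := fun v =>
  if v = root then ((s ⟨1, []⟩).1, 0) else s (parentLabel (s ⟨1, []⟩).2 v)

/-- The tree seen from the `i`-th child of the root. -/
noncomputable def down (i : ℕ) (s : Env) : Env := fun v =>
  if v = ⟨1, []⟩ then ((s root).1, i) else s (childLabel i v)

/-- `up` resets the record at its new root to `0`, so `s` is recovered only if its root carried that
default. -/
theorem up_down (i : ℕ) {s : Env} (h : (s root).2 = 0) : up (down i s) = s := by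
  funext v
  by_cases hv : v = root
  · subst hv
    simp [up, down, Prod.ext_iff, h]
  · have h1 : parentLabel i v ≠ ⟨1, []⟩ := fun e =>
      hv (parentLabel_injective i (e.trans (parentLabel_root i).symm))
    simp [up, down, hv, h1, childLabel_parentLabel]

/-- The recorded position at `v_1` is precisely what is needed to return to the old root. -/
theorem down_up (s : Env) : down (s ⟨1, []⟩).2 (up s) = s := by
  funext v
  by_cases hv : v = ⟨1, []⟩
  · subst hv
    simp [up, down]
  · have h1 : childLabel (s ⟨1, []⟩).2 v ≠ root := fun e =>
      hv (childLabel_injective _ (e.trans (childLabel_one_nil _).symm))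
    simp [up, down, hv, h1, parentLabel_childLabel]

theorem up_apply_succ (s : Env) (n : ℕ) (w : List ℕ) : up s ⟨n + 1, w⟩ = s ⟨n + 2, w⟩ := by
  have : (⟨n + 1, w⟩ : Vertex) ≠ root := by simp [root]
  simp [up, this, parentLabel_succ]

theorem up_iterate_apply_succ (s : Env) (j n : ℕ) (w : List ℕ) :
    up^[j] s ⟨n + 1, w⟩ = s ⟨j + n + 1, w⟩ := by
  induction j generalizing n with
  | zero => simp
  | succ j ih =>
    rw [Function.iterate_succ_apply', up_apply_succ, ih (n + 1)]
    congr 2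
    ring

theorem up_apply_root (s : Env) : up s root = ((s ⟨1, []⟩).1, 0) := by simp [up]

theorem up_apply_concat_skip (s : Env) (i : ℕ) (w : List ℕ) :
    up s ⟨0, w ++ [skip (s ⟨1, []⟩).2 i]⟩ = s ⟨1, w ++ [i]⟩ := by
  have : (⟨0, w ++ [skip (s ⟨1, []⟩).2 i]⟩ : Vertex) ≠ root := by simp [root]
  simp [up, this, parentLabel_concat_of_ne (skip_ne _ _), unskip_skip]

theorem down_apply_zero (i : ℕ) (s : Env) (w : List ℕ) : down i s ⟨0, w⟩ = s ⟨0, w ++ [i]⟩ := by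
  simp [down, childLabel_zero]

/-- The tree seen from the vertex of the path `w` below the vertex `v_j`. -/
noncomputable def envPath (s : Env) (j : ℕ) : List ℕ → Env
  | [] => up^[j] s
  | i :: w => down (if w = [] ∧ j ≠ 0 then skip (s ⟨j, []⟩).2 i else i) (envPath s j w)

/-- The tree seen from a vertex. -/
noncomputable def env (s : Env) (v : Vertex) : Env := envPath s v.ray v.path

theorem env_root (s : Env) : env s root = s := rfl

theorem env_ray_succ (s : Env) (j : ℕ) : env s ⟨j + 1, []⟩ = up (env s ⟨j, []⟩) :=
  Function.iterate_succ_apply' _ _ _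

theorem env_cons_of_offRay (s : Env) {v : Vertex} (hv : OffRay v) (i : ℕ) :
    env s ⟨v.ray, i :: v.path⟩ = down i (env s v) := by
  have : ¬ (v.path = [] ∧ v.ray ≠ 0) := by
    rintro ⟨h1, h2⟩
    rcases hv with h | h
    · exact h h1
    · exact h2 h
  simp [env, envPath, this]

/-- Labels of off-ray children of `v_{j+1}` leave out `v_j`, whereas `down` counts all offspring;
hence `skip`. -/
theorem env_ray_succ_single (s : Env) (j i : ℕ) :
    env s ⟨j + 1, [i]⟩ = down (skip (s ⟨j + 1, []⟩).2 i) (env s ⟨j + 1, []⟩) := by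
  simp [env, envPath]

theorem env_ray_apply_one (s : Env) (j : ℕ) : env s ⟨j, []⟩ ⟨1, []⟩ = s ⟨j + 1, []⟩ :=
  up_iterate_apply_succ s j 0 []

theorem env_apply_of_offRay (s : Env) {v : Vertex} (hv : OffRay v) (w : List ℕ) :
    env s v ⟨0, w⟩ = s ⟨v.ray, w ++ v.path⟩ := by
  rcases v with ⟨j, u⟩
  induction u generalizing w with
  | nil =>
    have hj : j = 0 := by simpa [OffRay] using hv
    subst hj
    simp [env, envPath]
  | cons i u ih =>
    by_cases hu : OffRay ⟨j, u⟩
    · have h := env_cons_of_offRay s hu i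
      simp only at h
      rw [h, down_apply_zero, ih _ hu]
      simp
    · simp only [OffRay, not_or, not_not] at hu
      obtain ⟨rfl, hj⟩ := hu
      obtain ⟨j, rfl⟩ := Nat.exists_eq_succ_of_ne_zero hj
      rw [env_ray_succ_single, down_apply_zero, env_ray_succ, ← env_ray_apply_one s j,
        up_apply_concat_skip]
      have := up_iterate_apply_succ s j 0 (w ++ [i])
      exact this

/-- The positions are those of actual offspring, and only recorded along the ray. -/
structure Good (s : Env) : Prop where
  pos_lt : ∀ j, (s ⟨j + 1, []⟩).2 < (s ⟨j + 1, []⟩).1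
  snd_eq_zero : ∀ v, OffRay v → (s v).2 = 0

theorem env_apply_root {s : Env} (hs : Good s) (v : Vertex) : env s v root = ((s v).1, 0) := by
  by_cases hv : OffRay v
  · have h := env_apply_of_offRay s hv []
    rw [root, h, ← hs.snd_eq_zero v hv]
    rfl
  · rcases v with ⟨j, w⟩
    simp only [OffRay, not_or, not_not] at hv
    obtain ⟨rfl, hj⟩ := hv
    obtain ⟨j, rfl⟩ := Nat.exists_eq_succ_of_ne_zero hj
    rw [env_ray_succ, up_apply_root, env_ray_apply_one]

theorem env_parent {s : Env} (hs : Good s) (v : Vertex) : env s (parent v) = up (env s v) := by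
  rcases v with ⟨j, _ | ⟨i, w⟩⟩
  · exact env_ray_succ s j
  · have h : ∃ a, env s ⟨j, i :: w⟩ = down a (env s ⟨j, w⟩) := ⟨_, rfl⟩
    obtain ⟨a, ha⟩ := h
    rw [ha, up_down]
    · rfl
    · rw [env_apply_root hs]

/-- At a ray vertex the child `v_j` corresponds to the index stored in the record, by `down_up`.
Together with `env_parent`, this makes the neighbours of `v` depend only on the environment seen
from `v`. -/
theorem sum_offspring_env {s : Env} (hs : Good s) {β : Type*} [AddCommMonoid β] (v : Vertex)
    (φ : Env → β) : ∑ u ∈ offspring (toTree s) v, φ (env s u) =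
      ∑ i ∈ Finset.range (toTree s v), φ (down i (env s v)) := by
  by_cases hv : OffRay v
  · rw [sum_offspring_of_offRay _ hv]
    simp only [env_cons_of_offRay s hv]
  · rcases v with ⟨j, w⟩
    simp only [OffRay, not_or, not_not] at hv
    obtain ⟨rfl, hj⟩ := hv
    obtain ⟨j, rfl⟩ := Nat.exists_eq_succ_of_ne_zero hj
    rw [sum_offspring_ray_succ, sum_range_eq_add_sum_skip
      (show (s ⟨j + 1, []⟩).2 < toTree s ⟨j + 1, []⟩ from hs.pos_lt j)]
    congr 1
    rw [env_ray_succ, ← env_ray_apply_one s j, down_up]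

theorem deg_toTree {s : Env} (hs : Good s) (v : Vertex) : deg (toTree s) v = toTree s v := by
  rw [deg, Finset.card_eq_sum_ones, sum_offspring_env hs v (fun _ => 1)]
  simp

theorem subtree_toTree_down (s : Env) (i : ℕ) :
    subtree (toTree (down i s)) root = (subtree (toTree s) root).child i := by
  funext w
  simp [subtree, root, toTree, RootedTree.child, down_apply_zero]

theorem card_generation_toTree_succ (s : Env) (n : ℕ) :
    ((subtree (toTree s) root).generation (n + 1)).card =
      ∑ i ∈ Finset.range (s root).1, ((subtree (toTree (down i s)) root).generation n).card := by
  rw [card_generation_succ]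
  simp only [subtree_toTree_down]
  rfl

/-- Seen from itself every vertex is a root, hence off the ray; ray vertices are thus covered as
well. -/
theorem Z_toTree {s : Env} (hs : Good s) (v : Vertex) (n : ℕ) :
    Z (toTree s) v n = ((subtree (toTree (env s v)) root).generation n).card := by
  induction n generalizing v with
  | zero => simp [Z, descendants, RootedTree.generation]
  | succ n ih =>
    rw [Z_succ, card_generation_toTree_succ, env_apply_root hs]
    simp only [ih]
    exact sum_offspring_env hs v fun e => ((subtree (toTree e) root).generation n).card

variable (p : OffspringLaw)

theorem W_toTree {s : Env} (hs : Good s) (v : Vertex) :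
    W p (toTree s) v = rootW p (subtree (toTree (env s v)) root) := by
  simp only [W, rootW, Z_toTree hs]

theorem muSq_toTree {s : Env} (hs : Good s) (v : Vertex) :
    muSq p (toTree s) v = muSq p (toTree (env s v)) root := by
  have h1 := sum_offspring_env hs v fun e => rootW p (subtree (toTree e) root) ^ 2
  have h2 := sum_offspring_env hs v fun e => rootW p (subtree (toTree e) root)
  have h3 : ∀ i, subtree (toTree (env s v)) ⟨0, [i]⟩ =
      subtree (toTree (down i (env s v))) root := by
    intro i
    rw [subtree_toTree_down]
    funext w
    simp [subtree, RootedTree.child, root]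
  have h4 : toTree (env s v) root = toTree s v := by
    rw [toTree, env_apply_root hs]; rfl
  rw [muSq_root_eq, muSq, deg_toTree hs]
  simp only [W_toTree p hs, h1, h2, h3, h4]

theorem measurable_up : Measurable up := by
  refine measurable_pi_lambda _ fun v => ?_
  by_cases hv : v = root
  · simp only [up, hv, if_true]
    exact ((measurable_pi_apply (⟨1, []⟩ : Vertex)).fst).prodMk measurable_const
  · simp only [up, hv, if_false]
    have h : Measurable fun q : ℕ × Env => q.2 (parentLabel q.1 v) :=
      measurable_from_prod_countable_right fun i => measurable_pi_apply (parentLabel i v)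
    have h' : Measurable fun s : Env => ((s ⟨1, []⟩).2, s) :=
      ((measurable_pi_apply (⟨1, []⟩ : Vertex)).snd).prodMk measurable_id
    exact h.comp h'

theorem measurable_down (i : ℕ) : Measurable (down i) := by
  refine measurable_pi_lambda _ fun v => ?_
  by_cases hv : v = ⟨1, []⟩
  · simp only [down, hv, if_true]
    exact ((measurable_pi_apply root).fst).prodMk measurable_const
  · simp only [down, hv, if_false]
    exact measurable_pi_apply _

theorem measurable_toTree : Measurable toTree :=
  measurable_pi_lambda _ fun v => (measurable_pi_apply v).fst

theorem measurable_root_fst : Measurable fun s : Env => (s root).1 := (measurable_pi_apply root).fst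

/-- One step of the tree seen from the walk. -/
noncomputable def envStep (s : Env) : Measure Env :=
  ENNReal.ofReal (p.mean / (p.mean + (s root).1)) • Measure.dirac (up s) +
    ∑ i ∈ Finset.range (s root).1,
      ENNReal.ofReal (1 / (p.mean + (s root).1)) • Measure.dirac (down i s)

theorem measurable_envStep : Measurable (envStep p) := by
  refine Measure.measurable_of_measurable_coe _ fun B hB => ?_
  have h0 := measurable_root_fst
  have h1 : Measurable fun s : Env => ((s root).1 : ℝ) := measurable_from_top.comp h0
  have hd : ∀ φ : Env → Env, Measurable φ → Measurable fun s => Measure.dirac (φ s) B :=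
    fun φ hφ => (Measure.measurable_coe hB).comp (Measure.measurable_dirac.comp hφ)
  simp only [envStep, Measure.add_apply, Measure.smul_apply, Measure.coe_finsetSum,
    Finset.sum_apply, smul_eq_mul]
  refine (((h1.const_add _).const_div _).ennreal_ofReal.mul (hd _ measurable_up)).add ?_
  exact measurable_sum_range h0 fun i =>
    ((h1.const_add _).const_div _).ennreal_ofReal.mul (hd _ (measurable_down i))

instance (s : Env) : IsProbabilityMeasure (envStep p s) := by
  have hm := p.mean_pos
  constructor
  simp only [envStep, Measure.add_apply, Measure.smul_apply, Measure.coe_finsetSum,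
    Finset.sum_apply, measure_univ, smul_eq_mul, mul_one, Finset.sum_const, nsmul_eq_mul]
  rw [Finset.card_range, ← ENNReal.ofReal_natCast, ← ENNReal.ofReal_mul (by positivity),
    ← ENNReal.ofReal_add (by positivity) (by positivity), ← ENNReal.ofReal_one]
  congr 1
  field_simp

/-- The transition kernel of the tree seen from the walk. -/
noncomputable def envKernel : Kernel Env Env := ⟨envStep p, measurable_envStep p⟩

instance : IsMarkovKernel (envKernel p) :=
  ⟨fun s => inferInstanceAs (IsProbabilityMeasure (envStep p s))⟩

/-- `env s` intertwines the two kernels. It need not be injective: the image of the step law depends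
only on `env s v`. -/
theorem map_stepKernel {s : Env} (hs : Good s) (v : Vertex) :
    (stepKernel p (toTree s) v).map (env s) = envKernel p (env s v) := by
  have hm : Measurable (env s) := measurable_of_countable _
  ext B hB
  change (stepMeasure p (toTree s) v).map (env s) B = envStep p (env s v) B
  rw [Measure.map_apply hm hB]
  simp only [stepMeasure, envStep, Measure.add_apply, Measure.smul_apply, Measure.coe_finsetSum,
    Finset.sum_apply, smul_eq_mul]
  have e : ∀ u, Measure.dirac u (env s ⁻¹' B) = Measure.dirac (env s u) B := fun u => by
    rw [← Measure.map_dirac' hm, Measure.map_apply hm hB]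
  simp only [e]
  rw [sum_offspring_env hs v fun x =>
    ENNReal.ofReal (1 / (p.mean + deg (toTree s) v)) * Measure.dirac x B,
    deg_toTree hs, env_apply_root hs, env_parent hs]
  rfl

theorem quenched_eq_chainLaw (T : RayTree) : quenched p T = chainLaw (stepKernel p T) root := rfl

/-- The image of the walk is Markov for `envKernel` and starts from `s`; these two facts determine
its law. -/
theorem map_quenched {s : Env} (hs : Good s) :
    (quenched p (toTree s)).map (fun X n => env s (X n)) = chainLaw (envKernel p) s := by
  have hm : Measurable (env s) := measurable_of_countable _
  have hm' : Measurable fun (X : Trajectory) n => env s (X n) :=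
    measurable_pi_lambda _ fun n => hm.comp (measurable_pi_apply n)
  have : IsProbabilityMeasure ((quenched p (toTree s)).map (fun X n => env s (X n))) :=
    Measure.isProbabilityMeasure_map hm'.aemeasurable
  refine IsMarkovLaw.unique (K := envKernel p) ?_ (isMarkovLaw_chainLaw _ _) ?_
  · rw [quenched_eq_chainLaw]
    exact (isMarkovLaw_chainLaw _ _).map hm (map_stepKernel p hs)
  · rw [map_zero_chainLaw, Measure.map_map (by fun_prop) hm', quenched_eq_chainLaw]
    have e : ((fun Y : ℕ → Env => Y 0) ∘ fun (X : Trajectory) n => env s (X n)) =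
        env s ∘ fun X => X 0 := rfl
    rw [e, ← Measure.map_map hm (by fun_prop), map_zero_chainLaw, Measure.map_dirac' hm, env_root]

end GWRay

/-! ### The law of the environment: flux identity, reversibility, densities of `up^[n]`. -/

namespace GWRay

variable (p : OffspringLaw)

/-- The law of the number of offspring of a vertex of the ray and of the position of its child
on the ray. -/
noncomputable def rayLaw : Measure (ℕ × ℕ) :=
  Measure.sum fun k => ∑ i ∈ Finset.range k,
    ENNReal.ofReal (p.prob k / p.mean) • Measure.dirac (k, i)

theorem lintegral_rayLaw (g : ℕ × ℕ → ℝ≥0∞) :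
    ∫⁻ x, g x ∂(rayLaw p) =
      ∑' k, ∑ i ∈ Finset.range k, ENNReal.ofReal (p.prob k / p.mean) * g (k, i) := by
  simp [rayLaw, lintegral_sum_measure, lintegral_finsetSum_measure, lintegral_smul_measure]

/-- Each of the `k` positions has weight `p_k / m`, so given the degree the position is uniform and
the degree is size-biased. -/
theorem map_fst_rayLaw : (rayLaw p).map Prod.fst = p.sizeBiased := by
  refine Measure.ext_of_lintegral _ fun g hg => ?_
  rw [lintegral_map hg measurable_fst, lintegral_rayLaw, OffspringLaw.sizeBiased, lintegral_lawOf]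
  refine tsum_congr fun k => ?_
  change ∑ _i ∈ Finset.range k, ENNReal.ofReal (p.prob k / p.mean) * g k = _
  rw [Finset.sum_const, Finset.card_range, nsmul_eq_mul, mul_div_assoc,
    ENNReal.ofReal_mul k.cast_nonneg, ENNReal.ofReal_natCast, mul_assoc]

instance : IsProbabilityMeasure (rayLaw p) := by
  constructor
  have h : (rayLaw p).map Prod.fst Set.univ = 1 := by rw [map_fst_rayLaw, measure_univ]
  rwa [Measure.map_apply measurable_fst .univ, Set.preimage_univ] at h

/-- The law of the number of offspring and of the recorded position, at every vertex; `q` is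
the law of the number of offspring of the root. -/
noncomputable def envLawAt (q : Measure ℕ) : Vertex → Measure (ℕ × ℕ)
  | ⟨0, []⟩ => q.map fun k => (k, 0)
  | ⟨_ + 1, []⟩ => rayLaw p
  | ⟨_, _ :: _⟩ => p.ordinary.map fun k => (k, 0)

instance (q : Measure ℕ) [IsProbabilityMeasure q] :
    IsProbabilityMeasure (q.map fun k => (k, 0)) :=
  Measure.isProbabilityMeasure_map (measurable_of_countable _).aemeasurable

instance (q : Measure ℕ) [IsProbabilityMeasure q] (v : Vertex) :
    IsProbabilityMeasure (envLawAt p q v) := by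
  rcases v with ⟨_ | j, _ | ⟨k, w⟩⟩ <;> rw [envLawAt] <;> infer_instance

/-- The law of the environment when the root has `q` as the law of its number of offspring. -/
noncomputable def envLaw (q : Measure ℕ) [IsProbabilityMeasure q] : Measure Env :=
  Measure.infinitePi (envLawAt p q)

instance (q : Measure ℕ) [IsProbabilityMeasure q] : IsProbabilityMeasure (envLaw p q) := by
  rw [envLaw]; infer_instance

theorem envLawAt_cons (q : Measure ℕ) (j k : ℕ) (w : List ℕ) :
    envLawAt p q ⟨j, k :: w⟩ = p.ordinary.map fun k => (k, 0) := by
  cases j <;> rfl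

theorem envLawAt_of_ne_root (q q' : Measure ℕ) {v : Vertex} (hv : v ≠ root) :
    envLawAt p q v = envLawAt p q' v := by
  rcases v with ⟨_ | j, _ | ⟨k, w⟩⟩
  · exact absurd rfl hv
  all_goals rfl

theorem envLawAt_concat (q : Measure ℕ) (j i : ℕ) (w : List ℕ) :
    envLawAt p q ⟨j, w ++ [i]⟩ = p.ordinary.map fun k => (k, 0) := by
  rcases w with _ | ⟨k, w⟩ <;> exact envLawAt_cons p q _ _ _

theorem map_toTree_envLaw : (envLaw p p.averaged).map toTree = IGWR p := by
  have h := Measure.infinitePi_map_pi (μ := envLawAt p p.averaged) (f := fun _ => Prod.fst)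
    fun _ => measurable_fst
  refine h.trans ?_
  rw [IGWR]
  congr 1
  funext v
  have h1 : ∀ q : Measure ℕ, (q.map fun k => (k, 0)).map Prod.fst = q := fun q => by
    rw [Measure.map_map measurable_fst (measurable_of_countable _)]
    exact Measure.map_id
  rcases v with ⟨_ | j, _ | ⟨k, w⟩⟩
  · exact h1 _
  · exact h1 _
  · exact map_fst_rayLaw p
  · exact h1 _

theorem ae_rayLaw : ∀ᵐ x ∂(rayLaw p), x.2 < x.1 := by
  have h : ∫⁻ x, (if x.2 < x.1 then 0 else 1) ∂(rayLaw p) = 0 := by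
    rw [lintegral_rayLaw, ENNReal.tsum_eq_zero]
    exact fun k => Finset.sum_eq_zero fun i hi => by simp [Finset.mem_range.1 hi]
  rw [lintegral_eq_zero_iff (measurable_of_countable _)] at h
  filter_upwards [h] with x hx
  by_contra hx'
  simp [hx'] at hx

theorem ae_envLaw_apply (q : Measure ℕ) [IsProbabilityMeasure q] {v : Vertex}
    {Q : ℕ × ℕ → Prop} (hQ : ∀ᵐ x ∂(envLawAt p q v), Q x) : ∀ᵐ s ∂(envLaw p q), Q (s v) := by
  rw [← Measure.infinitePi_map_eval (envLawAt p q) v] at hQ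
  exact ae_of_ae_map (measurable_pi_apply v).aemeasurable hQ

theorem ae_envLawAt_of_offRay (q : Measure ℕ) {v : Vertex} (hv : OffRay v) :
    ∀ᵐ x ∂(envLawAt p q v), x.2 = 0 := by
  have h : ∀ q' : Measure ℕ, ∀ᵐ x ∂(q'.map fun k => (k, 0)), (x : ℕ × ℕ).2 = 0 :=
    fun q' => (ae_map_iff (measurable_of_countable _).aemeasurable
      (MeasurableSet.of_discrete)).2 (Eventually.of_forall fun _ => rfl)
  rcases v with ⟨_ | j, _ | ⟨k, w⟩⟩
  · exact h q
  · exact h p.ordinary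
  · simp [OffRay] at hv
  · exact h p.ordinary

theorem ae_good (q : Measure ℕ) [IsProbabilityMeasure q] : ∀ᵐ s ∂(envLaw p q), Good s := by
  have h1 : ∀ᵐ s ∂(envLaw p q), ∀ j : ℕ, (s ⟨j + 1, []⟩).2 < (s ⟨j + 1, []⟩).1 :=
    ae_all_iff.2 fun j =>
      ae_envLaw_apply p q (v := ⟨j + 1, []⟩) (Q := fun x => x.2 < x.1) (ae_rayLaw p)
  have h2 : ∀ᵐ s ∂(envLaw p q), ∀ v, OffRay v → (s v).2 = 0 := by
    refine ae_all_iff.2 fun v => ?_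
    by_cases hv : OffRay v
    · filter_upwards [ae_envLaw_apply p q (Q := fun x => x.2 = 0) (ae_envLawAt_of_offRay p q hv)]
        with s hs _ using hs
    · exact Eventually.of_forall fun s h => absurd h hv
  filter_upwards [h1, h2] with s hs1 hs2 using ⟨hs1, hs2⟩

theorem lintegral_map_pair (q : Measure ℕ) {g : ℕ × ℕ → ℝ≥0∞} :
    ∫⁻ x, g x ∂(q.map fun k => (k, 0)) = ∫⁻ k, g (k, 0) ∂q :=
  lintegral_map (measurable_of_countable _) (measurable_of_countable _)

/-- The law of the environment under `IGWR` has a density with respect to `envLaw p.ordinary`. -/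
theorem lintegral_envLaw_averaged {F : Env → ℝ≥0∞} (hF : Measurable F) :
    ∫⁻ s, F s ∂(envLaw p p.averaged) =
      ∫⁻ s, ENNReal.ofReal ((p.mean + (s root).1) / (2 * p.mean)) * F s
        ∂(envLaw p p.ordinary) := by
  have hm := p.mean_pos
  have hd : Measurable fun s : Env =>
      ENNReal.ofReal ((p.mean + (s root).1) / (2 * p.mean)) :=
    (measurable_of_countable fun k : ℕ => ENNReal.ofReal ((p.mean + k) / (2 * p.mean))).comp
      measurable_root_fst
  have hdF : Measurable fun s : Env =>
      ENNReal.ofReal ((p.mean + (s root).1) / (2 * p.mean)) * F s := hd.mul hF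
  rw [envLaw, envLaw, lintegral_infinitePi_update (P := envLawAt p p.ordinary) root
    (fun v hv => envLawAt_of_ne_root p _ _ hv) hF,
    lintegral_infinitePi_update (P := envLawAt p p.ordinary) root (fun _ _ => rfl) hdF]
  refine lintegral_congr fun s => ?_
  change ∫⁻ x, F (Function.update s root x) ∂(p.averaged.map fun k => (k, 0)) =
    ∫⁻ x, _ ∂(p.ordinary.map fun k => (k, 0))
  rw [lintegral_map_pair, lintegral_map_pair, OffspringLaw.averaged, OffspringLaw.ordinary,
    lintegral_lawOf, lintegral_lawOf]
  refine tsum_congr fun k => ?_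
  rw [Function.update_self, ← mul_assoc, ← ENNReal.ofReal_mul (p.nonneg k)]
  congr 2
  ring

/-- `up` is studied under `envLaw p p.ordinary`; this carries almost sure statements over to the
stationary law. -/
theorem envLaw_averaged_absolutelyContinuous :
    envLaw p p.averaged ≪ envLaw p p.ordinary := by
  refine Measure.AbsolutelyContinuous.mk fun B hB h => ?_
  rw [← lintegral_indicator_one hB, lintegral_envLaw_averaged p (measurable_one.indicator hB)]
  have h1 : ∀ᵐ s ∂(envLaw p p.ordinary), s ∉ B := compl_mem_ae_iff.2 h
  rw [lintegral_congr_ae (g := fun _ => 0)]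
  · simp
  · filter_upwards [h1] with s hs
    simp [hs]

/-- With `p` itself as the root law, relabelling matches the laws everywhere except at `v_1`, which
reads the old root. With the averaged root law the match would also fail at the new root. -/
theorem envLawAt_childLabel {v : Vertex} (i : ℕ) (hv : v ≠ ⟨1, []⟩) :
    envLawAt p p.ordinary v = envLawAt p p.ordinary (childLabel i v) := by
  rcases v with ⟨_ | _ | n, w⟩
  · rw [childLabel_zero, envLawAt_concat]
    cases w <;> rfl
  · rcases List.eq_nil_or_concat' w with rfl | ⟨u, j, rfl⟩
    · exact absurd rfl hv
    · rw [zero_add, childLabel_one_concat, envLawAt_concat, envLawAt_concat]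
  · rw [childLabel_add_two]
    cases w <;> rfl

/-- Only `v_1` needs a computation: the old root has degree `k` with weight `p_k`, while `rayLaw`
gives `(k, i)` weight `p_k / m`. The quotient is the factor `m`. -/
theorem lintegral_down {f : Env → ℝ≥0∞} (hf : Measurable f) (i : ℕ) :
    ∫⁻ s, (if i < (s root).1 then f (down i s) else 0) ∂(envLaw p p.ordinary) =
      ENNReal.ofReal p.mean *
        ∫⁻ s, (if (s ⟨1, []⟩).2 = i then f s else 0) ∂(envLaw p p.ordinary) := by
  have hm := p.mean_pos
  have hx : ∀ v : Vertex, Measurable fun s : Env => s v := fun v => measurable_pi_apply v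
  let G : Env → ℝ≥0∞ := fun s =>
    if i < (s ⟨1, []⟩).1 then f (Function.update s ⟨1, []⟩ ((s ⟨1, []⟩).1, i)) else 0
  have hupd : Measurable fun s : Env => Function.update s ⟨1, []⟩ ((s ⟨1, []⟩).1, i) := by
    have h : Measurable fun q : Env × (ℕ × ℕ) => Function.update q.1 ⟨1, []⟩ q.2 :=
      measurable_update'
    exact h.comp (measurable_id.prodMk ((hx _).fst.prodMk measurable_const))
  have hG : Measurable G :=
    Measurable.ite (measurableSet_lt measurable_const (hx _).fst) (hf.comp hupd) measurable_const
  have hR : Measurable fun s : Env => if (s ⟨1, []⟩).2 = i then f s else 0 :=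
    Measurable.ite (measurableSet_eq_fun (hx _).snd measurable_const) hf measurable_const
  have hc : Measurable fun (s : Env) v => s (childLabel i v) :=
    measurable_pi_lambda _ fun v => hx _
  -- `down i s` is the relabelled environment with `i` written into the record at `v_1`; the degree
  -- at `v_1` after relabelling is that of the old root.
  have e : ∀ s : Env, (if i < (s root).1 then f (down i s) else 0) =
      G fun v => s (childLabel i v) := by
    intro s
    have h1 : down i s = Function.update (fun v => s (childLabel i v)) ⟨1, []⟩
        ((s root).1, i) := by
      funext v
      simp [down, Function.update]
    simp only [G, childLabel_one_nil, h1]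
    rfl
  simp_rw [e]
  rw [← lintegral_map hG hc, envLaw, Measure.map_infinitePi_infinitePi_of_inj
    (childLabel_injective i), lintegral_infinitePi_update (P := envLawAt p p.ordinary) ⟨1, []⟩
    (fun v hv => envLawAt_childLabel p i hv) hG, lintegral_infinitePi_update
    (P := envLawAt p p.ordinary) ⟨1, []⟩ (fun _ _ => rfl) hR, ← lintegral_const_mul']
  swap
  · exact ENNReal.ofReal_ne_top
  refine lintegral_congr fun s => ?_
  change ∫⁻ x, _ ∂(p.ordinary.map fun k => (k, 0)) = _ * ∫⁻ x, _ ∂(rayLaw p)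
  rw [lintegral_map_pair, OffspringLaw.ordinary, lintegral_lawOf, lintegral_rayLaw,
    ← ENNReal.tsum_mul_left]
  refine tsum_congr fun k => ?_
  simp only [G, Function.update_self, Function.update_idem]
  by_cases hik : i < k
  · rw [Finset.sum_eq_single_of_mem i (Finset.mem_range.2 hik) fun j _ hj => by simp [hj]]
    simp only [hik, if_true]
    rw [← mul_assoc, ← ENNReal.ofReal_mul hm.le]
    congr 2
    field_simp
  · rw [Finset.sum_eq_zero fun j hj => ?_]
    · simp [hik]
    · have : j ≠ i := by have := Finset.mem_range.1 hj; omega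
      simp [this]

/-- The flux identity, which makes the environment chain reversible. -/
theorem lintegral_sum_down {F : Env × Env → ℝ≥0∞} (hF : Measurable F) :
    ∫⁻ s, ∑ i ∈ Finset.range (s root).1, F (s, down i s) ∂(envLaw p p.ordinary) =
      ENNReal.ofReal p.mean * ∫⁻ s, F (up s, s) ∂(envLaw p p.ordinary) := by
  have hx : ∀ v : Vertex, Measurable fun s : Env => s v := fun v => measurable_pi_apply v
  have hup : Measurable fun s => F (up s, s) := hF.comp (measurable_up.prodMk measurable_id)
  have e : ∀ s : Env, ∑ i ∈ Finset.range (s root).1, F (s, down i s) =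
      ∑' i, if i < (s root).1 then F (s, down i s) else 0 := by
    intro s
    rw [tsum_eq_sum (s := Finset.range (s root).1) fun i hi => if_neg (by simpa using hi)]
    exact Finset.sum_congr rfl fun i hi => by simp [Finset.mem_range.1 hi]
  have hd : ∀ i, Measurable fun s : Env => if i < (s root).1 then F (s, down i s) else 0 :=
    fun i => Measurable.ite (measurableSet_lt measurable_const (hx _).fst)
      (hF.comp (measurable_id.prodMk (measurable_down i))) measurable_const
  have hu : ∀ i, Measurable fun s : Env => if (s ⟨1, []⟩).2 = i then F (up s, s) else 0 :=
    fun i => Measurable.ite (measurableSet_eq_fun (hx _).snd measurable_const) hup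
      measurable_const
  simp_rw [e]
  rw [lintegral_tsum fun i => (hd i).aemeasurable]
  have h1 : ∀ i, ∫⁻ s, (if i < (s root).1 then F (s, down i s) else 0) ∂(envLaw p p.ordinary) =
      ENNReal.ofReal p.mean * ∫⁻ s, (if (s ⟨1, []⟩).2 = i then F (up s, s) else 0)
        ∂(envLaw p p.ordinary) := by
    intro i
    rw [← lintegral_down p hup i]
    refine lintegral_congr_ae ?_
    filter_upwards [ae_good p p.ordinary] with s hs
    rw [up_down i (hs.snd_eq_zero root offRay_root)]
  simp_rw [h1]
  rw [ENNReal.tsum_mul_left, ← lintegral_tsum fun i => (hu i).aemeasurable]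
  congr 1
  refine lintegral_congr fun s => ?_
  -- Exactly one index `i` is the recorded position at `v_1`.
  exact tsum_ite_eq' _ _

/-- The density `(m + d) / (2m)` cancels the denominators `m + d` of the step: the parent gets
weight `1 / 2` and each child `1 / (2m)`. The flux identity turns the sum over children into half
the law of `(up s, s)`, so the law of two successive environments is symmetric. -/
theorem compProd_envKernel :
    (envLaw p p.averaged) ⊗ₘ (envKernel p) = (2⁻¹ : ℝ≥0∞) •
      ((envLaw p p.ordinary).map (fun s => (s, up s)) +
        (envLaw p p.ordinary).map (fun s => (up s, s))) := by
  have hm := p.mean_pos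
  have m1 : Measurable fun s : Env => (s, up s) := measurable_id.prodMk measurable_up
  have m2 : Measurable fun s : Env => (up s, s) := measurable_up.prodMk measurable_id
  refine Measure.ext_of_lintegral _ fun F hF => ?_
  rw [Measure.lintegral_compProd hF, lintegral_smul_measure, lintegral_add_measure,
    lintegral_map hF m1, lintegral_map hF m2,
    lintegral_envLaw_averaged p hF.lintegral_kernel_prod_right']
  have e : ∀ s : Env, ENNReal.ofReal ((p.mean + (s root).1) / (2 * p.mean)) *
      ∫⁻ s', F (s, s') ∂(envKernel p s) = 2⁻¹ * F (s, up s) +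
        ENNReal.ofReal (2 * p.mean)⁻¹ * ∑ i ∈ Finset.range (s root).1, F (s, down i s) := by
    intro s
    have hFs : Measurable fun s' => F (s, s') := hF.comp (measurable_const.prodMk measurable_id)
    change _ * ∫⁻ s', F (s, s') ∂(envStep p s) = _
    rw [envStep, lintegral_add_measure, lintegral_finsetSum_measure]
    simp only [lintegral_smul_measure, lintegral_dirac' _ hFs, smul_eq_mul]
    rw [← Finset.mul_sum, mul_add, ← mul_assoc, ← mul_assoc, ← ENNReal.ofReal_mul (by positivity),
      ← ENNReal.ofReal_mul (by positivity)]
    have e1 : (p.mean + (s root).1) / (2 * p.mean) * (p.mean / (p.mean + (s root).1)) = 2⁻¹ := by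
      field_simp
    have e2 : (p.mean + (s root).1) / (2 * p.mean) * (1 / (p.mean + (s root).1)) =
        (2 * p.mean)⁻¹ := by
      field_simp
    have e3 : ENNReal.ofReal 2⁻¹ = 2⁻¹ := by
      rw [ENNReal.ofReal_inv_of_pos two_pos, ENNReal.ofReal_ofNat]
    rw [e1, e2, e3]
  have hF1 : Measurable fun s => F (s, up s) := hF.comp m1
  simp_rw [e]
  rw [lintegral_add_left (hF1.const_mul _), lintegral_const_mul _ hF1,
    lintegral_const_mul' _ _ ENNReal.ofReal_ne_top, lintegral_sum_down p hF, ← mul_assoc,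
    ← ENNReal.ofReal_mul (by positivity), smul_eq_mul, mul_add]
  congr 2
  rw [show (2 * p.mean)⁻¹ * p.mean = (2 : ℝ)⁻¹ by field_simp,
    ENNReal.ofReal_inv_of_pos two_pos, ENNReal.ofReal_ofNat]

theorem envKernel_invariant : (envKernel p) ∘ₘ (envLaw p p.averaged) = envLaw p p.averaged := by
  have m1 : Measurable fun s : Env => (s, up s) := measurable_id.prodMk measurable_up
  have m2 : Measurable fun s : Env => (up s, s) := measurable_up.prodMk measurable_id
  rw [← Measure.snd_compProd]
  conv_rhs => rw [← Measure.fst_compProd (envLaw p p.averaged) (envKernel p)]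
  rw [compProd_envKernel, Measure.snd, Measure.fst, Measure.map_smul, Measure.map_smul,
    Measure.map_add _ _ measurable_snd, Measure.map_add _ _ measurable_fst,
    Measure.map_map measurable_snd m1, Measure.map_map measurable_snd m2,
    Measure.map_map measurable_fst m1, Measure.map_map measurable_fst m2, add_comm]
  rfl

/-- The flux identity iterated: under `envLaw p p.ordinary` the law of `up^[n] s` has density `Z_n /
m^n`. -/
theorem lintegral_comp_up_iterate {f : Env → ℝ≥0∞} (hf : Measurable f) (n : ℕ) :
    ENNReal.ofReal p.mean ^ n * ∫⁻ s, f (up^[n] s) ∂(envLaw p p.ordinary) =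
      ∫⁻ s, (((subtree (toTree s) root).generation n).card : ℝ≥0∞) * f s
        ∂(envLaw p p.ordinary) := by
  have hgen : ∀ n, Measurable fun s : Env =>
      (((subtree (toTree s) root).generation n).card : ℝ≥0∞) := fun n =>
    (measurable_of_countable fun k : ℕ => (k : ℝ≥0∞)).comp ((measurable_card_generation n).comp
      ((measurable_subtree root).comp measurable_toTree))
  induction n generalizing f with
  | zero => simp [RootedTree.generation]
  | succ n ih =>
    have h1 := lintegral_sum_down p
      (F := fun q => (((subtree (toTree q.2) root).generation n).card : ℝ≥0∞) * f q.1)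
      (((hgen n).comp measurable_snd).mul (hf.comp measurable_fst))
    simp only [card_generation_toTree_succ, Nat.cast_sum, Finset.sum_mul, Function.iterate_succ_apply',
      pow_succ']
    have h2 := ih (f := fun s => f (up s)) (hf.comp measurable_up)
    rw [h1, mul_assoc, ← h2]

theorem map_subtree_envLaw :
    (envLaw p p.ordinary).map (fun s => subtree (toTree s) root) = GW p := by
  have h := Measure.map_infinitePi_infinitePi_of_inj (P := envLawAt p p.ordinary)
    (f := fun u : List ℕ => (⟨0, u⟩ : Vertex)) fun a b h => by simpa using h
  have e : (fun s : Env => subtree (toTree s) root) =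
      (fun (t : List ℕ → ℕ × ℕ) u => (t u).1) ∘ fun (s : Env) u => s ⟨0, u⟩ := by
    funext s u
    simp [subtree, toTree, root]
  have m1 : Measurable fun (s : Env) (u : List ℕ) => s ⟨0, u⟩ :=
    measurable_pi_lambda _ fun u => measurable_pi_apply _
  have m2 : Measurable fun (t : List ℕ → ℕ × ℕ) u => (t u).1 :=
    measurable_pi_lambda _ fun u => (measurable_pi_apply u).fst
  rw [e, ← Measure.map_map m2 m1, envLaw, h, GW]
  refine (Measure.infinitePi_map_pi (f := fun _ => Prod.fst) _ fun _ => measurable_fst).trans ?_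
  congr 1
  funext u
  have h1 : (p.ordinary.map fun k => (k, 0)).map Prod.fst = p.ordinary := by
    rw [Measure.map_map measurable_fst (measurable_of_countable _)]
    exact Measure.map_id
  cases u <;> exact h1

/-- The iterates of `up` do not charge small sets much, uniformly in the number of iterations. -/
theorem exists_measure_preimage_up_iterate_le :
    ∃ C : ℝ≥0∞, C ≠ ∞ ∧ ∀ (n : ℕ) (B : Set Env), MeasurableSet B →
      envLaw p p.ordinary (up^[n] ⁻¹' B) ≤ C * envLaw p p.ordinary B ^ (1 / 2 : ℝ) := by
  obtain ⟨C, hC, h⟩ := exists_eLpNorm_normGen_le p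
  refine ⟨C, hC, fun n B hB => ?_⟩
  have hm := p.mean_pos
  have hsub : Measurable fun s : Env => subtree (toTree s) root :=
    (measurable_subtree root).comp measurable_toTree
  have hX : Measurable fun s : Env => ENNReal.ofReal (normGen p n (subtree (toTree s) root)) :=
    ((measurable_normGen p n).comp hsub).ennreal_ofReal
  have h1 := lintegral_comp_up_iterate p (measurable_one.indicator hB) n
  have h2 : ∫⁻ s, B.indicator (1 : Env → ℝ≥0∞) (up^[n] s) ∂(envLaw p p.ordinary) =
      envLaw p p.ordinary (up^[n] ⁻¹' B) := by
    rw [← lintegral_indicator_one ((measurable_up.iterate n) hB)]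
    rfl
  have hmn : ENNReal.ofReal p.mean ^ n ≠ 0 := pow_ne_zero _ (by simpa using hm)
  have hmn' : ENNReal.ofReal p.mean ^ n ≠ ∞ := ENNReal.pow_ne_top ENNReal.ofReal_ne_top
  have h3 : envLaw p p.ordinary (up^[n] ⁻¹' B) =
      ∫⁻ s, ENNReal.ofReal (normGen p n (subtree (toTree s) root)) *
        B.indicator (1 : Env → ℝ≥0∞) s ∂(envLaw p p.ordinary) := by
    rw [h2] at h1
    rw [← ENNReal.mul_right_inj hmn hmn', h1, ← lintegral_const_mul' _ _ hmn']
    refine lintegral_congr fun s => ?_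
    rw [← mul_assoc, ← ENNReal.ofReal_pow hm.le, ← ENNReal.ofReal_mul (by positivity), normGen,
      mul_div_cancel₀ _ (by positivity), ENNReal.ofReal_natCast]
  rw [h3]
  -- Cauchy–Schwarz against the density `Z_n / m^n`, whose `L²` norm is bounded in `n`; hence the
  -- square root of the measure of `B`.
  refine (ENNReal.lintegral_mul_le_Lp_mul_Lq _ Real.HolderConjugate.two_two
    hX.aemeasurable (measurable_one.indicator hB).aemeasurable).trans ?_
  refine mul_le_mul' ?_ ?_
  · refine le_trans (le_of_eq ?_) (h n)
    rw [eLpNorm_two_eq, ← map_subtree_envLaw,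
      lintegral_map ((measurable_normGen p n).pow_const 2).ennreal_ofReal hsub]
    congr 1
    refine lintegral_congr fun s => ?_
    rw [ENNReal.rpow_two, ENNReal.ofReal_pow (normGen_nonneg p n _)]
  · refine le_of_eq ?_
    congr 1
    rw [← lintegral_indicator_one hB]
    refine lintegral_congr fun s => ?_
    by_cases hs : s ∈ B <;> simp [hs]

end GWRay

/-! ### Ergodicity of `up` and of the environment chain. -/

namespace GWRay

/-- `up` reads labels one level higher. If `r ≤ 1`, the hypothesis covers `v_1` and with it the
record used for relabelling; if `r > 1`, only labels with positive ray index occur, and their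
relabelling ignores the record. -/
theorem eq_up_of_eq_of_le_level {s s' : Env} {r : ℤ} (h : ∀ v, r ≤ level v → s v = s' v)
    (v : Vertex) (hv : r - 1 ≤ level v) : up s v = up s' v := by
  by_cases hr : r ≤ 1
  · have h1 : s ⟨1, []⟩ = s' ⟨1, []⟩ := h _ (by simpa [level] using hr)
    by_cases hv0 : v = root
    · simp [hv0, up_apply_root, h1]
    · simp only [up, hv0, if_false, h1]
      exact h _ (by rw [level_parentLabel]; linarith)
  · rcases v with ⟨_ | n, w⟩
    · simp only [level] at hv
      push_cast at hv
      have : (0 : ℤ) ≤ w.length := by positivity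
      omega
    · rw [up_apply_succ, up_apply_succ]
      refine h _ ?_
      simp only [level] at hv ⊢
      push_cast at hv ⊢
      linarith

theorem eq_up_iterate_of_eq_of_le_level {s s' : Env} {r : ℤ}
    (h : ∀ v, r ≤ level v → s v = s' v) (n : ℕ) :
    ∀ v, r - n ≤ level v → up^[n] s v = up^[n] s' v := by
  induction n with
  | zero => simpa using h
  | succ n ih =>
    intro v hv
    rw [Function.iterate_succ_apply', Function.iterate_succ_apply']
    exact eq_up_of_eq_of_le_level ih v (by push_cast at hv; linarith)

variable (p : OffspringLaw)

theorem quasiMeasurePreserving_up :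
    Measure.QuasiMeasurePreserving up (envLaw p p.ordinary) (envLaw p p.ordinary) := by
  refine ⟨measurable_up, Measure.AbsolutelyContinuous.mk fun B hB h => ?_⟩
  obtain ⟨C, -, hC⟩ := exists_measure_preimage_up_iterate_le p
  rw [Measure.map_apply measurable_up hB]
  have h1 := hC 1 B hB
  rw [h, ENNReal.zero_rpow_of_pos (by norm_num), mul_zero, Function.iterate_one] at h1
  exact le_antisymm h1 zero_le

/-- Events that depend on finitely many vertices are independent of what is seen far up. -/
theorem exists_measure_inter_preimage_up_iterate {C : Set Env} (hC : MeasurableSet C)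
    {I : Finset Vertex} (hI : DependsOn (· ∈ C) (I : Set Vertex)) :
    ∃ n, envLaw p p.ordinary (C ∩ up^[n] ⁻¹' C) =
      envLaw p p.ordinary C * envLaw p p.ordinary (up^[n] ⁻¹' C) := by
  let L : ℕ := I.sup fun v => (level v).natAbs
  have hL : ∀ v ∈ I, (level v).natAbs ≤ L := fun v hv =>
    Finset.le_sup (f := fun v => (level v).natAbs) hv
  -- Vertices of `I` have levels between `-L` and `L`. After `2 * L + 1` applications of `up` they
  -- read levels at least `L + 1`, disjoint from `I`.
  refine ⟨2 * L + 1, ?_⟩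
  have hdep : DependsOn (· ∈ up^[2 * L + 1] ⁻¹' C) {v | (L : ℤ) + 1 ≤ level v} := by
    intro s s' h
    refine hI fun v hv => eq_up_iterate_of_eq_of_le_level h _ v ?_
    have := hL v hv
    push_cast
    omega
  have hdisj : Disjoint (I : Set Vertex) {v | (L : ℤ) + 1 ≤ level v} := by
    refine Set.disjoint_left.2 fun v hv hv' => ?_
    have h1 := hL v hv
    have h2 : (L : ℤ) + 1 ≤ level v := hv'
    omega
  have hind := indepFun_infinitePi_of_dependsOn (P := envLawAt p p.ordinary) hC.mem
    (((measurable_up.iterate _) hC).mem) hI hdep hdisj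
  have h := indepFun_iff_measure_inter_preimage_eq_mul.1 hind {True} {True} .of_discrete
    .of_discrete
  have e : ∀ B : Set Env, (fun s => s ∈ B) ⁻¹' {True} = B := fun B => by ext s; simp
  rw [e, e] at h
  exact h

/-- A zero–one law. Approximate `A` by a finitely determined `C`; by invariance the preimage of `C`
under `up^[n]` also approximates `A`, with error of order `ε ^ (1 / 2)` uniformly in `n`. For large
`n` the two are independent. -/
theorem measureReal_eq_sq_of_preimage_up {A : Set Env} (hA : MeasurableSet A)
    (h : up ⁻¹' A = A) :
    (envLaw p p.ordinary).real A = (envLaw p p.ordinary).real A ^ 2 := by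
  obtain ⟨K, hK, hKle⟩ := exists_measure_preimage_up_iterate_le p
  set μ := envLaw p p.ordinary
  have key : ∀ ε : ℝ, 0 < ε →
      |μ.real A - μ.real A ^ 2| ≤ 2 * ε + 2 * (K.toReal * ε ^ (1 / 2 : ℝ)) := by
    intro ε hε
    obtain ⟨I, C, hC, hdep, hlt⟩ := exists_dependsOn_measure_symmDiff_lt μ hA
      (ε := ENNReal.ofReal ε) (by simpa using hε)
    obtain ⟨n, hn⟩ := exists_measure_inter_preimage_up_iterate p hC hdep
    have hB : MeasurableSet (up^[n] ⁻¹' C) := (measurable_up.iterate n) hC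
    have hAn : up^[n] ⁻¹' A = A := by
      rw [Set.preimage_iterate_eq]
      exact Function.iterate_fixed h n
    have d1 : μ.real (A ∆ C) ≤ ε := ENNReal.toReal_le_of_le_ofReal hε.le hlt.le
    have d2 : μ.real (A ∆ (up^[n] ⁻¹' C)) ≤ K.toReal * ε ^ (1 / 2 : ℝ) := by
      have e : A ∆ (up^[n] ⁻¹' C) = up^[n] ⁻¹' (A ∆ C) := by
        rw [Set.preimage_symmDiff, hAn]
      have h1 : μ (up^[n] ⁻¹' (A ∆ C)) ≤ K * ENNReal.ofReal ε ^ (1 / 2 : ℝ) :=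
        (hKle n _ (hA.symmDiff hC)).trans
          (mul_le_mul_right (ENNReal.rpow_le_rpow hlt.le (by norm_num)) _)
      rw [e, measureReal_def]
      refine (ENNReal.toReal_mono (ENNReal.mul_ne_top hK
        (ENNReal.rpow_ne_top_of_nonneg (by norm_num) ENNReal.ofReal_ne_top)) h1).trans ?_
      rw [ENNReal.toReal_mul, ← ENNReal.toReal_rpow, ENNReal.toReal_ofReal hε.le]
    have d3 : μ.real (A ∆ (C ∩ up^[n] ⁻¹' C)) ≤
        μ.real (A ∆ C) + μ.real (A ∆ (up^[n] ⁻¹' C)) := by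
      refine (measureReal_mono ?_).trans (measureReal_union_le _ _)
      intro s
      simp only [Set.mem_symmDiff, Set.mem_inter_iff, Set.mem_union]
      tauto
    have a1 := abs_measureReal_sub_le_measureReal_symmDiff (μ := μ) hA.nullMeasurableSet
      hC.nullMeasurableSet
    have a2 := abs_measureReal_sub_le_measureReal_symmDiff (μ := μ) hA.nullMeasurableSet
      hB.nullMeasurableSet
    have a3 := abs_measureReal_sub_le_measureReal_symmDiff (μ := μ) hA.nullMeasurableSet
      (hC.inter hB).nullMeasurableSet
    have hn' : μ.real (C ∩ up^[n] ⁻¹' C) = μ.real C * μ.real (up^[n] ⁻¹' C) := by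
      rw [measureReal_def, hn, ENNReal.toReal_mul]; rfl
    rw [hn'] at a3
    have b1 : |μ.real A| ≤ 1 := by rw [abs_of_nonneg measureReal_nonneg]; exact measureReal_le_one
    have b2 : |μ.real (up^[n] ⁻¹' C)| ≤ 1 := by
      rw [abs_of_nonneg measureReal_nonneg]; exact measureReal_le_one
    have e : μ.real A - μ.real A ^ 2 = (μ.real A - μ.real C * μ.real (up^[n] ⁻¹' C)) -
        ((μ.real A - μ.real C) * μ.real (up^[n] ⁻¹' C) +
          μ.real A * (μ.real A - μ.real (up^[n] ⁻¹' C))) := by ring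
    rw [e]
    refine (abs_sub _ _).trans ?_
    have c1 : |(μ.real A - μ.real C) * μ.real (up^[n] ⁻¹' C)| ≤ μ.real (A ∆ C) := by
      rw [abs_mul]
      exact (mul_le_of_le_one_right (abs_nonneg _) b2).trans a1
    have c2 : |μ.real A * (μ.real A - μ.real (up^[n] ⁻¹' C))| ≤ μ.real (A ∆ (up^[n] ⁻¹' C)) := by
      rw [abs_mul]
      exact (mul_le_of_le_one_left (abs_nonneg _) b1).trans a2
    have c3 := abs_add_le ((μ.real A - μ.real C) * μ.real (up^[n] ⁻¹' C))
      (μ.real A * (μ.real A - μ.real (up^[n] ⁻¹' C)))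
    linarith
  have hlim : Tendsto (fun ε : ℝ => 2 * ε + 2 * (K.toReal * ε ^ (1 / 2 : ℝ))) (𝓝[>] 0) (𝓝 0) := by
    have hc : Continuous fun ε : ℝ => 2 * ε + 2 * (K.toReal * ε ^ (1 / 2 : ℝ)) := by
      have := Real.continuous_rpow_const (q := 1 / 2) (by norm_num)
      fun_prop
    have h0 := hc.tendsto 0
    simp only [mul_zero, Real.zero_rpow (show (1 / 2 : ℝ) ≠ 0 by norm_num), add_zero] at h0
    exact h0.mono_left nhdsWithin_le_nhds
  have h0 := ge_of_tendsto hlim (eventually_mem_nhdsWithin.mono fun ε hε => key ε hε)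
  exact sub_eq_zero.1 (abs_nonpos_iff.1 h0)

theorem quasiErgodic_up : QuasiErgodic up (envLaw p p.ordinary) := by
  refine { quasiMeasurePreserving_up p with aeconst_set := fun A hA h => ?_ }
  have h1 := measureReal_eq_sq_of_preimage_up p hA h
  have h2 : (envLaw p p.ordinary).real A = 0 ∨ (envLaw p p.ordinary).real A = 1 := by
    have : (envLaw p p.ordinary).real A * ((envLaw p p.ordinary).real A - 1) = 0 := by
      linear_combination -h1
    rcases mul_eq_zero.1 this with h | h
    · exact Or.inl h
    · exact Or.inr (by linarith)
  rw [eventuallyConst_set']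
  rcases h2 with h2 | h2
  · left
    exact ae_eq_empty.2 ((measureReal_eq_zero_iff).1 h2)
  · right
    rw [ae_eq_univ]
    have := (prob_compl_eq_zero_iff (μ := envLaw p p.ordinary) hA).2
      (by rwa [measureReal_def, ENNReal.toReal_eq_one_iff] at h2)
    exact this

/-- The only square integrable functions that are harmonic for the tree seen from the walk are
the constants. -/
theorem ae_eq_const_of_harmonic {h : Env → ℝ} (hm : Measurable h)
    (h2 : MemLp h 2 (envLaw p p.averaged))
    (H : ∀ (g : Env → ℝ) (C : ℝ), Measurable g → (∀ s, |g s| ≤ C) →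
      ∫ s, h s * (g s - ∫ z, g z ∂(envKernel p s)) ∂(envLaw p p.averaged) = 0) :
    ∃ c, h =ᵐ[envLaw p p.averaged] fun _ => c := by
  set ν := envLaw p p.averaged
  set μ := envLaw p p.ordinary
  -- `h` may be unbounded and so is not an admissible test function; `arctan ∘ h` is bounded and,
  -- being strictly increasing in `h`, still detects its variation.
  let g : Env → ℝ := fun s => Real.arctan (h s)
  have hg : Measurable g := hm.arctan
  have hgb : ∀ s, |g s| ≤ Real.pi / 2 := fun s =>
    abs_le.2 ⟨(Real.neg_pi_div_two_lt_arctan _).le, (Real.arctan_lt_pi_div_two _).le⟩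
  have hi : Integrable h ν := h2.integrable one_le_two
  have m1 : Measurable fun s : Env => (s, up s) := measurable_id.prodMk measurable_up
  have m2 : Measurable fun s : Env => (up s, s) := measurable_up.prodMk measurable_id
  let G : Env × Env → ℝ := fun q => h q.1 * (g q.1 - g q.2)
  have hG : Measurable G :=
    (hm.comp measurable_fst).mul ((hg.comp measurable_fst).sub (hg.comp measurable_snd))
  have hGi : Integrable G (ν ⊗ₘ (envKernel p)) := by
    have h1 : Integrable (fun q : Env × Env => h q.1) (ν ⊗ₘ (envKernel p)) := by
      have := hi
      rw [← Measure.fst_compProd ν (envKernel p)] at this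
      exact this.comp_measurable measurable_fst
    refine (h1.norm.mul_const Real.pi).mono' hG.aestronglyMeasurable
      (Eventually.of_forall fun q => ?_)
    rw [Real.norm_eq_abs, abs_mul]
    refine mul_le_mul_of_nonneg_left ?_ (abs_nonneg _)
    have := abs_sub (g q.1) (g q.2)
    linarith [hgb q.1, hgb q.2]
  have e1 : ∫ q, G q ∂(ν ⊗ₘ (envKernel p)) = 0 := by
    rw [Measure.integral_compProd hGi, ← H g _ hg hgb]
    refine integral_congr_ae (Eventually.of_forall fun s => ?_)
    have hgi : Integrable g (envKernel p s) :=
      integrable_of_measurable_of_abs_le hg hgb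
    simp only [G]
    rw [integral_const_mul, integral_sub (integrable_const _) hgi, integral_const]
    simp
  have hGi' := hGi
  rw [compProd_envKernel] at e1 hGi'
  have hGi2 := (integrable_smul_measure (by norm_num) (by norm_num)).1 hGi'
  rw [integrable_add_measure, integrable_map_measure hG.aestronglyMeasurable m1.aemeasurable,
    integrable_map_measure hG.aestronglyMeasurable m2.aemeasurable] at hGi2
  rw [integral_smul_measure, integral_add_measure
    ((integrable_map_measure hG.aestronglyMeasurable m1.aemeasurable).2 hGi2.1)
    ((integrable_map_measure hG.aestronglyMeasurable m2.aemeasurable).2 hGi2.2),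
    integral_map m1.aemeasurable hG.aestronglyMeasurable,
    integral_map m2.aemeasurable hG.aestronglyMeasurable] at e1
  -- Symmetrizing with the reversible pair law yields the Dirichlet form of `h` and `g`. By
  -- monotonicity its integrand is nonnegative, so it vanishes almost everywhere and `h ∘ up = h`.
  have e2 : ∫ s, (h s - h (up s)) * (g s - g (up s)) ∂μ = 0 := by
    rcases smul_eq_zero.1 e1 with h0 | h0
    · norm_num at h0
    · rw [← h0]
      refine Eq.trans ?_ (integral_add hGi2.1 hGi2.2)
      refine integral_congr_ae (Eventually.of_forall fun s => ?_)
      simp only [G]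
      ring
  have hint : Integrable (fun s => (h s - h (up s)) * (g s - g (up s))) μ := by
    refine (hGi2.1.add hGi2.2).congr (Eventually.of_forall fun s => ?_)
    simp only [G, Pi.add_apply, Function.comp_apply]
    ring
  have hnn : ∀ s, 0 ≤ (h s - h (up s)) * (g s - g (up s)) := by
    intro s
    rcases le_total (h s) (h (up s)) with hle | hle
    · exact mul_nonneg_of_nonpos_of_nonpos (sub_nonpos.2 hle)
        (sub_nonpos.2 (Real.arctan_strictMono.monotone hle))
    · exact mul_nonneg (sub_nonneg.2 hle) (sub_nonneg.2 (Real.arctan_strictMono.monotone hle))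
  have h3 := (integral_eq_zero_iff_of_nonneg hnn hint).1 e2
  have h4 : h ∘ up =ᵐ[μ] h := by
    filter_upwards [h3] with s hs
    rcases mul_eq_zero.1 hs with h5 | h5
    · exact (sub_eq_zero.1 h5).symm
    · exact (Real.arctan_injective (sub_eq_zero.1 h5)).symm
  obtain ⟨c, hc⟩ := (quasiErgodic_up p).ae_eq_const_of_ae_eq_comp₀ hm.nullMeasurable h4
  exact ⟨c, (envLaw_averaged_absolutelyContinuous p).ae_eq hc⟩

/-- The ergodic theorem for the tree seen from the walk, applied to `muSq`. -/
theorem ae_tendsto_average_muSq :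
    ∀ᵐ T ∂(IGWR p), ∀ᵐ X ∂(quenched p T),
      Tendsto (fun n : ℕ => (∑ i ∈ Finset.range n, muSq p T (X i)) / n) atTop
        (𝓝 (∫ T', muSq p T' root ∂(IGWR p))) := by
  have hmu := (measurable_muSq_root p).comp measurable_toTree
  have hint : Integrable (fun s => muSq p (toTree s) root) (envLaw p p.averaged) := by
    have := integrable_muSq_root p
    rw [← map_toTree_envLaw] at this
    exact this.comp_measurable measurable_toTree
  have h := ae_tendsto_average_chainLaw (envKernel p) (envKernel_invariant p)
    (fun h hm h2 H => ae_eq_const_of_harmonic p hm h2 H) hmu hint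
  have e : ∫ s, muSq p (toTree s) root ∂(envLaw p p.averaged) =
      ∫ T', muSq p T' root ∂(IGWR p) := by
    rw [← map_toTree_envLaw, integral_map measurable_toTree.aemeasurable
      (measurable_muSq_root p).aestronglyMeasurable]
  rw [← map_toTree_envLaw]
  -- The quenched property depends only on the tree, so the recorded positions are forgotten; this
  -- transfer requires no measurability of the property in `T`.
  refine ae_map_of_ae_of_standardBorel measurable_toTree ?_
  filter_upwards [h, ae_good p p.averaged] with s hs hgood
  rw [← map_quenched p hgood] at hs
  have hm' : Measurable fun (X : Trajectory) n => env s (X n) :=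
    measurable_pi_lambda _ fun n => (measurable_of_countable (env s)).comp (measurable_pi_apply n)
  have h1 := ae_of_ae_map hm'.aemeasurable hs
  rw [map_toTree_envLaw, ← e]
  filter_upwards [h1] with X hX
  simp only [muSq_toTree p hgood]
  exact hX

end GWRay

/-! ### Conditional variances of `M`, and the conclusion. -/

namespace GWRay

theorem parent_notMem_offspring (T : RayTree) (v : Vertex) : parent v ∉ offspring T v := by
  intro h
  have h1 := parent_of_mem_offspring h
  rcases v with ⟨j, _ | ⟨a, _ | ⟨b, w⟩⟩⟩
  · simp [parent] at h1
    omega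
  · simp [parent] at h1
  · have h2 := congrArg (fun v => v.path.length) h1
    simp [parent] at h2
    omega

variable (p : OffspringLaw)

/-- The increment of `M` along a step from `v` to `u`. -/
noncomputable def increment (T : RayTree) (v u : Vertex) : ℝ :=
  if u = parent v then -W p T v else if u ∈ offspring T v then W p T u else 0

theorem M_succ_sub (T : RayTree) (t : ℕ) (X : Trajectory) :
    M p T (t + 1) X - M p T t X = increment p T (X t) (X (t + 1)) := by
  rw [M, add_sub_cancel_left, increment]

theorem integrable_comp_of_ae_mem_finset {Ω β : Type*} [MeasurableSpace Ω] [MeasurableSpace β]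
    [DiscreteMeasurableSpace β] {μ : Measure Ω} [IsFiniteMeasure μ] {Y : Ω → β}
    (hY : Measurable Y) {F : Finset β} (hF : ∀ᵐ ω ∂μ, Y ω ∈ F) (f : β → ℝ) :
    Integrable (fun ω => f (Y ω)) μ := by
  refine (integrable_const (∑ b ∈ F, |f b|)).mono'
    ((Measurable.of_discrete (f := f)).comp hY).aestronglyMeasurable ?_
  filter_upwards [hF] with ω hω
  exact Finset.single_le_sum (f := fun b => |f b|) (fun _ _ => abs_nonneg _) hω

theorem integral_stepMeasure (T : RayTree) (v : Vertex) (φ : Vertex → ℝ) :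
    ∫ u, φ u ∂(stepMeasure p T v) = p.mean / (p.mean + deg T v) * φ (parent v) +
      1 / (p.mean + deg T v) * ∑ u ∈ offspring T v, φ u := by
  have hm := p.mean_pos
  have hi : ∀ (c : ℝ) (u : Vertex), Integrable φ (ENNReal.ofReal c • Measure.dirac u) :=
    fun c u => (integrable_dirac (by simp)).smul_measure ENNReal.ofReal_ne_top
  rw [stepMeasure, integral_add_measure (hi _ _)
    (integrable_finsetSum_measure.2 fun u _ => hi _ u), integral_finsetSum_measure fun u _ => hi _ u]
  simp only [integral_smul_measure, integral_dirac, smul_eq_mul]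
  rw [ENNReal.toReal_ofReal (by positivity), ENNReal.toReal_ofReal (by positivity),
    Finset.mul_sum]

/-- The parent contributes `m / (m + d_v) * W_v²`; harmonicity of `W` turns this into the second
term of `μ_v²`. -/
theorem integral_increment_sq {T : RayTree} (hT : ∀ v, HasW p T v) (v : Vertex) :
    ∫ u, increment p T v u ^ 2 ∂(stepMeasure p T v) = muSq p T v := by
  have hm := p.mean_pos
  have h1 : ∑ u ∈ offspring T v, increment p T v u ^ 2 = ∑ u ∈ offspring T v, W p T u ^ 2 := by
    refine Finset.sum_congr rfl fun u hu => ?_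
    have : u ≠ parent v := fun h => parent_notMem_offspring T v (h ▸ hu)
    simp [increment, this, hu]
  have h2 : increment p T v (parent v) ^ 2 =
      (p.mean⁻¹ * ∑ u ∈ offspring T v, W p T u) ^ 2 := by
    rw [← W_eq_sum p hT v]
    simp [increment]
  rw [integral_stepMeasure, h1, h2, muSq, add_comm]
  congr 1
  field_simp

/-- The vertices that the walk may occupy at a given time. -/
noncomputable def reachable (T : RayTree) : ℕ → Finset Vertex
  | 0 => {root}
  | n + 1 => (reachable T n).biUnion fun v => insert (parent v) (offspring T v)

theorem ae_stepMeasure (T : RayTree) (v : Vertex) :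
    ∀ᵐ u ∂(stepMeasure p T v), u ∈ insert (parent v) (offspring T v) := by
  rw [ae_iff, stepMeasure]
  simp only [Measure.add_apply, Measure.smul_apply, Measure.coe_finsetSum, Finset.sum_apply,
    Measure.dirac_apply, smul_eq_mul, add_eq_zero, Finset.sum_eq_zero_iff, mul_eq_zero]
  refine ⟨Or.inr ?_, fun u hu => Or.inr ?_⟩
  · simp
  · simp [hu]

theorem isMarkovLaw_quenched (T : RayTree) : IsMarkovLaw (stepKernel p T) (quenched p T) :=
  isMarkovLaw_chainLaw (stepKernel p T) root

theorem ae_mem_reachable (T : RayTree) (n : ℕ) : ∀ᵐ X ∂(quenched p T), X n ∈ reachable T n := by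
  induction n with
  | zero =>
    have h := map_zero_chainLaw (stepKernel p T) root
    have h1 : ∀ᵐ v ∂((quenched p T).map fun X => X 0), v ∈ reachable T 0 := by
      rw [quenched_eq_chainLaw, h]
      simp [ae_dirac_eq, reachable]
    exact ae_of_ae_map (measurable_pi_apply 0).aemeasurable h1
  | succ n ih =>
    have hm : Measurable fun X : Trajectory => (X n, X (n + 1)) := by fun_prop
    have h1 : ∀ᵐ q ∂((quenched p T).map fun X => (X n, X (n + 1))),
        q.2 ∈ insert (parent q.1) (offspring T q.1) := by
      rw [(isMarkovLaw_quenched p T).map_succ n]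
      refine (Measure.ae_compProd_iff .of_discrete).2 (Eventually.of_forall fun v => ?_)
      exact ae_stepMeasure p T v
    filter_upwards [ih, ae_of_ae_map hm.aemeasurable h1] with X hX hX'
    exact Finset.mem_biUnion.2 ⟨X n, hX, hX'⟩

/-- At each time the walk occupies one of finitely many vertices, so any function of a step is
integrable, whatever value `W` takes where its limit fails to exist. -/
theorem integrable_quenched (T : RayTree) (n : ℕ) (f : Vertex → Vertex → ℝ) :
    Integrable (fun X => f (X n) (X (n + 1))) (quenched p T) := by
  have hm : Measurable fun X : Trajectory => (X n, X (n + 1)) := by fun_prop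
  refine integrable_comp_of_ae_mem_finset hm (F := reachable T n ×ˢ reachable T (n + 1)) ?_
    fun q => f q.1 q.2
  filter_upwards [ae_mem_reachable p T n, ae_mem_reachable p T (n + 1)] with X h1 h2
  exact Finset.mk_mem_product h1 h2

theorem integrable_increment_sq (T : RayTree) (i : ℕ) :
    Integrable (fun X => (M p T (i + 1) X - M p T i X) ^ 2) (quenched p T) := by
  simp only [M_succ_sub]
  exact integrable_quenched p T i fun v u => increment p T v u ^ 2

theorem pastSigma_le_comap (i : ℕ) : pastSigma i ≤ MeasurableSpace.comap
    (Preorder.frestrictLe (π := fun _ : ℕ => Vertex) i) inferInstance := by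
  refine iSup₂_le fun s hs => ?_
  rw [← measurable_iff_comap_le]
  have h : (fun X : Trajectory => X s) = (fun x : Finset.Iic i → Vertex =>
      x ⟨s, Finset.mem_Iic.2 (Finset.mem_Icc.1 hs).2⟩) ∘
        Preorder.frestrictLe (π := fun _ : ℕ => Vertex) i := rfl
  rw [h]
  exact (measurable_pi_apply _).comp (comap_measurable _)

/-- The conditional variance of an increment of `M` is `muSq` at the position of the walk. -/
theorem condExp_increment_sq {T : RayTree} (hT : ∀ v, HasW p T v) {i : ℕ} (hi : 1 ≤ i) :
    (quenched p T)[fun Y => (M p T (i + 1) Y - M p T i Y) ^ 2 | pastSigma i]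
      =ᵐ[quenched p T] fun X => muSq p T (X i) := by
  have hle : pastSigma i ≤ (inferInstance : MeasurableSpace Trajectory) :=
    iSup₂_le fun s _ => (measurable_pi_apply s).comap_le
  -- `X_0` is not among the generators of `pastSigma i`, so `1 ≤ i` is needed for `X_i` to be
  -- measurable.
  have hX : Measurable[pastSigma i] fun X : Trajectory => X i :=
    Measurable.mono (comap_measurable _)
      (le_iSup₂_of_le i (Finset.mem_Icc.2 ⟨hi, le_rfl⟩) le_rfl) le_rfl
  have hg := integrable_quenched p T i fun v _ => muSq p T v
  have hf := integrable_increment_sq p T i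
  refine (ae_eq_condExp_of_forall_setIntegral_eq hle hf (fun _ _ _ => hg.integrableOn) ?_ ?_).symm
  · intro s hs _
    -- Every event of `pastSigma i` is an event of the full past `X_0, …, X_i`, so the Markov
    -- property can be integrated against its indicator.
    obtain ⟨A, hA, rfl⟩ := pastSigma_le_comap i s hs
    have hs' : MeasurableSet (Preorder.frestrictLe (π := fun _ : ℕ => Vertex) i ⁻¹' A) :=
      measurable_past i hA
    let G : (Finset.Iic i → Vertex) × Vertex → ℝ := fun q =>
      A.indicator (fun _ => (1 : ℝ)) q.1 *
        increment p T (q.1 ⟨i, Finset.mem_Iic.2 le_rfl⟩) q.2 ^ 2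
    have hG : Measurable G := by
      refine ((measurable_const.indicator hA).comp measurable_fst).mul ?_
      have h1 : Measurable fun q : (Finset.Iic i → Vertex) × Vertex =>
          (q.1 ⟨i, Finset.mem_Iic.2 le_rfl⟩, q.2) := by fun_prop
      exact (Measurable.of_discrete
        (f := fun q : Vertex × Vertex => increment p T q.1 q.2 ^ 2)).comp h1
    have e : ∀ (φ : Trajectory → ℝ) (X : Trajectory),
        (Preorder.frestrictLe (π := fun _ : ℕ => Vertex) i ⁻¹' A).indicator φ X =
          A.indicator (fun _ => (1 : ℝ)) (Preorder.frestrictLe (π := fun _ : ℕ => Vertex) i X) *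
            φ X := by
      intro φ X
      by_cases h : Preorder.frestrictLe (π := fun _ : ℕ => Vertex) i X ∈ A
      · rw [Set.indicator_of_mem (Set.mem_preimage.2 h), Set.indicator_of_mem h, one_mul]
      · rw [Set.indicator_of_notMem (fun h' => h (Set.mem_preimage.1 h')),
          Set.indicator_of_notMem h, zero_mul]
    have hGi : Integrable (fun X : Trajectory =>
        G (Preorder.frestrictLe (π := fun _ => Vertex) i X, X (i + 1))) (quenched p T) := by
      refine (hf.indicator hs').congr (Eventually.of_forall fun X => ?_)
      simp only [e, M_succ_sub]
      rfl
    rw [← integral_indicator hs', ← integral_indicator hs']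
    simp only [e, M_succ_sub]
    refine Eq.trans ?_ ((isMarkovLaw_quenched p T).integral_eq i hG hGi).symm
    refine integral_congr_ae (Eventually.of_forall fun X => ?_)
    simp only [G]
    rw [integral_const_mul, ← integral_increment_sq p hT]
    rfl
  · exact ((Measurable.of_discrete (f := muSq p T)).comp hX).aestronglyMeasurable

/-- `V` averages over `1, …, t` instead of `0, …, t - 1`: this costs the term `f 0 / t` and a factor
`(t + 1) / t`. -/
theorem tendsto_average_Icc {f : ℕ → ℝ} {L : ℝ}
    (h : Tendsto (fun n : ℕ => (∑ i ∈ Finset.range n, f i) / n) atTop (𝓝 L)) :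
    Tendsto (fun t : ℕ => 1 / (t : ℝ) * ∑ i ∈ Finset.Icc 1 t, f i) atTop (𝓝 L) := by
  have h1 := (tendsto_add_atTop_iff_nat 1).2 h
  have h2 : Tendsto (fun t : ℕ => ((t : ℝ) + 1) / t) atTop (𝓝 1) := by
    have h3 : Tendsto (fun t : ℕ => 1 + 1 / (t : ℝ)) atTop (𝓝 (1 + 0)) :=
      tendsto_const_nhds.add tendsto_one_div_atTop_nhds_zero_nat
    rw [add_zero] at h3
    refine h3.congr' ?_
    filter_upwards [eventually_gt_atTop 0] with t ht
    field_simp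
  have h4 := (h1.mul h2).sub (tendsto_const_div_atTop_nhds_zero_nat (f 0))
  rw [mul_one, sub_zero] at h4
  refine h4.congr' ?_
  filter_upwards [eventually_gt_atTop 0] with t ht
  have e : ∑ i ∈ Finset.range (t + 1), f i = f 0 + ∑ i ∈ Finset.Icc 1 t, f i := by
    rw [Finset.range_eq_Ico, Finset.sum_eq_sum_Ico_succ_bot (Nat.succ_pos t)]
    rfl
  have ht' : (t : ℝ) ≠ 0 := by positivity
  rw [e]
  push_cast
  field_simp
  ring

theorem ae_tendsto_V : ∀ᵐ T ∂(IGWR p), ∀ᵐ X ∂(quenched p T),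
    Tendsto (fun t : ℕ => V p T t X) atTop (𝓝 (∫ T', muSq p T' root ∂(IGWR p))) := by
  filter_upwards [ae_tendsto_average_muSq p, ae_hasW p] with T h hT
  have hc : ∀ᵐ X ∂(quenched p T), ∀ i : ℕ, 1 ≤ i →
      ((quenched p T)[fun Y => (M p T (i + 1) Y - M p T i Y) ^ 2 | pastSigma i]) X =
        muSq p T (X i) :=
    ae_all_iff.2 fun i => by
      by_cases hi : 1 ≤ i
      · filter_upwards [condExp_increment_sq p hT hi] with X hX _ using hX
      · exact Eventually.of_forall fun X h => absurd h hi
  filter_upwards [h, hc] with X hX hXc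
  refine (tendsto_average_Icc hX).congr fun t => ?_
  rw [V]
  congr 1
  exact Finset.sum_congr rfl fun i hi => (hXc i (Finset.mem_Icc.1 hi).1).symm

end GWRay

theorem corollary1 (p : GWRay.OffspringLaw) :
    -- the limits that define `W`, and the expectations that define `η` and `σ`, exist
    (∀ᵐ τ ∂(GWRay.GW p), Tendsto (fun n : ℕ => ((τ.generation n).card : ℝ) / p.mean ^ n)
        atTop (𝓝 (GWRay.rootW p τ))) ∧
    (∀ᵐ T ∂(GWRay.IGWR p), ∀ v : GWRay.Vertex,
        Tendsto (fun n : ℕ => (GWRay.Z T v n : ℝ) / p.mean ^ n) atTop (𝓝 (GWRay.W p T v))) ∧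
    Integrable (fun τ => GWRay.rootW p τ ^ 2) (GWRay.GW p) ∧
    0 < GWRay.eta p ∧
    Integrable (fun T => GWRay.muSq p T GWRay.root) (GWRay.IGWR p) ∧
    -- the conditional variances that make up `V` are genuine
    (∀ (T : GWRay.RayTree) (i : ℕ),
      Integrable (fun X => (GWRay.M p T (i + 1) X - GWRay.M p T i X) ^ 2) (GWRay.quenched p T)) ∧
    -- the convergence of `V_t`, for almost every tree and almost every trajectory of the walk
    (∀ᵐ T ∂(GWRay.IGWR p), ∀ᵐ X ∂(GWRay.quenched p T),
      Tendsto (fun t : ℕ => GWRay.V p T t X) atTop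
        (𝓝 (∫ T', GWRay.muSq p T' GWRay.root ∂(GWRay.IGWR p)))) ∧
    ∫ T, GWRay.muSq p T GWRay.root ∂(GWRay.IGWR p) = GWRay.sigmaSq p * GWRay.eta p ^ 2 := by
  refine ⟨GWRay.ae_tendsto_rootW p, GWRay.ae_hasW p, GWRay.integrable_rootW_sq p,
    GWRay.eta_pos p, GWRay.integrable_muSq_root p, GWRay.integrable_increment_sq p,
    GWRay.ae_tendsto_V p, ?_⟩
  -- `σ²` is a quotient by `η²`, so the last equality uses `η ≠ 0`.
  rw [GWRay.sigmaSq, div_mul_cancel₀ _ (pow_ne_zero 2 (GWRay.eta_pos p).ne')]
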